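/- For a finite simple undirected graph $G=(V,E)$ and $S\subseteq V$ let $\partial(S)$ be the set of edges of $G$ with exactly one endpoint in $S$. Consider the following decision problems, whose input is a graph $G$, a tree decomposition of $G$, a positive integer $k$ and, in the $st$-versions, two vertices $s,t\in V$. * Maximum Connected Cut: is there a proper subset $S\subset V$ such that $G[S]$ is connected and $|\partial(S)|\ge k$? * Largest Bond: is there a proper subset $S\subset V$ such that $G[S]$ and $G[V\setminus S]$ are both connected and $|\partial(S)|\ge k$? * Maximum Connected $st$-Cut and Largest $st$-Bond: the same questions, with the additional requirement that $s\in S$ and $t\notin S$. Let $tw$ denote the width of the given tree decomposition, that is, the maximum size of a bag minus one, and let $O^*$ suppress factors that are polynomial in the input size. Then there are Monte-Carlo algorithms (randomized random-access machines with logarithmic cost that toss fair coins, the running time being bounded for all outcomes of the coin tosses) that solve Largest Bond and Largest $st$-Bond in time $O^*(4^{tw})$, and Maximum Connected Cut and Maximum Connected $st$-Cut in time $O^*(3^{tw})$. Each of these algorithms never answers "yes" on a no-instance (no false positives), and on every yes-instance it answers "no" with probability at most $1/2$ (false negatives). -/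

import Mathlib

open MeasureTheory

namespace ConnectedCuts

/-! ### Cuts, bonds and tree decompositions -/

/-- The cut-set `∂(S)`: the edges of `G` with one endpoint in `S` and the other one outside `S`. -/
def cutSet {V : Type} (G : SimpleGraph V) (S : Set V) : Set (Sym2 V) :=
  {e | e ∈ G.edgeSet ∧ ∃ u ∈ S, ∃ v ∉ S, e = s(u, v)}

/-- A tree decomposition of `G` whose tree has the `m` nodes `0, …, m - 1`. -/
structure TreeDecomposition {V : Type} (G : SimpleGraph V) (m : ℕ) where
  tree : SimpleGraph (Fin m)
  isTree : tree.IsTree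
  bag : Fin m → Finset V
  vertex_mem : ∀ v, ∃ i, v ∈ bag i
  edge_mem : ∀ u v, G.Adj u v → ∃ i, u ∈ bag i ∧ v ∈ bag i
  connected : ∀ v, (tree.induce {i | v ∈ bag i}).Preconnected

/-- The width: the maximum cardinality of a bag, minus one. -/
def TreeDecomposition.width {V : Type} {G : SimpleGraph V} {m : ℕ}
    (D : TreeDecomposition G m) : ℕ :=
  (Finset.univ.sup fun i => (D.bag i).card) - 1

/-- A finite simple graph on the vertices `0, …, n - 1`, a tree decomposition of it and a positive
integer `k`. -/
structure CutInstance where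
  n : ℕ
  G : SimpleGraph (Fin n)
  m : ℕ
  D : TreeDecomposition G m
  k : ℕ
  k_pos : 0 < k

/-- An instance together with two vertices `s` and `t`. -/
structure STCutInstance extends CutInstance where
  s : Fin n
  t : Fin n

def MaximumConnectedCut (x : CutInstance) : Prop :=
  ∃ S : Set (Fin x.n), S ⊂ Set.univ ∧
    (x.G.induce S).Connected ∧ x.k ≤ (cutSet x.G S).ncard

def LargestBond (x : CutInstance) : Prop :=
  ∃ S : Set (Fin x.n), S ⊂ Set.univ ∧
    (x.G.induce S).Connected ∧ (x.G.induce Sᶜ).Connected ∧ x.k ≤ (cutSet x.G S).ncard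

def MaximumConnectedSTCut (x : STCutInstance) : Prop :=
  ∃ S : Set (Fin x.n), S ⊂ Set.univ ∧ x.s ∈ S ∧ x.t ∉ S ∧
    (x.G.induce S).Connected ∧ x.k ≤ (cutSet x.G S).ncard

def LargestSTBond (x : STCutInstance) : Prop :=
  ∃ S : Set (Fin x.n), S ⊂ Set.univ ∧ x.s ∈ S ∧ x.t ∉ S ∧
    (x.G.induce S).Connected ∧ (x.G.induce Sᶜ).Connected ∧ x.k ≤ (cutSet x.G S).ncard

/-! ### Encoding of the instances as lists of natural numbers -/

open Classical in
/-- The adjacency matrix, row by row. -/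
noncomputable def adjCode {n : ℕ} (G : SimpleGraph (Fin n)) : List ℕ :=
  List.ofFn fun p : Fin (n * n) => if G.Adj p.divNat p.modNat then 1 else 0

/-- The node-vertex incidence matrix of the bags, row by row. -/
def bagCode {n m : ℕ} (bag : Fin m → Finset (Fin n)) : List ℕ :=
  List.ofFn fun p : Fin (m * n) => if p.modNat ∈ bag p.divNat then 1 else 0

noncomputable def CutInstance.code (x : CutInstance) : List ℕ :=
  [x.n, x.m, x.k] ++ adjCode x.G ++ adjCode x.D.tree ++ bagCode x.D.bag

noncomputable def STCutInstance.code (x : STCutInstance) : List ℕ :=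
  [x.n, x.m, x.k, (x.s : ℕ), (x.t : ℕ)] ++ adjCode x.G ++ adjCode x.D.tree ++ bagCode x.D.bag

/-- The size of an input: the bits of all its numbers, plus one separator per number. -/
def inputSize (l : List ℕ) : ℕ :=
  (l.map fun a => Nat.size a + 1).sum

/-! ### Randomized random-access machines with logarithmic cost

A program is a structured program over registers `0, 1, 2, …` (named directly, so that a program
uses finitely many of them) and an infinite memory that is addressed indirectly. Every instruction
costs one plus the number of bits of all the numbers and addresses that it handles. -/

inductive Op
  | add | sub | mul | div

/-- Subtraction is truncated and division rounds down (division by zero gives zero). -/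
def Op.eval : Op → ℕ → ℕ → ℕ
  | .add, a, b => a + b
  | .sub, a, b => a - b
  | .mul, a, b => a * b
  | .div, a, b => a / b

inductive Prog
  /-- Do nothing. -/
  | skip
  /-- `reg x := c` -/
  | const (x c : ℕ)
  /-- `reg x := reg y ∘ reg z` -/
  | arith (o : Op) (x y z : ℕ)
  /-- `reg x := mem (reg a)` -/
  | load (x a : ℕ)
  /-- `mem (reg a) := reg x` -/
  | store (a x : ℕ)
  /-- `reg x :=` the outcome, 0 or 1, of a fresh coin toss -/
  | flip (x : ℕ)
  | seq (p q : Prog)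
  /-- if `reg x ≠ 0` then `p` else `q` -/
  | cond (x : ℕ) (p q : Prog)
  /-- while `reg x ≠ 0` do `p` -/
  | loop (x : ℕ) (p : Prog)

/-- Registers, memory, and the number of coins tossed so far. -/
structure State where
  reg : ℕ → ℕ
  mem : ℕ → ℕ
  tosses : ℕ

def State.setReg (σ : State) (x v : ℕ) : State :=
  { σ with reg := Function.update σ.reg x v }

def State.setMem (σ : State) (a v : ℕ) : State :=
  { σ with mem := Function.update σ.mem a v }

/-- Initially the input stands in the first memory cells and everything else is zero. -/
def State.init (input : List ℕ) : State where
  reg := fun _ => 0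
  mem := fun a => input.getD a 0
  tosses := 0

/-- `Exec ω p σ σ' c`: if the outcomes of the coin tosses are `ω 0, ω 1, …`, then the program `p`,
started in state `σ`, halts in state `σ'` at cost `c`. -/
inductive Exec (ω : ℕ → Bool) : Prog → State → State → ℕ → Prop
  | skip (σ : State) : Exec ω .skip σ σ 1
  | const (σ : State) (x c : ℕ) : Exec ω (.const x c) σ (σ.setReg x c) (1 + Nat.size c)
  | arith (σ : State) (o : Op) (x y z : ℕ) :
      Exec ω (.arith o x y z) σ (σ.setReg x (o.eval (σ.reg y) (σ.reg z)))
        (1 + Nat.size (σ.reg y) + Nat.size (σ.reg z) +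
          Nat.size (o.eval (σ.reg y) (σ.reg z)))
  | load (σ : State) (x a : ℕ) :
      Exec ω (.load x a) σ (σ.setReg x (σ.mem (σ.reg a)))
        (1 + Nat.size (σ.reg a) + Nat.size (σ.mem (σ.reg a)))
  | store (σ : State) (a x : ℕ) :
      Exec ω (.store a x) σ (σ.setMem (σ.reg a) (σ.reg x))
        (1 + Nat.size (σ.reg a) + Nat.size (σ.reg x))
  | flip (σ : State) (x : ℕ) :
      Exec ω (.flip x) σ
        { σ.setReg x (if ω σ.tosses then 1 else 0) with tosses := σ.tosses + 1 } 1
  | seq {p q : Prog} {σ σ₁ σ₂ : State} {c d : ℕ} :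
      Exec ω p σ σ₁ c → Exec ω q σ₁ σ₂ d → Exec ω (.seq p q) σ σ₂ (c + d)
  | cond_true {x : ℕ} {p q : Prog} {σ σ₁ : State} {c : ℕ} :
      σ.reg x ≠ 0 → Exec ω p σ σ₁ c →
        Exec ω (.cond x p q) σ σ₁ (1 + Nat.size (σ.reg x) + c)
  | cond_false {x : ℕ} {p q : Prog} {σ σ₁ : State} {c : ℕ} :
      σ.reg x = 0 → Exec ω q σ σ₁ c →
        Exec ω (.cond x p q) σ σ₁ (1 + Nat.size (σ.reg x) + c)
  | loop_true {x : ℕ} {p : Prog} {σ σ₁ σ₂ : State} {c d : ℕ} :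
      σ.reg x ≠ 0 → Exec ω p σ σ₁ c → Exec ω (.loop x p) σ₁ σ₂ d →
        Exec ω (.loop x p) σ σ₂ (1 + Nat.size (σ.reg x) + c + d)
  | loop_false {x : ℕ} {p : Prog} {σ : State} :
      σ.reg x = 0 → Exec ω (.loop x p) σ σ (1 + Nat.size (σ.reg x))

/-- The program halts on the input at cost at most `T`. -/
def Prog.HaltsWithin (p : Prog) (ω : ℕ → Bool) (input : List ℕ) (T : ℕ) : Prop :=
  ∃ σ c, Exec ω p (State.init input) σ c ∧ c ≤ T

/-- The program halts on the input with a nonzero number in register `0`, the answer "yes". -/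
def Prog.Accepts (p : Prog) (ω : ℕ → Bool) (input : List ℕ) : Prop :=
  ∃ σ c, Exec ω p (State.init input) σ c ∧ σ.reg 0 ≠ 0

/-- The law of a sequence of independent fair coin tosses. -/
noncomputable def coinMeasure : Measure (ℕ → Bool) :=
  Measure.infinitePi fun _ : ℕ => (PMF.uniformOfFintype Bool).toMeasure

/-- `p` decides the problem `yes` at cost at most `T x` on the instance `x`, whatever the coins are;
it never accepts a no-instance, and it fails to accept a yes-instance with probability at
most `1 / 2`. -/
def IsMonteCarloAlgorithm {I : Type} (code : I → List ℕ) (yes : I → Prop) (T : I → ℕ)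
    (p : Prog) : Prop :=
  ∀ x : I,
    (∀ ω, p.HaltsWithin ω (code x) (T x)) ∧
    (¬ yes x → ∀ ω, ¬ p.Accepts ω (code x)) ∧
    (yes x → coinMeasure {ω | ¬ p.Accepts ω (code x)} ≤ 1 / 2)

/-- There is a Monte-Carlo algorithm for the problem `yes` with running time `O*(b ^ tw)`, that is,
`b ^ tw` times a polynomial in the size of the input. -/
def MonteCarloSolvable {I : Type} (code : I → List ℕ) (yes : I → Prop) (b : ℕ)
    (tw : I → ℕ) : Prop :=
  ∃ (p : Prog) (f : Polynomial ℕ),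
    IsMonteCarloAlgorithm code yes (fun x => b ^ tw x * f.eval (inputSize (code x))) p

end ConnectedCuts

open MeasureTheory

namespace ConnectedCuts

/-! ### Compilation of expressions and loops to machine programs, with cost bounds -/

/-! ### Executions -/

/-! The method is "cut and count". Colour the vertices with `q` colours, two of them for the side
`S` and `q - 2` for the complement, and call a colouring consistent if adjacent vertices on the same
side have the same colour. A consistent colouring chooses one colour per connected component, so a
fixed `S` has `2 ^ c(S)` of them if `q = 3` and `2 ^ (c(S) + c(V \ S))` if `q = 4`, where `c` counts
components. If both sides are nonempty, this is divisible by `2 ^ (q - 2)`, and the quotient is odd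
exactly when `S` is a solution (`exists_numColorings`). Hence connectivity, a global condition, can
be tested by counting colourings subject to local conditions.

Solutions could still cancel modulo two. Therefore each vertex gets a random polynomial over `ZMod
2` of degree below `N` as its weight. The solutions of maximum cut size contribute the value, at
this random point, of a nonzero multilinear polynomial (distinct sets give distinct monomials). By
Schwartz–Zippel over the domain `(ZMod 2)[X]` the value is zero with probability at most `n / 2 ^ N
≤ 1 / 2` (`card_bad_le`). If there is no solution with a large enough cut, the coefficients tested
vanish for all coins (`exists_of_test`).

Everything is packed into one natural number: a cut edge has the weight `X ^ N ^ 2`, so that cut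
sizes occupy disjoint ranges of exponents, and `X` is replaced by `2 ^ N ^ 2`, which exceeds all
coefficients. The result `genNumber` is below `2 ^ N ^ 6`, and its digits are the coefficients of
`genPoly`.

This number is a sum over colourings of products of factors of vertices and edges, so it is computed
by eliminating the bags of the tree decomposition one by one (`message_root_eq`). A bag `B` has `q ^
|B| ≤ q ^ (tw + 1)` colourings, and each costs polynomial time. For the machine, the algorithm is
written in a small language of expressions with bounded sums and products, and of commands with
loops; its compilation is proved correct with a cost bound (`Cmd.exists_compile_spec`), in which
only loops over register `2`, the number of colourings, are expensive. -/

/-- `Accepts` speaks of some execution. By determinism one exhibited run decides it, which is needed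
to exclude false positives. -/
theorem Exec.deterministic {ω : ℕ → Bool} {p : Prog} {σ σ₁ : State} {c₁ : ℕ}
    (h₁ : Exec ω p σ σ₁ c₁) : ∀ {σ₂ : State} {c₂ : ℕ}, Exec ω p σ σ₂ c₂ → σ₁ = σ₂ := by
  induction h₁ with
  | skip | const | arith | load | store | flip => intro σ₂ c₂ h; cases h; rfl
  | seq _ _ ih₁ ih₂ =>
    intro σ₂ c₂ h; cases h with
    | seq h₁ h₂ => cases ih₁ h₁; exact ih₂ h₂
  | cond_true hx _ ih =>
    intro σ₂ c₂ h; cases h with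
    | cond_true _ h => exact ih h
    | cond_false h0 _ => exact absurd h0 hx
  | cond_false hx _ ih =>
    intro σ₂ c₂ h; cases h with
    | cond_true h0 _ => exact absurd hx h0
    | cond_false _ h => exact ih h
  | loop_true hx _ _ ih₁ ih₂ =>
    intro σ₂ c₂ h; cases h with
    | loop_true _ h₁ h₂ => cases ih₁ h₁; exact ih₂ h₂
    | loop_false h0 => exact absurd h0 hx
  | loop_false hx =>
    intro σ₂ c₂ h; cases h with
    | loop_true h0 _ _ => exact absurd hx h0
    | loop_false _ => rfl

/-- The program `p` leads from `σ` to `σ'` at cost at most `T`. -/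
def Runs (ω : ℕ → Bool) (p : Prog) (σ σ' : State) (T : ℕ) : Prop :=
  ∃ c, Exec ω p σ σ' c ∧ c ≤ T

theorem Runs.mono {ω : ℕ → Bool} {p : Prog} {σ σ' : State} {T T' : ℕ} (h : Runs ω p σ σ' T)
    (hT : T ≤ T') : Runs ω p σ σ' T' := by
  obtain ⟨c, h, hc⟩ := h
  exact ⟨c, h, hc.trans hT⟩

theorem Runs.seq {ω : ℕ → Bool} {p q : Prog} {σ σ₁ σ₂ : State} {S T : ℕ}
    (hp : Runs ω p σ σ₁ S) (hq : Runs ω q σ₁ σ₂ T) : Runs ω (.seq p q) σ σ₂ (S + T) := by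
  obtain ⟨c, hp, hc⟩ := hp
  obtain ⟨d, hq, hd⟩ := hq
  exact ⟨c + d, .seq hp hq, Nat.add_le_add hc hd⟩

theorem Runs.const (ω : ℕ → Bool) (σ : State) (x c : ℕ) :
    Runs ω (.const x c) σ (σ.setReg x c) (1 + Nat.size c) :=
  ⟨_, .const σ x c, le_rfl⟩

theorem Runs.arith (ω : ℕ → Bool) (σ : State) (o : Op) (x y z : ℕ) :
    Runs ω (.arith o x y z) σ (σ.setReg x (o.eval (σ.reg y) (σ.reg z)))
      (1 + Nat.size (σ.reg y) + Nat.size (σ.reg z) + Nat.size (o.eval (σ.reg y) (σ.reg z))) :=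
  ⟨_, .arith σ o x y z, le_rfl⟩

theorem size_le_of_lt {a L : ℕ} (h : a < 2 ^ L) : Nat.size a ≤ L := Nat.size_le.2 h

theorem size_le_of_le {a b : ℕ} {L : ℕ} (hab : a ≤ b) (h : b < 2 ^ L) : Nat.size a ≤ L :=
  Nat.size_le.2 (hab.trans_lt h)

@[simp] theorem State.setReg_reg (σ : State) (x v : ℕ) :
    (σ.setReg x v).reg = Function.update σ.reg x v := rfl
@[simp] theorem State.setReg_mem (σ : State) (x v : ℕ) : (σ.setReg x v).mem = σ.mem := rfl
@[simp] theorem State.setReg_tosses (σ : State) (x v : ℕ) :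
    (σ.setReg x v).tosses = σ.tosses := rfl
@[simp] theorem State.setMem_reg (σ : State) (x v : ℕ) : (σ.setMem x v).reg = σ.reg := rfl
@[simp] theorem State.setMem_mem (σ : State) (x v : ℕ) :
    (σ.setMem x v).mem = Function.update σ.mem x v := rfl
@[simp] theorem State.setMem_tosses (σ : State) (x v : ℕ) :
    (σ.setMem x v).tosses = σ.tosses := rfl

/-! ### Counting loops -/

/-- Run `body` with `reg x = 0, 1, …` as often as `reg b` says, and restore `reg x` in the end. The
registers `d, …, d + 3` control the loop. -/
def loopProg (b x d : ℕ) (body : Prog) : Prog :=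
  .seq (.const d 0) <| .seq (.arith .add (d + 1) x d) <| .seq (.arith .add (d + 2) b d) <|
  .seq (.const (d + 3) 1) <| .seq
    (.loop (d + 2) (.seq (.arith .sub x b (d + 2)) (.seq body
      (.arith .sub (d + 2) (d + 2) (d + 3)))))
    (.arith .add x (d + 1) d)

/-- Register `d + 2` counts the remaining rounds down, so `b - (d + 2)` is the number of the round.
Register `d` is a zero used for copying, `d + 1` saves `x`, and `d + 3` holds the one to subtract.
The hypothesis `stable` says that the invariant ignores `x` and these control registers; the body
may overwrite `x`, as it is recomputed in every round. -/
theorem loopProg_spec {ω : ℕ → Bool} {b x d : ℕ} {body : Prog} {σ : State} {L C : ℕ}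
    (hbx : b ≠ x) (hb : b < d) (hx : x < d) (hbL : σ.reg b < 2 ^ L) (hxL : σ.reg x < 2 ^ L)
    (Inv : ℕ → State → Prop)
    (stable : ∀ i τ τ', Inv i τ → (∀ r, r ≠ x → (r < d ∨ d + 4 ≤ r) → τ'.reg r = τ.reg r) →
      τ'.mem = τ.mem → τ'.tosses = τ.tosses → Inv i τ')
    (step : ∀ i τ, i < σ.reg b → Inv i τ → τ.reg x = i → τ.reg b = σ.reg b →
      ∃ τ', Runs ω body τ τ' C ∧ Inv (i + 1) τ' ∧
        ∀ r, r = b ∨ (d ≤ r ∧ r < d + 4) → τ'.reg r = τ.reg r)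
    (h0 : Inv 0 σ) :
    ∃ σ', Runs ω (loopProg b x d body) σ σ' (σ.reg b * (C + 6 * L + 8) + 8 * L + 12) ∧
      Inv (σ.reg b) σ' ∧ σ'.reg x = σ.reg x := by
  -- Induction on the number `k` of remaining rounds, with `i` rounds already done.
  have key : ∀ k i τ, i + k = σ.reg b → Inv i τ → τ.reg b = σ.reg b → τ.reg d = 0 →
      τ.reg (d + 1) = σ.reg x → τ.reg (d + 2) = k → τ.reg (d + 3) = 1 →
      ∃ τ', Runs ω (.loop (d + 2) (.seq (.arith .sub x b (d + 2)) (.seq body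
        (.arith .sub (d + 2) (d + 2) (d + 3))))) τ τ' (k * (C + 6 * L + 8) + 1) ∧
        Inv (σ.reg b) τ' ∧ τ'.reg d = 0 ∧ τ'.reg (d + 1) = σ.reg x := by
    intro k
    induction k with
    | zero =>
      intro i τ hi hI hb' hd hd1 hd2 hd3
      have hi' : i = σ.reg b := by omega
      subst hi'
      exact ⟨τ, ⟨_, .loop_false hd2, by simp [hd2]⟩, hI, hd, hd1⟩
    | succ k ih =>
      intro i τ hi hI hb' hd hd1 hd2 hd3
      have e1 := Runs.arith ω τ .sub x b (d + 2)
      set τ₁ := τ.setReg x (Op.sub.eval (τ.reg b) (τ.reg (d + 2))) with hτ₁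
      have hv : Op.sub.eval (τ.reg b) (τ.reg (d + 2)) = i := by
        simp only [Op.eval, hb', hd2]; omega
      have r1 : ∀ r, r ≠ x → τ₁.reg r = τ.reg r := by
        intro r hr; simp [hτ₁, Function.update_of_ne hr]
      have hI1 : Inv i τ₁ := stable i τ τ₁ hI (fun r hr _ => r1 r hr) rfl rfl
      have hx1 : τ₁.reg x = i := by simp [hτ₁, hv]
      obtain ⟨τ₂, e2, hI2, r2⟩ := step i τ₁ (by omega) hI1 hx1 (by rw [r1 b hbx, hb'])
      have e3 := Runs.arith ω τ₂ .sub (d + 2) (d + 2) (d + 3)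
      set τ₃ := τ₂.setReg (d + 2) (Op.sub.eval (τ₂.reg (d + 2)) (τ₂.reg (d + 3))) with hτ₃
      have q0 : τ₂.reg b = σ.reg b := by rw [r2 b (.inl rfl), r1 b hbx, hb']
      have q1 : τ₂.reg d = 0 := by rw [r2 d (by omega), r1 d (by omega), hd]
      have q2 : τ₂.reg (d + 1) = σ.reg x := by
        rw [r2 (d + 1) (by omega), r1 _ (by omega), hd1]
      have q3 : τ₂.reg (d + 2) = k + 1 := by rw [r2 (d + 2) (by omega), r1 _ (by omega), hd2]
      have q4 : τ₂.reg (d + 3) = 1 := by rw [r2 (d + 3) (by omega), r1 _ (by omega), hd3]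
      have r3 : ∀ r, r ≠ d + 2 → τ₃.reg r = τ₂.reg r := by
        intro r hr; simp [hτ₃, Function.update_of_ne hr]
      have hI3 : Inv (i + 1) τ₃ :=
        stable _ τ₂ τ₃ hI2 (fun r _ hr => r3 r (by omega)) rfl rfl
      obtain ⟨τ₄, ⟨c4, e4, hc4⟩, hI4, s1, s2⟩ := ih (i + 1) τ₃ (by omega) hI3
        (by rw [r3 b (by omega), q0]) (by rw [r3 d (by omega), q1])
        (by rw [r3 _ (by omega), q2]) (by simp [hτ₃, Op.eval, q3, q4])
        (by rw [r3 _ (by omega), q4])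
      obtain ⟨c, e, hc⟩ := e1.seq (e2.seq e3)
      refine ⟨τ₄, ⟨_, .loop_true (by omega) e e4, ?_⟩, hI4, s1, s2⟩
      have z1 : Nat.size (k + 1) ≤ L := size_le_of_le (by omega) hbL
      have z2 : Nat.size i ≤ L := size_le_of_le (by omega) hbL
      have z3 : Nat.size k ≤ L := size_le_of_le (by omega) hbL
      have z4 : Nat.size (σ.reg b) ≤ L := size_le_of_lt hbL
      have z5 : Nat.size 1 = 1 := by simp
      rw [hv, q3, q4, hb', hd2] at hc
      simp only [Op.eval, Nat.add_sub_cancel, z5] at hc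
      rw [hd2]
      have : (k + 1) * (C + 6 * L + 8) = k * (C + 6 * L + 8) + (C + 6 * L + 8) := by ring
      omega
  have e1 := Runs.const ω σ d 0
  set σ₁ := σ.setReg d 0 with h₁
  have e2 := Runs.arith ω σ₁ .add (d + 1) x d
  set σ₂ := σ₁.setReg (d + 1) (Op.add.eval (σ₁.reg x) (σ₁.reg d)) with h₂
  have e3 := Runs.arith ω σ₂ .add (d + 2) b d
  set σ₃ := σ₂.setReg (d + 2) (Op.add.eval (σ₂.reg b) (σ₂.reg d)) with h₃
  have e4 := Runs.const ω σ₃ (d + 3) 1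
  set σ₄ := σ₃.setReg (d + 3) 1 with h₄
  have a1 : ∀ r, r < d → σ₁.reg r = σ.reg r := fun r hr => by
    simp [h₁, Function.update_of_ne (show r ≠ d by omega)]
  have a2 : ∀ r, r ≤ d → σ₂.reg r = σ₁.reg r := fun r hr => by
    simp [h₂, Function.update_of_ne (show r ≠ d + 1 by omega)]
  have a3 : ∀ r, r ≤ d + 1 → σ₃.reg r = σ₂.reg r := fun r hr => by
    simp [h₃, Function.update_of_ne (show r ≠ d + 2 by omega)]
  have a4 : ∀ r, r ≤ d + 2 → σ₄.reg r = σ₃.reg r := fun r hr => by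
    simp [h₄, Function.update_of_ne (show r ≠ d + 3 by omega)]
  have b1 : σ₁.reg d = 0 := by simp [h₁]
  have b2 : σ₂.reg (d + 1) = σ.reg x := by
    have : σ₂.reg (d + 1) = σ₁.reg x + σ₁.reg d := by simp [h₂, Op.eval]
    rw [this, b1, a1 x hx]; simp
  have b3 : σ₃.reg (d + 2) = σ.reg b := by
    have : σ₃.reg (d + 2) = σ₂.reg b + σ₂.reg d := by simp [h₃, Op.eval]
    rw [this, a2 d le_rfl, b1, a2 b (by omega), a1 b hb]; simp
  have hI4 : Inv 0 σ₄ := by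
    refine stable 0 σ σ₄ h0 (fun r hr hr' => ?_) rfl rfl
    simp only [h₄, h₃, h₂, h₁, State.setReg_reg]
    repeat rw [Function.update_of_ne (by omega)]
  obtain ⟨σ₅, e5, hI5, c1, c2⟩ := key (σ.reg b) 0 σ₄ (by omega) hI4
    (by rw [a4 b (by omega), a3 b (by omega), a2 b (by omega), a1 b hb])
    (by rw [a4 d (by omega), a3 d (by omega), a2 d (by omega), b1])
    (by rw [a4 _ (by omega), a3 _ (by omega), b2])
    (by rw [a4 _ (by omega), b3]) (by simp [h₄])
  have e6 := Runs.arith ω σ₅ .add x (d + 1) d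
  refine ⟨_, (e1.seq (e2.seq (e3.seq (e4.seq (e5.seq e6))))).mono ?_, ?_, ?_⟩
  · have z1 : Nat.size (σ.reg x) ≤ L := size_le_of_lt hxL
    have z2 : Nat.size (σ.reg b) ≤ L := size_le_of_lt hbL
    have z3 : Nat.size 1 = 1 := by simp
    have z4 : Nat.size 0 = 0 := by simp
    rw [c1, c2, a2 d le_rfl, b1, a1 x hx, a2 b (by omega), a1 b hb]
    simp only [Op.eval, z3, z4, Nat.add_zero]
    omega
  · exact stable _ σ₅ _ hI5 (fun r hr _ => by simp [Function.update_of_ne hr]) rfl rfl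
  · simp [Op.eval, c1, c2]

/-! ### Expressions -/

/-- Expressions over the registers and the memory. The bound variable `x` of `sum x e` and
`prod x e` ranges over the natural numbers below `reg 1`. -/
inductive RamExpr
  | var (x : ℕ)
  | const (c : ℕ)
  | op (o : Op) (a b : RamExpr)
  | load (a : RamExpr)
  | sum (x : ℕ) (e : RamExpr)
  | prod (x : ℕ) (e : RamExpr)

namespace RamExpr

def den : RamExpr → (ℕ → ℕ) → (ℕ → ℕ) → ℕ
  | var x, env, _ => env x
  | const c, _, _ => c
  | op o a b, env, mem => o.eval (a.den env mem) (b.den env mem)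
  | load a, env, mem => mem (a.den env mem)
  | sum x e, env, mem => ∑ i ∈ Finset.range (env 1), e.den (Function.update env x i) mem
  | prod x e, env, mem => ∏ i ∈ Finset.range (env 1), e.den (Function.update env x i) mem

/-- All variables are below `D`, and the bound ones are not among `0`, `1`, `2`. -/
def wf (D : ℕ) : RamExpr → Bool
  | var x => decide (x < D)
  | const _ => true
  | op _ a b => a.wf D && b.wf D
  | load a => a.wf D
  | sum x e => decide (x < D) && decide (2 < x) && e.wf D
  | prod x e => decide (x < D) && decide (2 < x) && e.wf D

/-- The program that writes the value of the expression into `reg d`. -/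
def compile : RamExpr → ℕ → Prog
  | var x, d => .seq (.const d 0) (.arith .add d x d)
  | const c, d => .const d c
  | op o a b, d => .seq (a.compile d) (.seq (b.compile (d + 1)) (.arith o d d (d + 1)))
  | load a, d => .seq (a.compile d) (.load d d)
  | sum x e, d => .seq (.const d 0)
      (loopProg 1 x (d + 1) (.seq (e.compile (d + 5)) (.arith .add d d (d + 5))))
  | prod x e, d => .seq (.const d 1)
      (loopProg 1 x (d + 1) (.seq (e.compile (d + 5)) (.arith .mul d d (d + 5))))

/-- `2 ^ L` exceeds all variables below `D` and all memory cells, and the loops run at most `L`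
times. -/
structure Bdd (D L : ℕ) (env mem : ℕ → ℕ) : Prop where
  reg_lt : ∀ r < D, env r < 2 ^ L
  mem_lt : ∀ a, mem a < 2 ^ L
  loop_le : env 1 ≤ L

theorem Bdd.update {D L : ℕ} {env mem : ℕ → ℕ} (h : Bdd D L env mem) {x i : ℕ} (hx : 2 < x)
    (hi : i < env 1) : Bdd D L (Function.update env x i) mem where
  reg_lt r hr := by
    by_cases hrx : r = x
    · subst hrx
      simpa using (hi.trans_le h.loop_le).trans Nat.lt_two_pow_self
    · simpa [Function.update_of_ne hrx] using h.reg_lt r hr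
  mem_lt := h.mem_lt
  loop_le := by simpa [Function.update_of_ne (show 1 ≠ x by omega)] using h.loop_le

theorem Bdd.congr {D L : ℕ} {env env' mem : ℕ → ℕ} (h : Bdd D L env mem) (hD : 1 < D)
    (he : ∀ r < D, env' r = env r) : Bdd D L env' mem where
  reg_lt r hr := by rw [he r hr]; exact h.reg_lt r hr
  mem_lt := h.mem_lt
  loop_le := by rw [he 1 hD]; exact h.loop_le

/-- Registers from `D` on are scratch space of the compiled code; this lemma lets values be computed
without regard to them. -/
theorem den_congr {D : ℕ} (hD : 1 < D) (e : RamExpr) (he : e.wf D = true) (mem : ℕ → ℕ) :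
    ∀ {env env' : ℕ → ℕ}, (∀ r < D, env' r = env r) → e.den env' mem = e.den env mem := by
  induction e with
  | var x => intro env env' h; exact h x (by simpa [wf] using he)
  | const c => intro env env' h; rfl
  | op o a b iha ihb =>
    intro env env' h
    simp only [wf, Bool.and_eq_true] at he
    simp only [den, iha he.1 h, ihb he.2 h]
  | load a iha => intro env env' h; simp only [den, iha he h]
  | sum x e ih | prod x e ih =>
    intro env env' h
    simp only [wf, Bool.and_eq_true] at he
    simp only [den, h 1 hD]
    congr 1
    funext i
    apply ih he.2
    intro r hr
    by_cases hrx : r = x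
    · subst hrx; simp
    · simp [Function.update_of_ne hrx, h r hr]

/-- The nesting of an expression is fixed and its loops have at most `L` rounds. Each operation
therefore changes the bit length polynomially: a product of at most `L` factors multiplies it by
`L`, a sum adds at most `L`. -/
theorem exists_den_lt {D : ℕ} (e : RamExpr) (he : e.wf D = true) :
    ∃ P : Polynomial ℕ, ∀ (L : ℕ) (env mem : ℕ → ℕ), Bdd D L env mem →
      e.den env mem < 2 ^ P.eval L := by
  induction e with
  | var x =>
    refine ⟨.X, fun L env mem h => ?_⟩
    simpa [den] using h.reg_lt x (by simpa [wf] using he)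
  | const c => exact ⟨.C c, fun L env mem h => by simpa [den] using Nat.lt_two_pow_self⟩
  | op o a b iha ihb =>
    simp only [wf, Bool.and_eq_true] at he
    obtain ⟨P, hP⟩ := iha he.1
    obtain ⟨R, hR⟩ := ihb he.2
    refine ⟨P + R + 1, fun L env mem h => ?_⟩
    have h1 := hP L env mem h
    have h2 := hR L env mem h
    simp only [Polynomial.eval_add, Polynomial.eval_one, den]
    generalize a.den env mem = u at *
    generalize b.den env mem = v at *
    have p1 : 2 ^ P.eval L ≤ 2 ^ (P.eval L + R.eval L) := Nat.pow_le_pow_right (by simp) (by simp)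
    have p2 : 2 ^ R.eval L ≤ 2 ^ (P.eval L + R.eval L) := Nat.pow_le_pow_right (by simp) (by simp)
    rw [pow_succ]
    cases o with
    | add => simp only [Op.eval]; omega
    | sub => simp only [Op.eval]; omega
    | mul =>
      have : u * v < 2 ^ (P.eval L + R.eval L) := by
        rw [pow_add]; exact Nat.mul_lt_mul'' h1 h2
      simp only [Op.eval]; omega
    | div =>
      have := Nat.div_le_self u v
      simp only [Op.eval]; omega
  | load a _ => exact ⟨.X, fun L env mem h => by simpa [den] using h.mem_lt _⟩
  | sum x e ih =>
    simp only [wf, Bool.and_eq_true, decide_eq_true_eq] at he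
    obtain ⟨P, hP⟩ := ih he.2
    refine ⟨.X + P, fun L env mem h => ?_⟩
    simp only [den, Polynomial.eval_add, Polynomial.eval_X, pow_add]
    calc _ ≤ ∑ i ∈ Finset.range (env 1), 2 ^ P.eval L :=
          Finset.sum_le_sum fun i hi =>
            (hP L _ mem (h.update he.1.2 (Finset.mem_range.1 hi))).le
      _ = env 1 * 2 ^ P.eval L := by simp
      _ < _ := Nat.mul_lt_mul_of_pos_right
          (h.loop_le.trans_lt Nat.lt_two_pow_self) (by positivity)
  | prod x e ih =>
    simp only [wf, Bool.and_eq_true, decide_eq_true_eq] at he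
    obtain ⟨P, hP⟩ := ih he.2
    refine ⟨.X * P + 1, fun L env mem h => ?_⟩
    simp only [den, Polynomial.eval_add, Polynomial.eval_X, Polynomial.eval_mul,
      Polynomial.eval_one]
    calc _ ≤ ∏ i ∈ Finset.range (env 1), 2 ^ P.eval L :=
          Finset.prod_le_prod' fun i hi =>
            (hP L _ mem (h.update he.1.2 (Finset.mem_range.1 hi))).le
      _ = 2 ^ (env 1 * P.eval L) := by simp [← pow_mul, mul_comm]
      _ < _ := Nat.pow_lt_pow_right (by simp)
          (Nat.lt_succ_of_le (Nat.mul_le_mul_right _ h.loop_le))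

/-- `σ'` differs from `σ` at most in the registers from `d` on. -/
structure Agree (d : ℕ) (σ σ' : State) : Prop where
  reg : ∀ r < d, σ'.reg r = σ.reg r
  mem : σ'.mem = σ.mem
  tosses : σ'.tosses = σ.tosses

/-- The common part of the compilation of sums and products. -/
theorem loop_compile_spec {D : ℕ} (hD : 1 < D) {x : ℕ} {e : RamExpr} (hx : x < D) (hx2 : 2 < x)
    (he : e.wf D = true) (o : Op) {P R : Polynomial ℕ}
    (hR : ∀ (d : ℕ) (ω : ℕ → Bool) (σ : State) (L : ℕ), D ≤ d → Bdd D L σ.reg σ.mem →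
      ∃ σ', Runs ω (e.compile d) σ σ' (R.eval L) ∧ σ'.reg d = e.den σ.reg σ.mem ∧ Agree d σ σ')
    (d : ℕ) (ω : ℕ → Bool) (σ : State) (L : ℕ) (hd : D ≤ d) (hσ : Bdd D L σ.reg σ.mem) (c : ℕ)
    (acc : ℕ → ℕ) (h0 : acc 0 = c)
    (hacc : ∀ i, acc (i + 1) = o.eval (acc i) (e.den (Function.update σ.reg x i) σ.mem))
    (hP : ∀ i < σ.reg 1, acc i < 2 ^ P.eval L ∧ acc (i + 1) < 2 ^ P.eval L ∧
      e.den (Function.update σ.reg x i) σ.mem < 2 ^ P.eval L) :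
    ∃ σ', Runs ω (.seq (.const d c) (loopProg 1 x (d + 1)
        (.seq (e.compile (d + 5)) (.arith o d d (d + 5))))) σ σ'
        (L * (R.eval L + 1 + 3 * P.eval L + 6 * L + 8) + 8 * L + 13 + Nat.size c) ∧
      σ'.reg d = acc (σ.reg 1) ∧ Agree d σ σ' := by
  have e1 := Runs.const ω σ d c
  set σ₁ := σ.setReg d c with h₁
  have a1 : ∀ r, r ≠ d → σ₁.reg r = σ.reg r := fun r hr => by
    simp [h₁, Function.update_of_ne hr]
  let Inv : ℕ → State → Prop := fun i τ => τ.reg d = acc i ∧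
    (∀ r < d, r ≠ x → τ.reg r = σ.reg r) ∧ τ.mem = σ.mem ∧ τ.tosses = σ.tosses
  have hreg1 : σ₁.reg 1 = σ.reg 1 := a1 1 (by omega)
  obtain ⟨σ₂, e2, hI, hx'⟩ := loopProg_spec (ω := ω) (b := 1) (x := x) (d := d + 1)
    (body := .seq (e.compile (d + 5)) (.arith o d d (d + 5))) (σ := σ₁) (L := L)
    (C := R.eval L + (1 + 3 * P.eval L)) (by omega) (by omega) (by omega)
    (by rw [hreg1]; exact hσ.reg_lt 1 hD) (by rw [a1 x (by omega)]; exact hσ.reg_lt x hx) Inv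
    (by
      rintro i τ τ' ⟨i1, i2, i3, i4⟩ hr hm ht
      refine ⟨?_, fun r hr1 hr2 => ?_, hm.trans i3, ht.trans i4⟩
      · rw [hr d (by omega) (by omega), i1]
      · rw [hr r hr2 (by omega), i2 r hr1 hr2])
    (by
      rintro i τ hi ⟨i1, i2, i3, i4⟩ hxi _
      rw [hreg1] at hi
      have henv : ∀ r < D, τ.reg r = Function.update σ.reg x i r := by
        intro r hr
        by_cases hrx : r = x
        · subst hrx; simpa using hxi
        · rw [Function.update_of_ne hrx, i2 r (by omega) hrx]
      have hb : Bdd D L τ.reg τ.mem := by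
        rw [i3]; exact (hσ.update hx2 hi).congr hD henv
      obtain ⟨τ₁, f1, v1, g1⟩ := hR (d + 5) ω τ L (by omega) hb
      have f2 := Runs.arith ω τ₁ o d d (d + 5)
      have w1 : τ₁.reg d = acc i := by rw [g1.reg d (by omega), i1]
      have w2 : τ₁.reg (d + 5) = e.den (Function.update σ.reg x i) σ.mem := by
        rw [v1, i3]; exact den_congr hD e he _ henv
      obtain ⟨z1, z2, z3⟩ := hP i hi
      refine ⟨_, (f1.seq f2).mono ?_, ⟨?_, ?_, ?_, ?_⟩, ?_⟩
      · rw [w1, w2, ← hacc]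
        have := size_le_of_lt z1
        have := size_le_of_lt z2
        have := size_le_of_lt z3
        omega
      · simp [w1, w2, hacc]
      · intro r hr hrx
        rw [State.setReg_reg, Function.update_of_ne (by omega), g1.reg r (by omega), i2 r hr hrx]
      · rw [State.setReg_mem, g1.mem, i3]
      · rw [State.setReg_tosses, g1.tosses, i4]
      · intro r hr
        rw [State.setReg_reg, Function.update_of_ne (by omega), g1.reg r (by omega)])
    ⟨by simp [h₁, h0], fun r hr _ => a1 r (by omega), rfl, rfl⟩
  obtain ⟨i1, i2, i3, i4⟩ := hI
  refine ⟨σ₂, (e1.seq e2).mono ?_, by rw [i1, hreg1], ⟨fun r hr => ?_, i3, i4⟩⟩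
  · rw [hreg1]
    have := Nat.mul_le_mul_right (R.eval L + (1 + 3 * P.eval L) + 6 * L + 8) hσ.loop_le
    have e : R.eval L + 1 + 3 * P.eval L + 6 * L + 8 =
      R.eval L + (1 + 3 * P.eval L) + 6 * L + 8 := by ring
    rw [e]
    omega
  · by_cases hrx : r = x
    · subst hrx; rw [hx', a1 _ (by omega)]
    · exact i2 r hr hrx

/-- The code uses registers as a stack that grows upwards from `d`, so the values of enclosing
expressions, below `d`, survive. The cost is polynomial because all intermediate values have
polynomially many bits, by `exists_den_lt`. -/
theorem exists_compile_spec {D : ℕ} (hD : 1 < D) (e : RamExpr) (he : e.wf D = true) :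
    ∃ P : Polynomial ℕ, ∀ (d : ℕ) (ω : ℕ → Bool) (σ : State) (L : ℕ), D ≤ d →
      Bdd D L σ.reg σ.mem → ∃ σ', Runs ω (e.compile d) σ σ' (P.eval L) ∧
        σ'.reg d = e.den σ.reg σ.mem ∧ Agree d σ σ' := by
  induction e with
  | var x =>
    refine ⟨2 + .C 2 * .X, fun d ω σ L hd h => ?_⟩
    have hx : x < D := by simpa [wf] using he
    have hs := size_le_of_lt (h.reg_lt x hx)
    refine ⟨_, ((Runs.const ω σ d 0).seq (Runs.arith ω _ .add d x d)).mono ?_, ?_, ?_, rfl, rfl⟩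
    · simp [Op.eval, Function.update_of_ne (show x ≠ d by omega)]
      omega
    · simp [Op.eval, Function.update_of_ne (show x ≠ d by omega), den]
    · intro r hr
      simp [Function.update_of_ne (show r ≠ d by omega)]
  | const c =>
    refine ⟨.C (1 + Nat.size c), fun d ω σ L hd h => ?_⟩
    refine ⟨_, (Runs.const ω σ d c).mono (by simp), by simp [den], ?_, rfl, rfl⟩
    intro r hr
    simp [Function.update_of_ne (show r ≠ d by omega)]
  | op o a b iha ihb =>
    obtain ⟨S, hS⟩ := exists_den_lt (op o a b) he
    simp only [wf, Bool.and_eq_true] at he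
    obtain ⟨P, hP⟩ := iha he.1
    obtain ⟨R, hR⟩ := ihb he.2
    obtain ⟨P', hP'⟩ := exists_den_lt a he.1
    obtain ⟨R', hR'⟩ := exists_den_lt b he.2
    refine ⟨P + R + (1 + P' + R' + S), fun d ω σ L hd h => ?_⟩
    obtain ⟨σ₁, e1, v1, g1⟩ := hP d ω σ L hd h
    have h1 : Bdd D L σ₁.reg σ₁.mem := by
      rw [g1.mem]; exact h.congr hD fun r hr => g1.reg r (by omega)
    obtain ⟨σ₂, e2, v2, g2⟩ := hR (d + 1) ω σ₁ L (by omega) h1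
    have w1 : σ₂.reg d = a.den σ.reg σ.mem := by rw [g2.reg d (by omega), v1]
    have w2 : σ₂.reg (d + 1) = b.den σ.reg σ.mem := by
      rw [v2, g1.mem]
      exact den_congr hD b he.2 _ fun r hr => g1.reg r (by omega)
    refine ⟨_, (e1.seq (e2.seq (Runs.arith ω σ₂ o d d (d + 1)))).mono ?_, ?_, ?_, ?_, ?_⟩
    · rw [w1, w2]
      have := size_le_of_lt (hP' L _ _ h)
      have := size_le_of_lt (hR' L _ _ h)
      have := size_le_of_lt (hS L _ _ h)
      simp only [den] at this
      simp only [Polynomial.eval_add, Polynomial.eval_one]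
      omega
    · simp [w1, w2, den]
    · intro r hr
      rw [State.setReg_reg, Function.update_of_ne (by omega), g2.reg r (by omega),
        g1.reg r (by omega)]
    · rw [State.setReg_mem, g2.mem, g1.mem]
    · rw [State.setReg_tosses, g2.tosses, g1.tosses]
  | load a iha =>
    obtain ⟨P, hP⟩ := iha he
    obtain ⟨P', hP'⟩ := exists_den_lt a he
    refine ⟨P + (1 + P' + .X), fun d ω σ L hd h => ?_⟩
    obtain ⟨σ₁, e1, v1, g1⟩ := hP d ω σ L hd h
    refine ⟨_, (e1.seq ⟨_, .load σ₁ d d, le_rfl⟩).mono ?_, ?_, ?_, ?_, ?_⟩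
    · rw [v1, g1.mem]
      have := size_le_of_lt (hP' L _ _ h)
      have := size_le_of_lt (h.mem_lt (a.den σ.reg σ.mem))
      simp only [Polynomial.eval_add, Polynomial.eval_one, Polynomial.eval_X]
      omega
    · simp [v1, g1.mem, den]
    · intro r hr
      rw [State.setReg_reg, Function.update_of_ne (by omega), g1.reg r (by omega)]
    · rw [State.setReg_mem, g1.mem]
    · rw [State.setReg_tosses, g1.tosses]
  | sum x e ih =>
    obtain ⟨S, hS⟩ := exists_den_lt (sum x e) he
    simp only [wf, Bool.and_eq_true, decide_eq_true_eq] at he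
    obtain ⟨R, hR⟩ := ih he.2
    refine ⟨.X * (R + 1 + 3 * S + 6 * .X + 8) + 8 * .X + 13, fun d ω σ L hd h => ?_⟩
    have hle : ∀ k ≤ σ.reg 1, ∑ i ∈ Finset.range k, e.den (Function.update σ.reg x i) σ.mem <
        2 ^ S.eval L := fun k hk => lt_of_le_of_lt
      (Finset.sum_le_sum_of_subset (Finset.range_mono hk)) (hS L _ _ h)
    obtain ⟨σ', h1, h2, h3⟩ := loop_compile_spec hD he.1.1 he.1.2 he.2 .add (P := S) hR d ω σ L hd h
      0 (fun k => ∑ i ∈ Finset.range k, e.den (Function.update σ.reg x i) σ.mem) (by simp)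
      (fun i => by simp [Op.eval, Finset.sum_range_succ])
      (fun i hi => ⟨hle i hi.le, hle (i + 1) hi, lt_of_le_of_lt
        (Finset.single_le_sum (f := fun i => e.den (Function.update σ.reg x i) σ.mem)
          (fun _ _ => Nat.zero_le _) (Finset.mem_range.2 hi)) (hle _ le_rfl)⟩)
    exact ⟨σ', h1.mono (by simp), h2, h3⟩
  | prod x e ih =>
    simp only [wf, Bool.and_eq_true, decide_eq_true_eq] at he
    obtain ⟨R, hR⟩ := ih he.2
    obtain ⟨S, hS⟩ := exists_den_lt e he.2
    -- A partial product may exceed the whole product, since a later factor can vanish. So all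
    -- partial products are bounded directly; `T` also dominates the bound `S` of a single factor.
    obtain ⟨T, hT⟩ : ∃ T : Polynomial ℕ, ∀ L, T.eval L = L * S.eval L + 1 + S.eval L :=
      ⟨.X * S + 1 + S, fun L => by simp⟩
    refine ⟨.X * (R + 1 + 3 * T + 6 * .X + 8) + 8 * .X + 14, fun d ω σ L hd h => ?_⟩
    have hle : ∀ k ≤ σ.reg 1, ∏ i ∈ Finset.range k, e.den (Function.update σ.reg x i) σ.mem <
        2 ^ T.eval L := by
      intro k hk
      calc _ ≤ ∏ i ∈ Finset.range k, 2 ^ S.eval L :=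
            Finset.prod_le_prod' fun i hi => (hS L _ σ.mem (h.update he.1.2
              ((Finset.mem_range.1 hi).trans_le hk))).le
        _ = 2 ^ (k * S.eval L) := by simp [← pow_mul, mul_comm]
        _ < _ := by
            apply Nat.pow_lt_pow_right (by simp)
            have := Nat.mul_le_mul_right (S.eval L) (hk.trans h.loop_le)
            rw [hT]
            omega
    have hS' : 2 ^ S.eval L ≤ 2 ^ T.eval L :=
      Nat.pow_le_pow_right Nat.two_pos (by rw [hT]; omega)
    obtain ⟨σ', h1, h2, h3⟩ := loop_compile_spec hD he.1.1 he.1.2 he.2 .mul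
      (P := T) hR d ω σ L hd h
      1 (fun k => ∏ i ∈ Finset.range k, e.den (Function.update σ.reg x i) σ.mem) (by simp)
      (fun i => by simp [Op.eval, Finset.prod_range_succ])
      (fun i hi => ⟨hle i hi.le, hle (i + 1) hi,
        (hS L _ σ.mem (h.update he.1.2 hi)).trans_le hS'⟩)
    exact ⟨σ', h1.mono (by simp), h2, h3⟩

end RamExpr

/-! ### Commands -/

/-- Commands work on the memory. `loop b x c` runs `c` for the values `0, 1, …` of the variable `x`
below `reg b`. -/
inductive Cmd
  /-- `mem a := e % reg 0` -/
  | store (a e : RamExpr)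
  /-- `mem a :=` the outcome of a coin toss -/
  | flip (a : RamExpr)
  | seq (c d : Cmd)
  | loop (b x : ℕ) (c : Cmd)

namespace Cmd

/-- The effect of a command on the memory and on the number of coins tossed. -/
def den (ω : ℕ → Bool) : Cmd → (ℕ → ℕ) → (ℕ → ℕ) × ℕ → (ℕ → ℕ) × ℕ
  | store a e, env, s => (Function.update s.1 (a.den env s.1) (e.den env s.1 % env 0), s.2)
  | flip a, env, s =>
      (Function.update s.1 (a.den env s.1) (if ω s.2 then 1 else 0), s.2 + 1)
  | seq c d, env, s => d.den ω env (c.den ω env s)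
  | loop b x c, env, s =>
      Nat.rec s (fun i s' => c.den ω (Function.update env x i) s') (env b)

/-- All variables are below `D`, and the loops run over `reg 1` or `reg 2`. -/
def wf (D : ℕ) : Cmd → Bool
  | store a e => a.wf D && e.wf D
  | flip a => a.wf D
  | seq c d => c.wf D && d.wf D
  | loop b x c => decide (b = 1 ∨ b = 2) && decide (x < D) && decide (2 < x) && c.wf D

/-- The nesting depth of the loops over `reg 2`. -/
def depth : Cmd → ℕ
  | store _ _ => 0
  | flip _ => 0
  | seq c d => max c.depth d.depth
  | loop b _ c => if b = 2 then c.depth + 1 else c.depth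

def compile : Cmd → ℕ → Prog
  | store a e, d => .seq (a.compile d) <| .seq (e.compile (d + 1)) <|
      .seq (.arith .div (d + 2) (d + 1) 0) <| .seq (.arith .mul (d + 2) (d + 2) 0) <|
      .seq (.arith .sub (d + 1) (d + 1) (d + 2)) (.store d (d + 1))
  | flip a, d => .seq (a.compile d) (.seq (.flip (d + 1)) (.store d (d + 1)))
  | seq c e, d => .seq (c.compile d) (e.compile d)
  | loop b x c, d => loopProg b x d (c.compile (d + 4))

open ConnectedCuts.RamExpr (Bdd)

/-- Every stored number is reduced modulo `reg 0 < 2 ^ L`, so the bound on the memory survives any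
number of rounds, even exponentially many. The hypothesis `0 < L` makes room for the outcome `1` of
a coin. -/
theorem den_bdd {D L : ℕ} (ω : ℕ → Bool) (c : Cmd) : ∀ {env : ℕ → ℕ} {s : (ℕ → ℕ) × ℕ},
    0 < env 0 → env 0 < 2 ^ L → 0 < L → c.wf D = true → (∀ a, s.1 a < 2 ^ L) →
    ∀ a, (c.den ω env s).1 a < 2 ^ L := by
  induction c with
  | store a e =>
    intro env s h0 hL _ _ hs b
    simp only [den]
    by_cases hb : b = a.den env s.1
    · subst hb; simpa using (Nat.mod_lt _ h0).trans hL
    · simpa [Function.update_of_ne hb] using hs b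
  | flip a =>
    intro env s h0 hL hL0 _ hs b
    simp only [den]
    by_cases hb : b = a.den env s.1
    · subst hb
      have : 1 < 2 ^ L := Nat.one_lt_two_pow (by omega)
      rw [Function.update_self]; split <;> omega
    · simpa [Function.update_of_ne hb] using hs b
  | seq c d ihc ihd =>
    intro env s h0 hL hL0 hw hs
    simp only [wf, Bool.and_eq_true] at hw
    exact ihd h0 hL hL0 hw.2 (ihc h0 hL hL0 hw.1 hs)
  | loop b x c ih =>
    intro env s h0 hL hL0 hw hs
    simp only [wf, Bool.and_eq_true, decide_eq_true_eq] at hw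
    simp only [den]
    generalize env b = k
    induction k with
    | zero => exact hs
    | succ k ihk =>
      have : Function.update env x k 0 = env 0 := Function.update_of_ne (by omega) _ _
      exact ih (by rw [this]; exact h0) (by rw [this]; exact hL) hL0 hw.2 ihk

theorem den_congr {D : ℕ} (hD : 2 < D) (ω : ℕ → Bool) (c : Cmd) (hc : c.wf D = true) :
    ∀ {env env' : ℕ → ℕ} (s : (ℕ → ℕ) × ℕ), (∀ r < D, env' r = env r) →
      c.den ω env' s = c.den ω env s := by
  induction c with
  | store a e =>
    intro env env' s h
    simp only [wf, Bool.and_eq_true] at hc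
    simp only [den, RamExpr.den_congr (by omega) a hc.1 s.1 h, RamExpr.den_congr (by omega) e hc.2 s.1 h,
      h 0 (by omega)]
  | flip a =>
    intro env env' s h
    simp only [den, RamExpr.den_congr (by omega) a hc s.1 h]
  | seq c d ihc ihd =>
    intro env env' s h
    simp only [wf, Bool.and_eq_true] at hc
    simp only [den, ihc hc.1 _ h, ihd hc.2 _ h]
  | loop b x c ih =>
    intro env env' s h
    simp only [wf, Bool.and_eq_true, decide_eq_true_eq] at hc
    simp only [den, h b (by omega)]
    congr 1
    funext i s'
    apply ih hc.2
    intro r hr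
    by_cases hrx : r = x
    · subst hrx; simp
    · simp [Function.update_of_ne hrx, h r hr]

/-- By `den_bdd` the same `L` bounds the memory throughout, so every round has the same cost bound.
A loop over `reg 1 ≤ L` costs a polynomial factor, whereas one over `reg 2` costs a factor `reg 2 +
1`; these are counted by `depth`. -/
theorem exists_compile_spec {D : ℕ} (hD : 2 < D) (c : Cmd) (hc : c.wf D = true) :
    ∃ P : Polynomial ℕ, ∀ (d : ℕ) (ω : ℕ → Bool) (σ : State) (L : ℕ), D ≤ d → 0 < L →
      0 < σ.reg 0 → (∀ r < D, σ.reg r < 2 ^ L) → (∀ a, σ.mem a < 2 ^ L) → σ.reg 1 ≤ L →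
      ∃ σ', Runs ω (c.compile d) σ σ' ((σ.reg 2 + 1) ^ c.depth * P.eval L) ∧
        (σ'.mem, σ'.tosses) = c.den ω σ.reg (σ.mem, σ.tosses) ∧
        ∀ r < d, σ'.reg r = σ.reg r := by
  induction c with
  | store a e =>
    simp only [wf, Bool.and_eq_true] at hc
    obtain ⟨P, hP⟩ := a.exists_compile_spec (by omega) hc.1
    obtain ⟨R, hR⟩ := e.exists_compile_spec (by omega) hc.2
    obtain ⟨P', hP'⟩ := a.exists_den_lt hc.1
    obtain ⟨R', hR'⟩ := e.exists_den_lt hc.2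
    refine ⟨P + R + (4 + P' + 8 * R' + 3 * .X), fun d ω σ L hd hL h0 hr hm h1 => ?_⟩
    have hB : Bdd D L σ.reg σ.mem := ⟨hr, hm, h1⟩
    obtain ⟨σ₁, e1, v1, g1⟩ := hP d ω σ L hd hB
    have hB1 : Bdd D L σ₁.reg σ₁.mem := by
      rw [g1.mem]; exact hB.congr (by omega) fun r hr => g1.reg r (by omega)
    obtain ⟨σ₂, e2, v2, g2⟩ := hR (d + 1) ω σ₁ L (by omega) hB1
    have w1 : σ₂.reg d = a.den σ.reg σ.mem := by rw [g2.reg d (by omega), v1]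
    have w2 : σ₂.reg (d + 1) = e.den σ.reg σ.mem := by
      rw [v2, g1.mem]
      exact RamExpr.den_congr (by omega) e hc.2 _ fun r hr => g1.reg r (by omega)
    have w0 : σ₂.reg 0 = σ.reg 0 := by rw [g2.reg 0 (by omega), g1.reg 0 (by omega)]
    -- The remainder modulo `K` is computed as `u - u / K * K`.
    have e3 := Runs.arith ω σ₂ .div (d + 2) (d + 1) 0
    set σ₃ := σ₂.setReg (d + 2) (Op.div.eval (σ₂.reg (d + 1)) (σ₂.reg 0)) with h₃
    have e4 := Runs.arith ω σ₃ .mul (d + 2) (d + 2) 0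
    set σ₄ := σ₃.setReg (d + 2) (Op.mul.eval (σ₃.reg (d + 2)) (σ₃.reg 0)) with h₄
    have e5 := Runs.arith ω σ₄ .sub (d + 1) (d + 1) (d + 2)
    set σ₅ := σ₄.setReg (d + 1) (Op.sub.eval (σ₄.reg (d + 1)) (σ₄.reg (d + 2))) with h₅
    set u := e.den σ.reg σ.mem with hu
    set K := σ.reg 0 with hK
    have x3 : σ₃.reg (d + 2) = u / K := by simp [h₃, Op.eval, w2, w0]
    have x30 : σ₃.reg 0 = K := by simp [h₃, w0]
    have x4 : σ₄.reg (d + 2) = u / K * K := by simp [h₄, Op.eval, x3, x30]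
    have x41 : σ₄.reg (d + 1) = u := by simp [h₄, h₃, w2]
    have x5 : σ₅.reg (d + 1) = u % K := by
      simp [h₅, Op.eval, x4, x41, Nat.mod_eq_sub_div_mul]
    have x50 : σ₅.reg d = a.den σ.reg σ.mem := by simp [h₅, h₄, h₃, w1]
    have y1 : u / K * K ≤ u := Nat.div_mul_le_self u K
    have y2 : u / K ≤ u := Nat.div_le_self u K
    have y3 : u % K ≤ u := Nat.mod_le u K
    have z1 := hP' L _ _ hB
    have z2 : u < 2 ^ R'.eval L := hR' L _ _ hB
    have z3 : Nat.size K ≤ L := size_le_of_lt (hr 0 (by omega))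
    refine ⟨_, (e1.seq (e2.seq (e3.seq (e4.seq (e5.seq ⟨_, .store σ₅ d (d + 1), le_rfl⟩))))).mono
      ?_, ?_, ?_⟩
    · rw [x5, x50, x41, x4, x3, x30, w2, w0]
      simp only [Op.eval, ← Nat.mod_eq_sub_div_mul]
      have := size_le_of_lt z1
      have := size_le_of_lt z2
      have := size_le_of_le y1 z2
      have := size_le_of_le y2 z2
      have := size_le_of_le y3 z2
      simp only [depth, pow_zero, one_mul, Polynomial.eval_add, Polynomial.eval_mul,
        Polynomial.eval_X, Polynomial.eval_ofNat]
      omega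
    · simp only [den, State.setMem_mem, State.setMem_tosses, x5, x50]
      simp only [h₅, h₄, h₃, State.setReg_mem, State.setReg_tosses, g2.mem, g1.mem, g2.tosses,
        g1.tosses, hu, hK]
    · intro r hr
      rw [State.setMem_reg, h₅, h₄, h₃]
      simp only [State.setReg_reg]
      repeat rw [Function.update_of_ne (by omega)]
      rw [g2.reg r (by omega), g1.reg r (by omega)]
  | flip a =>
    obtain ⟨P, hP⟩ := a.exists_compile_spec (by omega) hc
    obtain ⟨P', hP'⟩ := a.exists_den_lt hc
    refine ⟨P + (3 + P'), fun d ω σ L hd hL h0 hr hm h1 => ?_⟩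
    have hB : Bdd D L σ.reg σ.mem := ⟨hr, hm, h1⟩
    obtain ⟨σ₁, e1, v1, g1⟩ := hP d ω σ L hd hB
    obtain ⟨σ₂, h₂⟩ : ∃ σ₂ : State, σ₂ = { σ₁.setReg (d + 1) (if ω σ₁.tosses then 1 else 0) with
      tosses := σ₁.tosses + 1 } := ⟨_, rfl⟩
    have e2 : Runs ω (.flip (d + 1)) σ₁ σ₂ 1 := ⟨_, h₂ ▸ .flip σ₁ (d + 1), le_rfl⟩
    have x1 : σ₂.reg d = a.den σ.reg σ.mem := by simp [h₂, v1]
    have x2 : σ₂.reg (d + 1) = if ω σ.tosses then 1 else 0 := by simp [h₂, g1.tosses]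
    refine ⟨_, (e1.seq (e2.seq ⟨_, .store σ₂ d (d + 1), le_rfl⟩)).mono ?_, ?_, ?_⟩
    · rw [x1, x2]
      have := size_le_of_lt (hP' L _ _ hB)
      have : Nat.size (if ω σ.tosses then 1 else 0) ≤ 1 := by split <;> simp
      simp only [depth, pow_zero, one_mul, Polynomial.eval_add, Polynomial.eval_ofNat]
      omega
    · simp only [den, State.setMem_mem, State.setMem_tosses, x1, x2]
      simp [h₂, g1.mem, g1.tosses]
    · intro r hr
      rw [State.setMem_reg, h₂]
      simp only [State.setReg_reg]
      rw [Function.update_of_ne (by omega), g1.reg r (by omega)]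
  | seq c e ihc ihe =>
    simp only [wf, Bool.and_eq_true] at hc
    obtain ⟨P, hP⟩ := ihc hc.1
    obtain ⟨R, hR⟩ := ihe hc.2
    refine ⟨P + R, fun d ω σ L hd hL h0 hr hm h1 => ?_⟩
    obtain ⟨σ₁, e1, v1, g1⟩ := hP d ω σ L hd hL h0 hr hm h1
    have hmem : σ₁.mem = (c.den ω σ.reg (σ.mem, σ.tosses)).1 := by rw [← v1]
    obtain ⟨σ₂, e2, v2, g2⟩ := hR d ω σ₁ L hd hL (by rw [g1 0 (by omega)]; exact h0)
      (fun r hr' => by rw [g1 r (by omega)]; exact hr r hr')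
      (by rw [hmem]; exact den_bdd ω c h0 (hr 0 (by omega)) hL hc.1 hm)
      (by rw [g1 1 (by omega)]; exact h1)
    refine ⟨σ₂, (e1.seq e2).mono ?_, ?_, fun r hr => by rw [g2 r hr, g1 r hr]⟩
    · rw [g1 2 (by omega)]
      simp only [depth, Polynomial.eval_add, Nat.mul_add]
      exact Nat.add_le_add
        (Nat.mul_le_mul_right _ (Nat.pow_le_pow_right (by omega) (le_max_left _ _)))
        (Nat.mul_le_mul_right _ (Nat.pow_le_pow_right (by omega) (le_max_right _ _)))
    · rw [v2, v1]
      exact den_congr hD ω e hc.2 _ fun r hr => g1 r (by omega)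
  | loop b x c ih =>
    have hw := hc
    simp only [wf, Bool.and_eq_true, decide_eq_true_eq] at hc
    obtain ⟨P, hP⟩ := ih hc.2
    refine ⟨(.X + 1) * (P + 6 * .X + 8) + 8 * .X + 12, fun d ω σ L hd hL h0 hr hm h1 => ?_⟩
    let it : ℕ → (ℕ → ℕ) × ℕ := fun k =>
      Nat.rec (σ.mem, σ.tosses) (fun i s' => c.den ω (Function.update σ.reg x i) s') k
    have hit : ∀ k a, (it k).1 a < 2 ^ L := by
      intro k
      induction k with
      | zero => exact hm
      | succ k ihk =>
        have : Function.update σ.reg x k 0 = σ.reg 0 := Function.update_of_ne (by omega) _ _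
        exact den_bdd ω c (by rw [this]; exact h0) (by rw [this]; exact hr 0 (by omega)) hL hc.2 ihk
    let Inv : ℕ → State → Prop := fun i τ => (∀ r < d, r ≠ x → τ.reg r = σ.reg r) ∧
      (τ.mem, τ.tosses) = it i
    obtain ⟨σ', e1, ⟨i1, i2⟩, i3⟩ := loopProg_spec (ω := ω) (b := b) (x := x) (d := d)
      (body := c.compile (d + 4)) (σ := σ) (L := L)
      (C := (σ.reg 2 + 1) ^ c.depth * P.eval L) (by omega) (by omega) (by omega)
      (hr b (by omega)) (hr x (by omega)) Inv
      (by
        rintro i τ τ' ⟨j1, j2⟩ hr' hm' ht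
        refine ⟨fun r hr1 hr2 => ?_, ?_⟩
        · rw [hr' r hr2 (by omega), j1 r hr1 hr2]
        · rw [hm', ht, j2])
      (by
        rintro i τ hi ⟨j1, j2⟩ hxi hbi
        have henv : ∀ r < D, τ.reg r = Function.update σ.reg x i r := by
          intro r hr'
          by_cases hrx : r = x
          · subst hrx; simpa using hxi
          · rw [Function.update_of_ne hrx, j1 r (by omega) hrx]
        have hmem : τ.mem = (it i).1 := by rw [← j2]
        have t0 : τ.reg 0 = σ.reg 0 := j1 0 (by omega) (by omega)
        have t1 : τ.reg 1 = σ.reg 1 := j1 1 (by omega) (by omega)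
        have t2 : τ.reg 2 = σ.reg 2 := j1 2 (by omega) (by omega)
        obtain ⟨τ', f1, f2, f3⟩ := hP (d + 4) ω τ L (by omega) hL (by rw [t0]; exact h0)
          (by
            intro r hr'
            rw [henv r hr']
            by_cases hrx : r = x
            · subst hrx; simpa using hi.trans (hr b (by omega))
            · rw [Function.update_of_ne hrx]; exact hr r hr')
          (by rw [hmem]; exact hit i) (by rw [t1]; exact h1)
        refine ⟨τ', f1.mono (by rw [t2]), ⟨?_, ?_⟩, ?_⟩
        · intro r hr1 hr2
          rw [f3 r (by omega), j1 r hr1 hr2]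
        · rw [f2, j2]
          exact den_congr hD ω c hc.2 _ henv
        · intro r hr'
          exact f3 r (by omega))
      ⟨fun _ _ _ => rfl, rfl⟩
    refine ⟨σ', e1.mono ?_, i2, fun r hr' => ?_⟩
    · set A := (σ.reg 2 + 1) ^ c.depth with hA
      have hA1 : 1 ≤ A := Nat.one_le_pow _ _ (by omega)
      simp only [Polynomial.eval_add, Polynomial.eval_mul, Polynomial.eval_X,
        Polynomial.eval_ofNat, Polynomial.eval_one]
      -- The overhead of a round is absorbed into `A * (…)`, as `A ≥ 1`.
      have s1 : A * P.eval L + 6 * L + 8 ≤ A * (P.eval L + 6 * L + 8) := by nlinarith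
      rcases hc.1.1.1 with rfl | rfl
      · simp only [depth, show (1 : ℕ) ≠ 2 by omega, if_false, ← hA]
        calc _ ≤ (L + 1) * (A * (P.eval L + 6 * L + 8)) + 8 * L + 12 := by
              have := Nat.mul_le_mul (show σ.reg 1 ≤ L + 1 by omega) s1
              omega
          _ = A * ((L + 1) * (P.eval L + 6 * L + 8)) + (8 * L + 12) := by ring
          _ ≤ A * ((L + 1) * (P.eval L + 6 * L + 8)) + A * (8 * L + 12) :=
              Nat.add_le_add_left (Nat.le_mul_of_pos_left _ hA1) _
          _ = _ := by ring
      · simp only [depth, if_true, pow_succ, ← hA]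
        calc _ ≤ (σ.reg 2 + 1) * (A * (P.eval L + 6 * L + 8)) + 8 * L + 12 := by
              have := Nat.mul_le_mul (show σ.reg 2 ≤ σ.reg 2 + 1 by omega) s1
              omega
          _ = A * (σ.reg 2 + 1) * (1 * (P.eval L + 6 * L + 8)) + (8 * L + 12) := by ring
          _ ≤ A * (σ.reg 2 + 1) * ((L + 1) * (P.eval L + 6 * L + 8)) +
              A * (σ.reg 2 + 1) * (8 * L + 12) :=
              Nat.add_le_add (Nat.mul_le_mul_left _ (Nat.mul_le_mul_right _ (by omega)))
                (Nat.le_mul_of_pos_left _ (Nat.mul_pos hA1 (by omega)))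
          _ = _ := by ring
    · by_cases hrx : r = x
      · subst hrx; exact i3
      · exact i1 r hr' hrx

end Cmd

/-! ### The first number with a property -/

/-- The first number below `N` with the property `p`, or `N` if there is none. -/
def first (N : ℕ) (p : ℕ → Prop) [DecidablePred p] : ℕ :=
  ∑ i ∈ Finset.range N, if ∀ j ≤ i, ¬ p j then 1 else 0

/-- The indices `i` such that no `j ≤ i` has the property are exactly those below the least number
with the property. A minimum thus becomes a sum of indicators, which the expression language offers.
-/
theorem first_spec {N : ℕ} {p : ℕ → Prop} [DecidablePred p] (h : ∃ j < N, p j) :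
    p (first N p) := by
  have hex : ∃ j, p j := ⟨h.choose, h.choose_spec.2⟩
  have hlt : Nat.find hex < N := (Nat.find_min' hex h.choose_spec.2).trans_lt h.choose_spec.1
  have : first N p = Nat.find hex := by
    unfold first
    rw [← Finset.card_filter]
    have : (Finset.range N).filter (fun i => ∀ j ≤ i, ¬ p j) = Finset.range (Nat.find hex) := by
      ext i
      simp only [Finset.mem_filter, Finset.mem_range, Nat.lt_find_iff]
      constructor
      · exact fun h => h.2
      · intro hi
        refine ⟨?_, hi⟩
        by_contra hN
        exact hi _ (by omega) (Nat.find_spec hex)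
    rw [this, Finset.card_range]
  rw [this]
  exact Nat.find_spec hex

theorem first_le (N : ℕ) (p : ℕ → Prop) [DecidablePred p] : first N p ≤ N := by
  unfold first
  rw [← Finset.card_filter]
  exact (Finset.card_filter_le _ _).trans (by simp)

/-! ### Elimination along a tree decomposition -/

/-! ### Search orders of a tree -/

section SearchOrder

variable {m : ℕ}

/-- The node `i` can be appended to the list `o 0, …, o t` of nodes. -/
def Extends (T : ℕ → ℕ → Prop) (m : ℕ) (o : ℕ → ℕ) (t i : ℕ) : Prop :=
  i < m ∧ (∀ s ≤ t, o s ≠ i) ∧ ∃ s ≤ t, T (o s) i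

/-- An enumeration of the nodes of a graph where each node but the first is adjacent to an
earlier one. -/
structure IsSearchOrder (T : SimpleGraph (Fin m)) (o : ℕ → Fin m) : Prop where
  inj : ∀ s < m, ∀ t < m, o s = o t → s = t
  exists_adj : ∀ t < m, 0 < t → ∃ s < t, T.Adj (o s) (o t)

theorem IsSearchOrder.exists_index {T : SimpleGraph (Fin m)} {o : ℕ → Fin m}
    (h : IsSearchOrder T o) (i : Fin m) : ∃ t < m, o t = i := by
  have hinj : Function.Injective fun t : Fin m => o t := fun s t hst =>
    Fin.ext (h.inj s s.2 t t.2 hst)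
  obtain ⟨t, ht⟩ := (Finite.injective_iff_surjective.1 hinj) i
  exact ⟨t, t.2, ht⟩

/-- The `t + 1 < m` listed nodes miss some node `b`, and a walk from `o 0` to `b` leaves the listed
set along an edge. -/
theorem exists_extends {T : SimpleGraph (Fin m)} (hT : T.Connected) (o : ℕ → ℕ) {t : ℕ}
    (ht : t + 1 < m) (ho : ∀ s ≤ t, o s < m) :
    ∃ i < m, Extends (fun i j => ∃ (hi : i < m) (hj : j < m), T.Adj ⟨i, hi⟩ ⟨j, hj⟩) m o t i := by
  classical
  let S : Set (Fin m) := {i | ∃ s ≤ t, o s = i}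
  obtain ⟨b, hb⟩ : ∃ b : Fin m, b ∉ S := by
    by_contra! hS
    have hsurj : Function.Surjective fun s : Fin (t + 1) =>
        (⟨o s, ho s (by omega)⟩ : Fin m) := by
      intro b
      obtain ⟨s, hs, hsb⟩ := hS b
      exact ⟨⟨s, by omega⟩, Fin.ext hsb⟩
    have := Fintype.card_le_of_surjective _ hsurj
    simp at this
    omega
  obtain ⟨w⟩ := hT.preconnected ⟨o 0, ho 0 (by omega)⟩ b
  obtain ⟨d, -, h1, h2⟩ := w.exists_boundary_dart S ⟨0, by omega, rfl⟩ hb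
  obtain ⟨s, hs, hsd⟩ := h1
  refine ⟨d.snd, d.snd.2, d.snd.2, fun s hs he => h2 ⟨s, hs, he⟩, s, hs, ho s hs, d.snd.2, ?_⟩
  convert d.adj

/-- The greedy enumeration of the nodes of a connected graph. -/
theorem isSearchOrder_of_greedy {T : SimpleGraph (Fin m)} (hT : T.Connected) (o : ℕ → ℕ)
    (h0 : o 0 = 0)
    (hstep : ∀ t, (∃ i < m, Extends (fun i j => ∃ (hi : i < m) (hj : j < m),
        T.Adj ⟨i, hi⟩ ⟨j, hj⟩) m o t i) → t + 1 < m →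
      Extends (fun i j => ∃ (hi : i < m) (hj : j < m), T.Adj ⟨i, hi⟩ ⟨j, hj⟩) m o t (o (t + 1))) :
    ∃ o' : ℕ → Fin m, IsSearchOrder T o' ∧ ∀ t < m, (o' t : ℕ) = o t := by
  have hm : 0 < m := by
    obtain ⟨i⟩ := hT.nonempty
    exact i.pos
  have hlt : ∀ t, ∀ s ≤ t, s < m → o s < m := by
    intro t
    induction t with
    | zero =>
      intro s hs _
      obtain rfl : s = 0 := by omega
      omega
    | succ t ih =>
      intro s hs hsm
      rcases Nat.lt_or_ge s (t + 1) with h | h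
      · exact ih s (by omega) hsm
      · obtain rfl : s = t + 1 := by omega
        exact (hstep t (exists_extends hT o hsm fun r hr => ih r hr (by omega)) hsm).1
  have hE : ∀ t, t + 1 < m → _ := fun t ht =>
    hstep t (exists_extends hT o ht fun r hr => hlt r r le_rfl (by omega)) ht
  refine ⟨fun t => if h : t < m then ⟨o t, hlt t t le_rfl h⟩ else ⟨0, hm⟩, ⟨?_, ?_⟩, ?_⟩
  · have aux : ∀ s t, s < t → t < m → o s ≠ o t := by
      intro s t hst ht
      obtain ⟨t, rfl⟩ : ∃ t', t = t' + 1 := ⟨t - 1, by omega⟩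
      exact (hE t ht).2.1 s (by omega)
    intro s hs t ht hst
    simp only [hs, ht, dif_pos, Fin.mk.injEq] at hst
    rcases lt_trichotomy s t with h | h | h
    · exact absurd hst (aux s t h ht)
    · exact h
    · exact absurd hst.symm (aux t s h hs)
  · intro t ht ht0
    obtain ⟨t, rfl⟩ : ∃ t', t = t' + 1 := ⟨t - 1, by omega⟩
    obtain ⟨-, -, s, hs, h1, h2, hadj⟩ := hE t ht
    refine ⟨s, by omega, ?_⟩
    simpa [show s < m by omega, ht] using hadj
  · intro t ht
    simp [ht]

variable {T : SimpleGraph (Fin m)} {o : ℕ → Fin m}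

/-- Going back to earlier neighbours leads from `o s` to the root through nodes before position `t`
only, hence along edges that avoid `o t`. -/
theorem IsSearchOrder.reachable_deleteEdges (h : IsSearchOrder T o) {t : ℕ} (ht : t < m)
    (e : Sym2 (Fin m)) (he : o t ∈ e) {s : ℕ} (hs : s < t) :
    (T.deleteEdges {e}).Reachable (o 0) (o s) := by
  induction s using Nat.strong_induction_on with
  | _ s ih =>
    rcases Nat.eq_zero_or_pos s with rfl | hs0
    · exact .rfl
    · obtain ⟨r, hr, hadj⟩ := h.exists_adj s (by omega) hs0
      refine (ih r hr (by omega)).trans (SimpleGraph.Adj.reachable ?_)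
      rw [SimpleGraph.deleteEdges_adj]
      refine ⟨hadj, ?_⟩
      rintro rfl
      rw [Sym2.mem_iff] at he
      rcases he with he | he
      · have := h.inj t ht r (by omega) he; omega
      · have := h.inj t ht s (by omega) he; omega

theorem IsSearchOrder.not_reachable (hT : T.IsAcyclic) {t s : ℕ}
    (hadj : T.Adj (o s) (o t)) :
    ¬ (T.deleteEdges {s(o s, o t)}).Reachable (o s) (o t) := by
  have := SimpleGraph.isAcyclic_iff_forall_adj_isBridge.1 hT hadj
  rw [SimpleGraph.isBridge_iff] at this
  exact this

/-- In a search order of a tree, each node has at most one earlier neighbour. -/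
theorem IsSearchOrder.adj_unique (h : IsSearchOrder T o) (hT : T.IsAcyclic) {t r s : ℕ}
    (ht : t < m) (hr : r < t) (hs : s < t) (h1 : T.Adj (o r) (o t)) (h2 : T.Adj (o s) (o t)) :
    r = s := by
  by_contra hrs
  -- The edge between `o r` and `o t` is a bridge. Without it, `o r` would still reach `o s` via the
  -- root, and then `o t` by the second edge.
  apply IsSearchOrder.not_reachable hT h1
  refine ((h.reachable_deleteEdges ht _ (by simp) hr).symm.trans
    (h.reachable_deleteEdges ht _ (by simp) hs)).trans (SimpleGraph.Adj.reachable ?_)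
  rw [SimpleGraph.deleteEdges_adj]
  refine ⟨h2, fun he => hrs ?_⟩
  rw [Set.mem_singleton_iff, Sym2.congr_left] at he
  exact h.inj r (by omega) s (by omega) he.symm

/-- The running intersection property. -/
theorem IsSearchOrder.running_intersection (h : IsSearchOrder T o) (hT : T.IsAcyclic)
    {A : Set (Fin m)} (hA : (T.induce A).Preconnected) {t r s : ℕ} (ht : t < m) (hr : r < t)
    (hs : s < t) (hadj : T.Adj (o s) (o t)) (htA : o t ∈ A) (hrA : o r ∈ A) : o s ∈ A := by
  by_contra hsA
  -- Without the bridge between `o s` and `o t`, the node `o s` reaches `o r` via the root. From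
  -- there a walk inside `A`, which avoids `o s` and thus the bridge, leads to `o t`.
  apply IsSearchOrder.not_reachable hT hadj
  refine ((h.reachable_deleteEdges ht _ (by simp) hs).symm.trans
    (h.reachable_deleteEdges ht _ (by simp) hr)).trans ?_
  have hreach := hA ⟨o r, hrA⟩ ⟨o t, htA⟩
  let f : T.induce A →g T.deleteEdges {s(o s, o t)} :=
    { toFun := Subtype.val
      map_rel' := by
        rintro ⟨a, ha⟩ ⟨b, hb⟩ hab
        rw [SimpleGraph.deleteEdges_adj]
        refine ⟨hab, fun he => ?_⟩
        rw [Set.mem_singleton_iff] at he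
        have : o s ∈ s(a, b) := by rw [show s(a, b) = _ from he]; simp
        rw [Sym2.mem_iff] at this
        rcases this with h | h
        · exact hsA (h ▸ ha)
        · exact hsA (h ▸ hb) }
  exact hreach.map f

end SearchOrder

/-! ### Summation over colourings along a tree decomposition -/

section MessagePassing

variable {V C R : Type*} [DecidableEq V] [Zero C] [CommSemiring R]

/-- The colouring that agrees with `c` on `A` and vanishes elsewhere. -/
def restr (A : Finset V) (c : V → C) : V → C := A.piecewise c 0

theorem restr_apply (A : Finset V) (c : V → C) (v : V) :
    restr A c v = if v ∈ A then c v else 0 := by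
  by_cases hv : v ∈ A <;> simp [restr, hv]

theorem restr_congr {A : Finset V} {c c' : V → C} (h : ∀ v ∈ A, c v = c' v) :
    restr A c = restr A c' := by
  funext v
  by_cases hv : v ∈ A
  · simp [restr_apply, hv, h v hv]
  · simp [restr_apply, hv]

variable [Fintype V] [Fintype C]

/-- The colourings that vanish outside `A`. -/
def colorings (C : Type*) [Fintype C] [Zero C] (A : Finset V) : Finset (V → C) :=
  Fintype.piFinset fun v => if v ∈ A then Finset.univ else {0}

theorem mem_colorings {A : Finset V} {c : V → C} : c ∈ colorings C A ↔ ∀ v ∉ A, c v = 0 := by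
  simp only [colorings, Fintype.mem_piFinset]
  refine forall_congr' fun v => ?_
  by_cases hv : v ∈ A <;> simp [hv]

theorem restr_mem_colorings (A : Finset V) (c : V → C) : restr A c ∈ colorings C A :=
  mem_colorings.2 fun v hv => by simp [restr_apply, hv]

theorem restr_eq_self {A : Finset V} {c : V → C} (hc : c ∈ colorings C A) : restr A c = c := by
  funext v
  rw [mem_colorings] at hc
  by_cases hv : v ∈ A
  · simp [restr_apply, hv]
  · simp [restr_apply, hv, hc v hv]

/-- This splits a sum over the colourings of the vertices seen so far into the old vertices and
those that a new bag adds. -/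
theorem sum_colorings_union {A B : Finset V} (h : Disjoint A B) (f : (V → C) → R) :
    ∑ c ∈ colorings C (A ∪ B), f c =
      ∑ a ∈ colorings C A, ∑ b ∈ colorings C B, f (A.piecewise a b) := by
  rw [← Finset.sum_product']
  symm
  refine Finset.sum_bij' (fun p _ => A.piecewise p.1 p.2) (fun c _ => (restr A c, restr B c))
    ?_ ?_ ?_ ?_ ?_
  · rintro ⟨a, b⟩ hab
    simp only [Finset.mem_product, mem_colorings] at hab
    rw [mem_colorings]
    intro v hv
    rw [Finset.mem_union, not_or] at hv
    simp [hv.1, hab.2 v hv.2]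
  · intro c _
    exact Finset.mem_product.2 ⟨restr_mem_colorings _ _, restr_mem_colorings _ _⟩
  · rintro ⟨a, b⟩ hab
    simp only [Finset.mem_product, mem_colorings] at hab
    ext v
    · by_cases hv : v ∈ A
      · simp [restr_apply, hv]
      · simp [restr_apply, hv, hab.1 v hv]
    · by_cases hv : v ∈ B
      · simp [restr_apply, hv, Finset.disjoint_right.1 h hv]
      · simp [restr_apply, hv, hab.2 v hv]
  · intro c hc
    rw [mem_colorings] at hc
    funext v
    by_cases hA : v ∈ A
    · simp [restr_apply, hA]
    · by_cases hB : v ∈ B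
      · simp [restr_apply, hA, hB]
      · simp [restr_apply, hA, hB, hc v (by simp [hA, hB])]
  · intro p _
    rfl

/-- The value `μ 0 0` of a system of messages is the sum of the products of the local factors `φ t`
over all colourings. The bags `B 0, …, B (m - 1)` have the running intersection property with
respect to the parent relation `par`. -/
theorem message_root_eq [DecidableEq C] {m : ℕ} (hm : 0 < m) (B Bp : ℕ → Finset V)
    (par : ℕ → ℕ → Prop) [DecidableRel par] (par_lt : ∀ t s, par t s → s < t)
    (par_unique : ∀ t r s, par t r → par t s → r = s)
    (par_exists : ∀ t < m, 0 < t → ∃ s, par t s)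
    (rip : ∀ t r s, t < m → r < t → par t s → B t ∩ B r ⊆ B s)
    (hBp : ∀ t s, par t s → Bp t = B s) (hBp0 : Bp 0 = ∅)
    (φ : ℕ → (V → C) → R)
    (hφ : ∀ t c c', (∀ v ∈ B t, c v = c' v) → φ t c = φ t c')
    (μ : ℕ → (V → C) → R)
    (hμ : ∀ t < m, ∀ k, μ t k = ∑ b ∈ colorings C (B t) with restr (Bp t) b = k,
      φ t b * ∏ j ∈ Finset.range m with par j t, μ j (restr (B j) b)) :
    μ 0 0 = ∑ c ∈ colorings C ((Finset.range m).biUnion B), ∏ t ∈ Finset.range m, φ t c := by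
  -- The factor of bag `s` once the bags from `t` on have been eliminated: its local factor times
  -- the messages of its eliminated children.
  let F : ℕ → ℕ → (V → C) → R := fun t s c =>
    φ s c * ∏ j ∈ Finset.range m with t ≤ j ∧ par j s, μ j (restr (B j) (restr (B s) c))
  have hF : ∀ t s c c', (∀ v ∈ B s, c v = c' v) → F t s c = F t s c' := by
    intro t s c c' h
    simp only [F]
    rw [hφ s c c' h, restr_congr h]
  have hF' : ∀ t ≤ m, ∀ r ≤ t + 1, F r t = fun c =>
      φ t c * ∏ j ∈ Finset.range m with par j t, μ j (restr (B j) (restr (B t) c)) := by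
    intro t _ r hr
    funext c
    simp only [F]
    congr 2
    refine Finset.filter_congr fun j _ => ?_
    constructor
    · exact fun h => h.2
    · intro h
      have := par_lt j t h
      exact ⟨by omega, h⟩
  let U : ℕ → Finset V := fun t => (Finset.range t).biUnion B
  -- The whole sum with the bags from `t` on eliminated. `W m` is the right-hand side, `W 1` is the
  -- message of the root, and each elimination preserves the value.
  let W : ℕ → R := fun t => ∑ c ∈ colorings C (U t), ∏ s ∈ Finset.range t, F t s c
  have hstep : ∀ t < m, 0 < t → W (t + 1) = W t := by
    intro t ht ht0
    obtain ⟨p, hp⟩ := par_exists t ht ht0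
    have hpt := par_lt t p hp
    have hU : U (t + 1) = U t ∪ (B t \ U t) := by
      simp only [U, Finset.range_add_one, Finset.biUnion_insert]
      rw [Finset.union_comm, Finset.union_sdiff_self_eq_union]
    have hsub : ∀ s < t, ∀ v ∈ B s, v ∈ U t := fun s hs v hv =>
      Finset.mem_biUnion.2 ⟨s, Finset.mem_range.2 hs, hv⟩
    -- Running intersection: the bag `t` meets the earlier ones only inside the bag of its parent
    -- `p`.
    have hmeet : ∀ v ∈ B t, v ∈ U t → v ∈ B p := by
      intro v hv hvU
      obtain ⟨r, hr, hvr⟩ := Finset.mem_biUnion.1 hvU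
      exact rip t r p ht (Finset.mem_range.1 hr) hp (Finset.mem_inter.2 ⟨hv, hvr⟩)
    -- Summing over the vertices that are new in bag `t` gives its message to `p`: by `hmeet`,
    -- prescribing a colouring of `B t` on `B p` is the same as prescribing it on all old vertices.
    have hsum : ∀ a : V → C, ∑ b ∈ colorings C (B t \ U t), F (t + 1) t ((U t).piecewise a b) =
        μ t (restr (B t) (restr (B p) a)) := by
      intro a
      rw [hμ t ht, hBp t p hp, hF' t ht.le (t + 1) le_rfl]
      refine Finset.sum_bij' (fun b _ => restr (B t) ((U t).piecewise a b))
        (fun b _ => restr (B t \ U t) b) ?_ ?_ ?_ ?_ ?_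
      · intro b _
        refine Finset.mem_filter.2 ⟨restr_mem_colorings _ _, ?_⟩
        funext v
        by_cases h1 : v ∈ B p
        · simp [restr_apply, h1, hsub p hpt v h1]
        · simp [restr_apply, h1]
      · exact fun b _ => restr_mem_colorings _ _
      · intro b hb
        rw [mem_colorings] at hb
        funext v
        by_cases h1 : v ∈ B t \ U t
        · simp [restr_apply, (Finset.mem_sdiff.1 h1).1, (Finset.mem_sdiff.1 h1).2]
        · rw [restr_apply, if_neg h1, hb v h1]
      · intro b hb
        obtain ⟨hb, hbk⟩ := Finset.mem_filter.1 hb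
        rw [mem_colorings] at hb
        funext v
        by_cases h1 : v ∈ B t
        · by_cases h2 : v ∈ U t
          · have := congrFun hbk v
            simpa [restr_apply, h1, h2, hmeet v h1 h2] using this.symm
          · simp [restr_apply, h1, h2]
        · simp [restr_apply, h1, hb v h1]
      · intro b _
        have e : restr (B t) (restr (B t) ((U t).piecewise a b)) =
            restr (B t) ((U t).piecewise a b) := restr_eq_self (restr_mem_colorings _ _)
        simp only
        congr 1
        exact hφ t _ _ fun v hv => by simp [restr_apply, hv]
    -- Eliminating bag `t` attaches its message to the factor of the parent and leaves the others
    -- alone.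
    have hfac : ∀ (a : V → C), ∀ s, F t s a = F (t + 1) s a *
        if par t s then μ t (restr (B t) (restr (B s) a)) else 1 := by
      intro a s
      simp only [F, mul_assoc]
      congr 1
      by_cases hps : par t s
      · have : (Finset.range m).filter (fun j => t ≤ j ∧ par j s) =
            insert t ((Finset.range m).filter (fun j => t + 1 ≤ j ∧ par j s)) := by
          ext j
          simp only [Finset.mem_filter, Finset.mem_insert, Finset.mem_range]
          constructor
          · rintro ⟨h1, h2, h3⟩
            rcases h2.eq_or_lt with h | h
            · exact .inl h.symm
            · exact .inr ⟨h1, h, h3⟩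
          · rintro (rfl | ⟨h1, h2, h3⟩)
            · exact ⟨ht, le_rfl, hps⟩
            · exact ⟨h1, by omega, h3⟩
        rw [this, Finset.prod_insert (by simp), if_pos hps, mul_comm]
      · rw [if_neg hps, mul_one]
        refine Finset.prod_congr (Finset.filter_congr fun j _ => ?_) fun _ _ => rfl
        constructor
        · rintro ⟨h1, h2⟩
          refine ⟨Nat.lt_of_le_of_ne h1 ?_, h2⟩
          rintro rfl
          exact hps h2
        · exact fun h => ⟨by omega, h.2⟩
    simp only [W]
    rw [hU, sum_colorings_union Finset.disjoint_sdiff]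
    refine Finset.sum_congr rfl fun a _ => ?_
    have h1 : ∀ b : V → C, ∏ s ∈ Finset.range (t + 1), F (t + 1) s ((U t).piecewise a b) =
        (∏ s ∈ Finset.range t, F (t + 1) s a) * F (t + 1) t ((U t).piecewise a b) := by
      intro b
      rw [Finset.prod_range_succ]
      congr 1
      refine Finset.prod_congr rfl fun s hs => hF _ _ _ _ fun v hv => ?_
      simp [hsub s (Finset.mem_range.1 hs) v hv]
    simp only [h1, ← Finset.mul_sum, hsum, hfac, Finset.prod_mul_distrib]
    congr 1
    rw [Finset.prod_eq_single p]
    · rw [if_pos hp]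
    · intro s _ hsp
      rw [if_neg fun h => hsp (par_unique t s p h hp)]
    · intro h
      exact absurd (Finset.mem_range.2 hpt) h
  have hall : ∀ t, 0 < t → t ≤ m → W t = W 1 := by
    intro t
    induction t with
    | zero => intro h; omega
    | succ t ih =>
      intro _ htm
      rcases Nat.eq_zero_or_pos t with rfl | h
      · rfl
      · rw [hstep t (by omega) h, ih h (by omega)]
  have hWm : W m = ∑ c ∈ colorings C ((Finset.range m).biUnion B),
      ∏ t ∈ Finset.range m, φ t c := by
    refine Finset.sum_congr rfl fun c _ => Finset.prod_congr rfl fun s _ => ?_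
    simp only [F]
    rw [Finset.filter_false_of_mem, Finset.prod_empty, mul_one]
    intro j hj
    have := Finset.mem_range.1 hj
    omega
  have hW1 : W 1 = μ 0 0 := by
    have hU1 : U 1 = B 0 := by simp [U]
    simp only [W, hU1]
    rw [hμ 0 hm, hBp0]
    -- The root has no parent, so the condition on the restriction to `Bp 0 = ∅` is void.
    rw [Finset.filter_true_of_mem]
    · refine Finset.sum_congr rfl fun c hc => ?_
      simp [restr_eq_self hc, hF' 0 (Nat.zero_le _) 1 le_rfl]
    · intro b _
      funext v
      simp [restr_apply]
  rw [← hWm, hall m hm le_rfl, hW1]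

end MessagePassing

/-! ### Cut and count: consistent colourings and connectivity -/

/-! ### Locally constant two-colourings of a graph -/

section LocallyConstant

variable {W : Type*} (H : SimpleGraph W)

/-- The two-colourings of `H` that are constant on edges. -/
abbrev LocConst : Type _ := {f : W → Bool // ∀ a b, H.Adj a b → f a = f b}

/-- A locally constant two-colouring is a two-colouring of the connected components. -/
def locConstEquiv : LocConst H ≃ (H.ConnectedComponent → Bool) where
  toFun f := SimpleGraph.ConnectedComponent.lift f.1 fun v w p _ => by
    induction p with
    | nil => rfl
    | cons h _ ih => exact (f.2 _ _ h).trans (ih (SimpleGraph.Walk.IsPath.of_cons ‹_›))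
  invFun g := ⟨fun v => g (H.connectedComponentMk v), fun a b h =>
    congrArg g (SimpleGraph.ConnectedComponent.sound h.reachable)⟩
  left_inv f := rfl
  right_inv g := by
    funext C
    induction C using SimpleGraph.ConnectedComponent.ind with
    | _ v => rfl

/-- There are `2` to the number of components such colourings. A nonempty graph has at least one
component; `a` counts the others. -/
theorem exists_card_locConst [Finite W] [Nonempty W] :
    ∃ a, Nat.card (LocConst H) = 2 ^ (a + 1) ∧ (a = 0 ↔ H.Connected) := by
  classical
  have := Fintype.ofFinite W
  have hpos : 0 < Nat.card H.ConnectedComponent := Nat.card_pos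
  refine ⟨Nat.card H.ConnectedComponent - 1, ?_, ?_⟩
  · rw [Nat.card_congr (locConstEquiv H), Nat.card_fun, Nat.card_eq_fintype_card (α := Bool),
      Fintype.card_bool, Nat.sub_add_cancel hpos]
  · constructor
    · intro h
      have h1 : Nat.card H.ConnectedComponent ≤ 1 := by omega
      have hs : Subsingleton H.ConnectedComponent := Finite.card_le_one_iff_subsingleton.1 h1
      exact ⟨fun u v => SimpleGraph.ConnectedComponent.exact (Subsingleton.elim _ _)⟩
    · intro h
      have := h.preconnected.subsingleton_connectedComponent
      have := Finite.card_le_one_iff_subsingleton.2 this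
      omega

end LocallyConstant

/-! ### The partition function -/

/-- The side (`1` for `S`, `0` for the complement) of a vertex of colour `a < q`. With `q = 4` both
sides have two colours, with `q = 3` the complement has only one. -/
def side (q a : ℕ) : ℕ := (a + (4 - q)) / 2

section PartitionFunction

variable {R : Type*} [CommSemiring R] {n : ℕ}

/-- The weight of a vertex `v` of colour `a`; the vertex `s` has to be in `S`, and `t` outside. -/
def vertexFactor (q s t v : ℕ) (x : R) (a : ℕ) : R :=
  if side q a = 1 then (if v = t then 0 else x) else if v = s then 0 else 1

/-- The weight of an edge with endpoints of colours `a` and `b`. -/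
def edgeFactor (q : ℕ) (y : R) (a b : ℕ) : R :=
  if side q a = side q b then (if a = b then 1 else 0) else y

open Classical in
/-- The weight of a pair of vertices of colours `a` and `b`. -/
noncomputable def pairFactor (G : SimpleGraph (Fin n)) (q s t : ℕ) (x : Fin n → R) (y : R)
    (u v : Fin n) (a b : ℕ) : R :=
  if u = v then vertexFactor q s t u (x u) a
  else if u < v ∧ G.Adj u v then edgeFactor q y a b else 1

/-- The sum of the weights of all colourings. -/
noncomputable def partitionFn (G : SimpleGraph (Fin n)) (q s t : ℕ) (x : Fin n → R) (y : R) : R :=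
  ∑ c : Fin n → Fin q, ∏ u, ∏ v, pairFactor G q s t x y u v (c u) (c v)

/-- The same partition function is needed over polynomials, for the analysis, and over `ℕ`, where
the machine computes; evaluation homomorphisms relate the two. -/
theorem map_partitionFn {R' : Type*} [CommSemiring R'] (f : R →+* R') (G : SimpleGraph (Fin n))
    (q s t : ℕ) (x : Fin n → R) (y : R) :
    f (partitionFn G q s t x y) = partitionFn G q s t (fun v => f (x v)) (f y) := by
  simp only [partitionFn, map_sum, map_prod]
  refine Finset.sum_congr rfl fun c _ => Finset.prod_congr rfl fun u _ =>
    Finset.prod_congr rfl fun v _ => ?_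
  simp only [pairFactor, vertexFactor, edgeFactor]
  split_ifs <;> simp

open Classical in
/-- The number of edges of the cut. -/
noncomputable def cutSize (G : SimpleGraph (Fin n)) (S : Finset (Fin n)) : ℕ :=
  (Finset.univ.filter fun p : Fin n × Fin n =>
    (p.1 < p.2 ∧ G.Adj p.1 p.2) ∧ ¬ (p.1 ∈ S ↔ p.2 ∈ S)).card

theorem cutSize_le (G : SimpleGraph (Fin n)) (S : Finset (Fin n)) : cutSize G S ≤ n ^ 2 := by
  classical
  refine (Finset.card_filter_le _ _).trans ?_
  simp [sq]

theorem ncard_cutSet (G : SimpleGraph (Fin n)) (S : Finset (Fin n)) :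
    (cutSet G S).ncard = cutSize G S := by
  classical
  rw [cutSize, ← Set.ncard_coe_finset]
  have : cutSet G S = (fun p : Fin n × Fin n => s(p.1, p.2)) ''
      ((Finset.univ.filter fun p : Fin n × Fin n =>
        (p.1 < p.2 ∧ G.Adj p.1 p.2) ∧ ¬ (p.1 ∈ S ↔ p.2 ∈ S) : Finset _) : Set _) := by
    ext e
    simp only [cutSet, Set.mem_ofPred_eq, Set.mem_image, Finset.coe_filter, Finset.mem_univ,
      true_and, Prod.exists, Finset.mem_coe]
    constructor
    · rintro ⟨he, u, hu, v, hv, rfl⟩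
      rw [SimpleGraph.mem_edgeSet] at he
      rcases lt_trichotomy u v with h | h | h
      · exact ⟨u, v, ⟨⟨h, he⟩, by tauto⟩, rfl⟩
      · exact absurd (h ▸ hu) hv
      · exact ⟨v, u, ⟨⟨h, he.symm⟩, by tauto⟩, Sym2.eq_swap⟩
    · rintro ⟨u, v, ⟨⟨h, hadj⟩, hS⟩, rfl⟩
      refine ⟨hadj, ?_⟩
      by_cases hu : u ∈ S
      · exact ⟨u, hu, v, by tauto, rfl⟩
      · exact ⟨v, by tauto, u, hu, Sym2.eq_swap⟩
  rw [this, Set.InjOn.ncard_image]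
  rintro ⟨a, b⟩ h1 ⟨c, d⟩ h2 h
  simp only [Finset.coe_filter, Set.mem_ofPred_eq] at h1 h2
  rcases Sym2.eq_iff.1 h with ⟨h3, h4⟩ | ⟨h3, h4⟩
  · exact Prod.ext h3 h4
  · simp only at h3 h4
    subst h3 h4
    exact absurd h1.2.1.1 (lt_asymm h2.2.1.1)

/-- The vertices on side `1` of a colouring. -/
def sideSet {q : ℕ} (c : Fin n → Fin q) : Finset (Fin n) :=
  Finset.univ.filter fun v => side q (c v) = 1

/-- Adjacent vertices on the same side have the same colour. -/
def Consistent (G : SimpleGraph (Fin n)) {q : ℕ} (c : Fin n → Fin q) : Prop :=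
  ∀ u v, G.Adj u v → side q (c u) = side q (c v) → c u = c v

open Classical in
/-- The number of consistent colourings that have `S` on side `1`. -/
noncomputable def numColorings (G : SimpleGraph (Fin n)) (q : ℕ) (S : Finset (Fin n)) : ℕ :=
  (Finset.univ.filter fun c : Fin n → Fin q => sideSet c = S ∧ Consistent G c).card

/-- The vertex `s` is in `S`, and `t` is not. -/
def Separates (s t : ℕ) (S : Finset (Fin n)) : Prop :=
  (∀ v ∈ S, (v : ℕ) ≠ t) ∧ ∀ v ∉ S, (v : ℕ) ≠ s

theorem side_le_one {q : ℕ} (hq : q ≤ 4) {a : ℕ} (ha : a < q) : side q a = 0 ∨ side q a = 1 := by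
  unfold side; omega

-- The diagonal pairs contribute the vertex weights, and each edge contributes once, through its
-- ordering `u < v`. One zero factor kills each colouring that misplaces `s` or `t` or has an edge
-- inside a side with two colours; otherwise each cut edge gives one `y`.
open Classical in
theorem prod_pairFactor (G : SimpleGraph (Fin n)) {q : ℕ} (hq : q ≤ 4) (s t : ℕ) (x : Fin n → R)
    (y : R) (c : Fin n → Fin q) :
    ∏ u, ∏ v, pairFactor G q s t x y u v (c u) (c v) =
      if Separates s t (sideSet c) ∧ Consistent G c then
        y ^ cutSize G (sideSet c) * ∏ v ∈ sideSet c, x v else 0 := by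
  have hmem : ∀ v, v ∈ sideSet c ↔ side q (c v) = 1 := fun v => by simp [sideSet]
  have h1 : ∏ u, ∏ v, pairFactor G q s t x y u v (c u) (c v) =
      (∏ v : Fin n, vertexFactor q s t v (x v) (c v)) *
        ∏ p : Fin n × Fin n, if p.1 < p.2 ∧ G.Adj p.1 p.2 then
          edgeFactor q y (c p.1) (c p.2) else 1 := by
    rw [Fintype.prod_prod_type, ← Finset.prod_mul_distrib]
    refine Finset.prod_congr rfl fun u _ => ?_
    rw [Finset.prod_eq_mul_prod_sdiff_singleton_of_mem (Finset.mem_univ u),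
      Finset.prod_eq_mul_prod_sdiff_singleton_of_mem (Finset.mem_univ u)
        (fun v => if u < v ∧ G.Adj u v then edgeFactor q y (c u) (c v) else 1)]
    simp only [lt_self_iff_false, false_and, if_false, one_mul]
    congr 1
    · simp [pairFactor]
    · refine Finset.prod_congr rfl fun v hv => ?_
      have : u ≠ v := by simpa [eq_comm] using hv
      simp [pairFactor, this]
  have h2 : ∏ v : Fin n, vertexFactor q s t v (x v) (c v) =
      if Separates s t (sideSet c) then ∏ v ∈ sideSet c, x v else 0 := by
    split_ifs with h
    · have : ∀ v : Fin n, vertexFactor q s t v (x v) (c v) = if v ∈ sideSet c then x v else 1 := by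
        intro v
        by_cases hv : v ∈ sideSet c
        · have := h.1 v hv
          rw [vertexFactor, if_pos ((hmem v).1 hv), if_neg this, if_pos hv]
        · have := h.2 v hv
          rw [vertexFactor, if_neg (fun h => hv ((hmem v).2 h)), if_neg this, if_neg hv]
      simp only [this]
      rw [Finset.prod_ite_mem, Finset.univ_inter]
    · simp only [Separates, not_and_or, not_forall, ne_eq, not_not] at h
      rcases h with ⟨v, hv, h⟩ | ⟨v, hv, h⟩
      · refine Finset.prod_eq_zero (Finset.mem_univ v) ?_
        rw [vertexFactor, if_pos ((hmem v).1 hv), if_pos h]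
      · refine Finset.prod_eq_zero (Finset.mem_univ v) ?_
        rw [vertexFactor, if_neg (fun h => hv ((hmem v).2 h)), if_pos h]
  have hside : ∀ u v, side q (c u) = side q (c v) ↔ (u ∈ sideSet c ↔ v ∈ sideSet c) := by
    intro u v
    rw [hmem, hmem]
    have := side_le_one hq (c u).2
    have := side_le_one hq (c v).2
    omega
  have h3 : (∏ p : Fin n × Fin n, if p.1 < p.2 ∧ G.Adj p.1 p.2 then
      edgeFactor q y (c p.1) (c p.2) else 1) =
        if Consistent G c then y ^ cutSize G (sideSet c) else 0 := by
    split_ifs with h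
    · rw [cutSize, ← Finset.prod_const, Finset.prod_filter]
      refine Finset.prod_congr rfl fun p _ => ?_
      by_cases hp : p.1 < p.2 ∧ G.Adj p.1 p.2
      · by_cases hs : side q (c p.1) = side q (c p.2)
        · rw [if_pos hp, if_neg (fun h => h.2 ((hside _ _).1 hs)), edgeFactor, if_pos hs,
            if_pos (congrArg _ (h _ _ hp.2 hs))]
        · rw [if_pos hp, if_pos ⟨hp, fun h => hs ((hside _ _).2 h)⟩, edgeFactor, if_neg hs]
      · rw [if_neg hp, if_neg fun h => hp h.1]
    · simp only [Consistent, not_forall] at h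
      obtain ⟨u, v, hadj, hs, hc⟩ := h
      have hc' : ((c u : Fin q) : ℕ) ≠ c v := fun h => hc (Fin.ext h)
      rcases lt_or_gt_of_ne hadj.ne with huv | huv
      · refine Finset.prod_eq_zero (Finset.mem_univ (u, v)) ?_
        simp [huv, hadj, edgeFactor, hs, hc']
      · refine Finset.prod_eq_zero (Finset.mem_univ (v, u)) ?_
        simp [huv, hadj.symm, edgeFactor, hs, hc'.symm]
  rw [h1, h2, h3]
  by_cases hA : Separates s t (sideSet c) <;> by_cases hB : Consistent G c <;>
    simp [hA, hB, mul_comm]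

-- The weight of a consistent colouring depends only on its side set, so colourings are grouped by
-- it.
open Classical in
theorem partitionFn_eq_sum (G : SimpleGraph (Fin n)) {q : ℕ} (hq : q ≤ 4) (s t : ℕ)
    (x : Fin n → R) (y : R) :
    partitionFn G q s t x y = ∑ S : Finset (Fin n) with Separates s t S,
      (numColorings G q S : R) * (y ^ cutSize G S * ∏ v ∈ S, x v) := by
  rw [partitionFn, Finset.sum_congr rfl fun c _ => prod_pairFactor G hq s t x y c,
    ← Finset.sum_fiberwise (s := Finset.univ) (g := fun c : Fin n → Fin q => sideSet c),
    Finset.sum_filter]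
  refine Finset.sum_congr rfl fun S _ => ?_
  have : ∀ c ∈ Finset.univ.filter (fun c : Fin n → Fin q => sideSet c = S),
      (if Separates s t (sideSet c) ∧ Consistent G c then
        y ^ cutSize G (sideSet c) * ∏ v ∈ sideSet c, x v else 0) =
      if Separates s t S then (if Consistent G c then
        y ^ cutSize G S * ∏ v ∈ S, x v else 0) else 0 := by
    intro c hc
    obtain rfl := (Finset.mem_filter.1 hc).2
    by_cases hA : Separates s t (sideSet c) <;> by_cases hB : Consistent G c <;> simp [hA, hB]
  rw [Finset.sum_congr rfl this]
  split_ifs with h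
  · rw [← Finset.sum_filter, Finset.filter_filter, Finset.sum_const, nsmul_eq_mul, numColorings]
  · simp

/-! ### Counting consistent colourings -/

/-- The set `S` is connected and, if `q = 4`, its complement is connected, too. -/
def IsSolution (G : SimpleGraph (Fin n)) (q : ℕ) (S : Finset (Fin n)) : Prop :=
  (G.induce (S : Set (Fin n))).Connected ∧
    (q = 4 → (G.induce ((S : Set (Fin n))ᶜ)).Connected)

/-- The complement has the single colour `0`, so there is no choice there. On `S` the colours `1`
and `2` form a two-colouring, and consistency says that it is constant on the edges inside `S`. -/
theorem numColorings_three (G : SimpleGraph (Fin n)) (S : Finset (Fin n)) :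
    numColorings G 3 S = Nat.card (LocConst (G.induce (S : Set (Fin n)))) := by
  classical
  rw [numColorings, ← Fintype.card_subtype, ← Nat.card_eq_fintype_card]
  have hs : ∀ a : Fin 3, side 3 a = 1 ↔ a ≠ 0 := by decide
  refine Nat.card_congr
    { toFun := fun c => ⟨fun v => decide (c.1 v = 2), fun a b hab => ?_⟩
      invFun := fun f => ⟨fun v => if h : v ∈ S then (if f.1 ⟨v, h⟩ then 2 else 1) else 0, ?_, ?_⟩
      left_inv := ?_
      right_inv := ?_ }
  · obtain ⟨c, hc, hcons⟩ := c
    have ha : side 3 (c a) = 1 := by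
      have : (a : Fin n) ∈ sideSet c := hc ▸ a.2
      simpa [sideSet] using this
    have hb : side 3 (c b) = 1 := by
      have : (b : Fin n) ∈ sideSet c := hc ▸ b.2
      simpa [sideSet] using this
    simp only [hcons a b hab (by rw [ha, hb])]
  · ext v
    simp only [sideSet, Finset.mem_filter, Finset.mem_univ, true_and, hs]
    by_cases hv : v ∈ S
    · simp only [hv, dif_pos]
      split <;> simp
    · simp [hv]
  · intro u v huv hside
    by_cases hu : u ∈ S <;> by_cases hv : v ∈ S
    · have := f.2 ⟨u, hu⟩ ⟨v, hv⟩ huv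
      simp [hu, hv, this]
    · exfalso
      revert hside
      simp only [hu, hv, dif_pos, dif_neg, not_false_eq_true]
      split <;> decide
    · exfalso
      revert hside
      simp only [hu, hv, dif_pos, dif_neg, not_false_eq_true]
      split <;> decide
    · simp [hu, hv]
  · rintro ⟨c, hc, hcons⟩
    ext1
    funext v
    have hm : v ∈ S ↔ c v ≠ 0 := by rw [← hs, ← hc]; simp [sideSet]
    by_cases hv : v ∈ S
    · simp only [hv, dif_pos]
      have := hm.1 hv
      by_cases h2 : c v = 2
      · simp [h2]
      · simp only [h2, decide_false]
        revert this h2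
        generalize c v = a
        revert a
        decide
    · have : c v = 0 := by simpa using fun h => hv (hm.2 h)
      simp [hv, this]
  · intro f
    ext1
    funext v
    have hv : (v : Fin n) ∈ S := v.2
    simp only [hv, dif_pos]
    cases f.1 v <;> simp

/-- Both sides have two colours, `2` and `3` on `S`, `0` and `1` outside. Consistency does not
relate the two sides, so the choices are independent. -/
theorem numColorings_four (G : SimpleGraph (Fin n)) (S : Finset (Fin n)) :
    numColorings G 4 S = Nat.card (LocConst (G.induce (S : Set (Fin n)))) *
      Nat.card (LocConst (G.induce ((S : Set (Fin n))ᶜ))) := by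
  classical
  rw [numColorings, ← Fintype.card_subtype, ← Nat.card_eq_fintype_card, ← Nat.card_prod]
  have hs : ∀ a : Fin 4, side 4 a = 1 ↔ a = 2 ∨ a = 3 := by decide
  have hs0 : ∀ a : Fin 4, side 4 a = 0 → a = 0 ∨ a = 1 := by decide
  have hside : ∀ {c : Fin n → Fin 4}, sideSet c = S →
      ∀ v, side 4 (c v) = if v ∈ S then 1 else 0 := by
    intro c hc v
    have hm : v ∈ S ↔ side 4 (c v) = 1 := by rw [← hc]; simp [sideSet]
    have := side_le_one (q := 4) le_rfl (c v).2
    split_ifs with h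
    · exact hm.1 h
    · rcases this with h' | h'
      · exact h'
      · exact absurd (hm.2 h') h
  refine Nat.card_congr
    { toFun := fun c => (⟨fun v => decide (c.1 v = 3), fun a b hab => ?_⟩,
        ⟨fun v => decide (c.1 v = 1), fun a b hab => ?_⟩)
      invFun := fun f => ⟨fun v => if h : v ∈ S then (if f.1.1 ⟨v, h⟩ then 3 else 2)
        else if f.2.1 ⟨v, h⟩ then 1 else 0, ?_, ?_⟩
      left_inv := ?_
      right_inv := ?_ }
  · obtain ⟨c, hc, hcons⟩ := c
    have ha : (a : Fin n) ∈ S := a.2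
    have hb : (b : Fin n) ∈ S := b.2
    simp only [hcons a b hab (by rw [hside hc, hside hc, if_pos ha, if_pos hb])]
  · obtain ⟨c, hc, hcons⟩ := c
    have ha : (a : Fin n) ∉ S := a.2
    have hb : (b : Fin n) ∉ S := b.2
    simp only [hcons a b hab (by rw [hside hc, hside hc, if_neg ha, if_neg hb])]
  · ext v
    simp only [sideSet, Finset.mem_filter, Finset.mem_univ, true_and, hs]
    by_cases hv : v ∈ S
    · simp only [hv, dif_pos]
      split <;> simp
    · simp only [hv, dif_neg, not_false_eq_true]
      split <;> simp
  · intro u v huv hsd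
    by_cases hu : u ∈ S <;> by_cases hv : v ∈ S
    · have := f.1.2 ⟨u, hu⟩ ⟨v, hv⟩ huv
      simp [hu, hv, this]
    · exfalso
      revert hsd
      simp only [hu, hv, dif_pos, dif_neg, not_false_eq_true]
      split <;> split <;> decide
    · exfalso
      revert hsd
      simp only [hu, hv, dif_pos, dif_neg, not_false_eq_true]
      split <;> split <;> decide
    · have := f.2.2 ⟨u, hu⟩ ⟨v, hv⟩ huv
      simp [hu, hv, this]
  · rintro ⟨c, hc, hcons⟩
    ext1
    funext v
    have h := hside hc v
    by_cases hv : v ∈ S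
    · simp only [hv, dif_pos, if_true] at h ⊢
      rcases (hs _).1 h with h' | h' <;> simp [h']
    · simp only [hv, dif_neg, not_false_eq_true, if_false] at h ⊢
      rcases hs0 _ h with h' | h' <;> simp [h']
  · rintro ⟨f, g⟩
    ext v
    · have hv : (v : Fin n) ∈ S := v.2
      simp only [hv, dif_pos]
      cases f.1 v <;> simp
    · have hv : (v : Fin n) ∉ S := v.2
      simp only [hv, dif_neg, not_false_eq_true]
      cases g.1 v <;> simp

/-- For a proper nonempty subset `S`, the number of colourings is divisible by `2 ^ (q - 2)`, and the
quotient is odd if and only if `S` is a solution. -/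
theorem exists_numColorings (G : SimpleGraph (Fin n)) {q : ℕ} (hq : q = 3 ∨ q = 4)
    {S : Finset (Fin n)} (h1 : S.Nonempty) (h2 : Sᶜ.Nonempty) :
    ∃ a, numColorings G q S = 2 ^ (q - 2) * 2 ^ a ∧ (a = 0 ↔ IsSolution G q S) := by
  have : Nonempty (S : Set (Fin n)) := ⟨⟨h1.choose, h1.choose_spec⟩⟩
  have : Nonempty ((S : Set (Fin n))ᶜ : Set (Fin n)) :=
    ⟨⟨h2.choose, by simpa using h2.choose_spec⟩⟩
  obtain ⟨a, ha, ha'⟩ := exists_card_locConst (G.induce (S : Set (Fin n)))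
  obtain ⟨b, hb, hb'⟩ := exists_card_locConst (G.induce ((S : Set (Fin n))ᶜ))
  rcases hq with rfl | rfl
  · refine ⟨a, ?_, ?_⟩
    · rw [numColorings_three, ha, pow_succ]; ring
    · simp [IsSolution, ha']
  · refine ⟨a + b, ?_, ?_⟩
    · rw [numColorings_four, ha, hb, pow_succ, pow_succ, pow_add]; ring
    · simp only [IsSolution, ← ha', ← hb', true_imp_iff, Nat.add_eq_zero_iff]

end PartitionFunction

/-! ### Kronecker substitution, the acceptance test and Schwartz–Zippel -/

/-! ### Reading off the coefficients of a polynomial from its value at a large number -/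

theorem sum_mul_pow_lt {b : ℕ} (a : ℕ → ℕ) (ha : ∀ i, a i < b) (D : ℕ) :
    ∑ i ∈ Finset.range D, a i * b ^ i < b ^ D := by
  induction D with
  | zero => simp
  | succ D ih =>
    rw [Finset.sum_range_succ, pow_succ']
    have := Nat.mul_le_mul_right (b ^ D) (show a D + 1 ≤ b from ha D)
    rw [add_mul, one_mul] at this
    omega

theorem sum_mul_pow_div_mod {b : ℕ} (a : ℕ → ℕ) (ha : ∀ i, a i < b) {D I : ℕ} (hI : I < D) :
    (∑ i ∈ Finset.range D, a i * b ^ i) / b ^ I % b = a I := by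
  have hb : 0 < b := (Nat.zero_le _).trans_lt (ha 0)
  obtain ⟨E, rfl⟩ : ∃ E, D = I + (1 + E) := ⟨D - I - 1, by omega⟩
  rw [Finset.sum_range_add, Finset.sum_range_add]
  have h1 : ∑ x ∈ Finset.range E, a (I + (1 + x)) * b ^ (I + (1 + x)) =
      b ^ I * (b * ∑ x ∈ Finset.range E, a (I + (1 + x)) * b ^ x) := by
    rw [Finset.mul_sum, Finset.mul_sum]
    refine Finset.sum_congr rfl fun x _ => ?_
    rw [pow_add, pow_add]
    ring
  rw [h1]
  simp only [Finset.range_one, Finset.sum_singleton, Nat.add_zero]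
  rw [mul_comm (a I), ← mul_add, Nat.add_mul_div_left _ _ (by positivity),
    Nat.div_eq_of_lt (sum_mul_pow_lt a ha I), zero_add, Nat.add_mul_mod_self_left,
    Nat.mod_eq_of_lt (ha I)]

theorem eval_lt_pow {P : Polynomial ℕ} {b D : ℕ} (hD : P.natDegree < D) (hb : ∀ i, P.coeff i < b) :
    P.eval b < b ^ D := by
  rw [Polynomial.eval_eq_sum_range' hD]
  exact sum_mul_pow_lt _ hb D

theorem eval_div_pow_mod {P : Polynomial ℕ} {b D I : ℕ} (hD : P.natDegree < D)
    (hb : ∀ i, P.coeff i < b) (hI : I < D) : P.eval b / b ^ I % b = P.coeff I := by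
  rw [Polynomial.eval_eq_sum_range' hD]
  exact sum_mul_pow_div_mod _ hb hI

theorem coeff_le_eval_one (P : Polynomial ℕ) (i : ℕ) : P.coeff i ≤ P.eval 1 := by
  rw [Polynomial.eval_eq_sum, Polynomial.sum]
  by_cases hi : i ∈ P.support
  · exact (by simp : P.coeff i ≤ P.coeff i * 1 ^ i).trans
      (Finset.single_le_sum (f := fun i => P.coeff i * 1 ^ i) (fun _ _ => Nat.zero_le _) hi)
  · simp [Polynomial.notMem_support_iff.1 hi]

/-! ### The acceptance test -/

section Test

variable {n : ℕ}

/-- Some digit in base `2 ^ N ^ 2` of `Z`, from the place `k * N ^ 2` on, has a one at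
position `d`. -/
def Test (N k d Z : ℕ) : Prop :=
  ∃ I < N ^ 4, k * N ^ 2 ≤ I ∧ Z / (2 ^ N ^ 2) ^ I / 2 ^ d % 2 = 1

/-- The polynomial with coefficients given by bits. -/
noncomputable def bitPoly (R : Type*) [CommSemiring R] (N : ℕ) (f : ℕ → Bool) : Polynomial R :=
  ∑ b ∈ Finset.range N, if f b then Polynomial.X ^ b else 0

theorem natDegree_bitPoly_le (R : Type*) [CommSemiring R] (N : ℕ) (f : ℕ → Bool) :
    (bitPoly R N f).natDegree ≤ N - 1 := by
  refine Polynomial.natDegree_sum_le_of_forall_le _ _ fun b hb => ?_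
  have := Finset.mem_range.1 hb
  split_ifs
  · exact (Polynomial.natDegree_X_pow_le b).trans (by omega)
  · simp

theorem map_bitPoly {R R' : Type*} [CommSemiring R] [CommSemiring R'] (φ : R →+* R') (N : ℕ)
    (f : ℕ → Bool) : (bitPoly R N f).map φ = bitPoly R' N f := by
  simp only [bitPoly, Polynomial.map_sum]
  refine Finset.sum_congr rfl fun b _ => ?_
  split_ifs <;> simp

theorem eval_bitPoly {R : Type*} [CommSemiring R] (N : ℕ) (f : ℕ → Bool) (a : R) :
    (bitPoly R N f).eval a = ∑ b ∈ Finset.range N, if f b then a ^ b else 0 := by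
  simp only [bitPoly, Polynomial.eval_finsetSum]
  refine Finset.sum_congr rfl fun b _ => ?_
  split_ifs <;> simp

/-- The vertex weights contribute at most `n * (N - 1) < N ^ 2` to the degree, less than one cut
edge does. Hence sets with different cut sizes occupy disjoint ranges of exponents. -/
theorem natDegree_monomial_le {R : Type*} [CommSemiring R] (N : ℕ) (f : Fin n → ℕ → Bool) (j : ℕ)
    (S : Finset (Fin n)) :
    ((Polynomial.X ^ N ^ 2) ^ j * ∏ v ∈ S, bitPoly R N (f v)).natDegree ≤
      N ^ 2 * j + n * (N - 1) := by
  refine Polynomial.natDegree_mul_le.trans (Nat.add_le_add ?_ ?_)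
  · rw [← pow_mul]; exact Polynomial.natDegree_X_pow_le _
  · refine (Polynomial.natDegree_prod_le _ _).trans ?_
    refine (Finset.sum_le_sum fun v _ => natDegree_bitPoly_le R N (f v)).trans ?_
    rw [Finset.sum_const, smul_eq_mul]
    exact Nat.mul_le_mul_right _ ((Finset.card_le_univ S).trans (by simp))

variable (G : SimpleGraph (Fin n)) (q s t N : ℕ) (f : Fin n → ℕ → Bool)

/-- The generating polynomial of the colourings. -/
noncomputable def genPoly : Polynomial ℕ :=
  partitionFn G q s t (fun v => bitPoly ℕ N (f v)) (Polynomial.X ^ N ^ 2)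

/-- The number computed by the algorithm. -/
noncomputable def genNumber : ℕ :=
  partitionFn G q s t (fun v => ∑ b ∈ Finset.range N, if f v b then (2 ^ N ^ 2) ^ b else 0)
    ((2 ^ N ^ 2) ^ N ^ 2)

theorem eval_genPoly : (genPoly G q s t N f).eval (2 ^ N ^ 2) = genNumber G q s t N f := by
  have := map_partitionFn (Polynomial.evalRingHom (2 ^ N ^ 2)) G q s t
    (fun v => bitPoly ℕ N (f v)) (Polynomial.X ^ N ^ 2)
  simp only [Polynomial.coe_evalRingHom, eval_bitPoly, Polynomial.eval_pow, Polynomial.eval_X]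
    at this
  exact this

variable {q N}

theorem degree_bound {n N : ℕ} (hn : n + 5 ≤ N) : N ^ 2 * n ^ 2 + n * (N - 1) < N ^ 4 := by
  obtain ⟨r, rfl⟩ : ∃ r, N = n + 5 + r := ⟨N - n - 5, by omega⟩
  have h1 : n ^ 2 + 1 ≤ (n + 5 + r) ^ 2 := by nlinarith
  have h2 : n * (n + 5 + r - 1) < (n + 5 + r) ^ 2 := by
    have : n * (n + 5 + r - 1) ≤ n * (n + 5 + r) := Nat.mul_le_mul_left _ (by omega)
    nlinarith
  calc _ < (n + 5 + r) ^ 2 * n ^ 2 + (n + 5 + r) ^ 2 := by omega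
    _ = (n + 5 + r) ^ 2 * (n ^ 2 + 1) := by ring
    _ ≤ (n + 5 + r) ^ 2 * (n + 5 + r) ^ 2 := Nat.mul_le_mul_left _ h1
    _ = _ := by ring

theorem degree_bound' {n N : ℕ} (hn : n + 5 ≤ N) : n * (N - 1) < N ^ 2 := by
  rw [sq]
  exact Nat.mul_lt_mul_of_lt_of_le' (by omega) (by omega) (by omega)

theorem natDegree_genPoly_lt (hq : q ≤ 4) (hn : n + 5 ≤ N) :
    (genPoly G q s t N f).natDegree < N ^ 4 := by
  refine lt_of_le_of_lt ?_ (degree_bound hn)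
  rw [genPoly, partitionFn_eq_sum G hq]
  refine Polynomial.natDegree_sum_le_of_forall_le _ _ fun S _ => ?_
  rw [← nsmul_eq_mul]
  refine (Polynomial.natDegree_smul_le _ _).trans ?_
  exact (natDegree_monomial_le N f _ S).trans
    (Nat.add_le_add_right (Nat.mul_le_mul_left _ (cutSize_le G S)) _)

/-- A coefficient is at most the value at `1`. There each of the `q ^ n` colourings has weight at
most `N ^ n`, and `(q * N) ^ n ≤ 2 ^ (N * n) < 2 ^ N ^ 2`, since `4 * N ≤ 2 ^ N` for `N ≥ 5`. -/
theorem coeff_genPoly_lt (hq : q ≤ 4) (hn : n + 5 ≤ N) (i : ℕ) :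
    (genPoly G q s t N f).coeff i < 2 ^ N ^ 2 := by
  refine (coeff_le_eval_one _ i).trans_lt ?_
  have h1 := map_partitionFn (Polynomial.evalRingHom 1) G q s t
    (fun v => bitPoly ℕ N (f v)) (Polynomial.X ^ N ^ 2)
  simp only [Polynomial.coe_evalRingHom, eval_bitPoly, Polynomial.eval_pow, Polynomial.eval_X,
    one_pow] at h1
  rw [genPoly, h1, partitionFn]
  have h2 : ∀ c : Fin n → Fin q, ∏ u, ∏ v, pairFactor G q s t
      (fun v => ∑ b ∈ Finset.range N, if f v b then 1 else 0) (1 : ℕ) u v (c u) (c v) ≤ N ^ n := by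
    intro c
    calc _ ≤ ∏ u : Fin n, ∏ v : Fin n, if u = v then N else 1 := by
          refine Finset.prod_le_prod' fun u _ => Finset.prod_le_prod' fun v _ => ?_
          have hN : ∑ b ∈ Finset.range N, (if f u b then 1 else 0) ≤ N := by
            rw [← Finset.card_filter]
            exact (Finset.card_filter_le _ _).trans (by simp)
          simp only [pairFactor, vertexFactor, edgeFactor]
          split_ifs <;> omega
      _ = N ^ n := by simp
  calc _ ≤ ∑ c : Fin n → Fin q, N ^ n := Finset.sum_le_sum fun c _ => h2 c
    _ = (q * N) ^ n := by simp [mul_pow]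
    _ ≤ (2 ^ N) ^ n := by
        refine Nat.pow_le_pow_left ?_ n
        have h5 : ∀ r, 4 * (5 + r) ≤ 2 ^ (5 + r) := by
          intro r
          induction r with
          | zero => norm_num
          | succ r ih => rw [← Nat.add_assoc, pow_succ]; omega
        obtain ⟨r, rfl⟩ : ∃ r, N = 5 + r := ⟨N - 5, by omega⟩
        exact (Nat.mul_le_mul_right _ hq).trans (h5 r)
    _ < _ := by
        rw [← pow_mul]
        refine Nat.pow_lt_pow_right (by simp) ?_
        rw [sq]
        exact Nat.mul_lt_mul_of_pos_left (by omega) (by omega)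

/-- The number has at most `N ^ 4` digits of `N ^ 2` bits each. This is why the machine may compute
modulo `2 ^ N ^ 6`. -/
theorem genNumber_lt (hq : q ≤ 4) (hn : n + 5 ≤ N) : genNumber G q s t N f < 2 ^ N ^ 6 := by
  rw [← eval_genPoly]
  refine (eval_lt_pow (natDegree_genPoly_lt G s t f hq hn)
    (coeff_genPoly_lt G s t f hq hn)).trans_eq ?_
  rw [← pow_mul, ← pow_add]

open Classical in
/-- The generating polynomial, modulo two, of the solutions that separate `s` and `t`. -/
noncomputable def solPoly (G : SimpleGraph (Fin n)) (q s t N : ℕ) (f : Fin n → ℕ → Bool) :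
    Polynomial (ZMod 2) :=
  ∑ S : Finset (Fin n) with (Separates s t S ∧ 0 < cutSize G S) ∧ IsSolution G q S,
    ((Polynomial.X ^ N ^ 2) ^ cutSize G S * ∏ v ∈ S, bitPoly (ZMod 2) N (f v))

theorem nonempty_of_cutSize_pos {S : Finset (Fin n)} (h : 0 < cutSize G S) :
    S.Nonempty ∧ Sᶜ.Nonempty := by
  classical
  obtain ⟨⟨u, v⟩, hp⟩ := Finset.card_pos.1 h
  obtain ⟨-, -, hS⟩ := Finset.mem_filter.1 hp
  simp only at hS
  by_cases hu : u ∈ S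
  · exact ⟨⟨u, hu⟩, ⟨v, by simp; tauto⟩⟩
  · exact ⟨⟨v, by tauto⟩, ⟨u, by simpa using hu⟩⟩

/-- The sets with empty cut, among them `∅` and the whole vertex set, have degree below `N ^ 2` and
do not contribute to this coefficient. For all others `exists_numColorings` applies: dividing by `2
^ (q - 2)` and reducing modulo two keeps precisely the solutions. -/
theorem exists_coeff_genPoly (hq : q = 3 ∨ q = 4) (hn : n + 5 ≤ N) {I : ℕ} (hI : N ^ 2 ≤ I) :
    ∃ a, (genPoly G q s t N f).coeff I = 2 ^ (q - 2) * a ∧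
      ((a : ℕ) : ZMod 2) = (solPoly G q s t N f).coeff I := by
  classical
  have hex : ∀ S : Finset (Fin n), ∃ a, 0 < cutSize G S →
      numColorings G q S = 2 ^ (q - 2) * 2 ^ a ∧ (a = 0 ↔ IsSolution G q S) := by
    intro S
    by_cases hS : 0 < cutSize G S
    · obtain ⟨h1, h2⟩ := nonempty_of_cutSize_pos G hS
      obtain ⟨a, ha⟩ := exists_numColorings G hq h1 h2
      exact ⟨a, fun _ => ha⟩
    · exact ⟨0, fun h => absurd h hS⟩
  choose a ha using hex
  let m : Finset (Fin n) → Polynomial ℕ := fun S =>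
    (Polynomial.X ^ N ^ 2) ^ cutSize G S * ∏ v ∈ S, bitPoly ℕ N (f v)
  refine ⟨∑ S : Finset (Fin n) with Separates s t S ∧ 0 < cutSize G S, 2 ^ a S * (m S).coeff I,
    ?_, ?_⟩
  · rw [genPoly, partitionFn_eq_sum G (by omega), Polynomial.finsetSum_coeff, Finset.mul_sum,
      ← Finset.filter_filter, Finset.sum_filter (p := fun S => 0 < cutSize G S)]
    refine Finset.sum_congr rfl fun S _ => ?_
    rw [Polynomial.coeff_natCast_mul]
    split_ifs with hS
    · rw [(ha S hS).1, Nat.cast_id, mul_assoc]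
    · rw [Polynomial.coeff_eq_zero_of_natDegree_lt, mul_zero]
      refine (natDegree_monomial_le N f _ S).trans_lt (lt_of_lt_of_le ?_ hI)
      have : cutSize G S = 0 := by omega
      rw [this, mul_zero, zero_add]
      exact degree_bound' hn
  · rw [solPoly, ← Finset.filter_filter (fun S => Separates s t S ∧ 0 < cutSize G S),
      Finset.sum_filter (p := fun S => IsSolution G q S), Polynomial.finsetSum_coeff,
      Nat.cast_sum]
    refine Finset.sum_congr rfl fun S hS => ?_
    obtain ⟨-, -, hS⟩ := Finset.mem_filter.1 hS
    have hm : (m S).map (Nat.castRingHom (ZMod 2)) =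
        (Polynomial.X ^ N ^ 2) ^ cutSize G S * ∏ v ∈ S, bitPoly (ZMod 2) N (f v) := by
      simp only [m, Polynomial.map_mul, Polynomial.map_pow, Polynomial.map_X,
        Polynomial.map_prod, map_bitPoly]
    have h2 : (2 : ZMod 2) = 0 := rfl
    split_ifs with h
    · rw [(ha S hS).2.2 h, ← hm, Polynomial.coeff_map]
      simp
    · have : a S ≠ 0 := fun h' => h ((ha S hS).2.1 h')
      simp [h2, this]

theorem test_iff (hq : q = 3 ∨ q = 4) (hn : n + 5 ≤ N) {k : ℕ} (hk : 0 < k) :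
    Test N k (q - 2) (genNumber G q s t N f) ↔
      ∃ I < N ^ 4, k * N ^ 2 ≤ I ∧ (solPoly G q s t N f).coeff I ≠ 0 := by
  refine exists_congr fun I => and_congr_right fun hI => and_congr_right fun hkI => ?_
  have hI' : N ^ 2 ≤ I := (Nat.le_mul_of_pos_left _ hk).trans hkI
  have h1 := eval_div_pow_mod (natDegree_genPoly_lt G s t f (q := q) (by omega) hn)
    (coeff_genPoly_lt G s t f (by omega) hn) hI
  rw [eval_genPoly] at h1
  obtain ⟨a, ha, hc⟩ := exists_coeff_genPoly G s t f hq hn hI'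
  generalize genNumber G q s t N f / (2 ^ N ^ 2) ^ I = w at h1 ⊢
  -- The digit is `w` modulo `2 ^ N ^ 2`, which has the same bit at position `q - 2 < N ^ 2` as `w`.
  have h2 : w / 2 ^ (q - 2) % 2 = 1 ↔ a % 2 = 1 := by
    have h3 := Nat.testBit_mod_two_pow w (N ^ 2) (q - 2)
    have hlt : q - 2 < N ^ 2 := by
      have : 5 * 5 ≤ N ^ 2 := by rw [sq]; exact Nat.mul_le_mul (by omega) (by omega)
      omega
    rw [h1, ha, decide_eq_true hlt, Bool.true_and, Nat.testBit_eq_decide_div_mod_eq,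
      Nat.testBit_eq_decide_div_mod_eq, Nat.mul_div_cancel_left _ (by positivity)] at h3
    exact decide_eq_decide.1 h3.symm
  rw [h2, ← hc, Ne, ZMod.natCast_eq_zero_iff, Nat.dvd_iff_mod_eq_zero]
  omega

/-- This holds for all weights, so false positives are impossible: if all solutions have cuts of
size below `k`, then the degree of `solPoly` is below `k * N ^ 2`, where the tested places begin. -/
theorem exists_of_test (hq : q = 3 ∨ q = 4) (hn : n + 5 ≤ N) {k : ℕ} (hk : 0 < k)
    (h : Test N k (q - 2) (genNumber G q s t N f)) :
    ∃ S : Finset (Fin n), Separates s t S ∧ IsSolution G q S ∧ k ≤ cutSize G S := by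
  classical
  obtain ⟨I, -, hkI, hI⟩ := (test_iff G s t f hq hn hk).1 h
  by_contra! hno
  have hb := degree_bound' hn
  obtain ⟨k, rfl⟩ : ∃ k', k = k' + 1 := ⟨k - 1, by omega⟩
  refine hI (Polynomial.coeff_eq_zero_of_natDegree_lt
    (lt_of_le_of_lt (b := N ^ 2 * k + n * (N - 1)) ?_ (lt_of_lt_of_le ?_ hkI)))
  · refine Polynomial.natDegree_sum_le_of_forall_le _ _ fun S hS => ?_
    obtain ⟨-, ⟨hS1, -⟩, hS2⟩ := Finset.mem_filter.1 hS
    exact (natDegree_monomial_le N f _ S).trans (Nat.add_le_add_right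
      (Nat.mul_le_mul_left _ (Nat.lt_succ_iff.1 (hno S hS1 hS2))) _)
  · rw [add_mul, one_mul, mul_comm]
    omega

/-- The family consists of the solutions of maximum cut size. It is fixed before the weights `f` are
drawn, as the probabilistic argument requires. -/
theorem exists_family (hq : q = 3 ∨ q = 4) (hn : n + 5 ≤ N) {k : ℕ} (hk : 0 < k)
    (h : ∃ S : Finset (Fin n), Separates s t S ∧ IsSolution G q S ∧ k ≤ cutSize G S) :
    ∃ F : Finset (Finset (Fin n)), F.Nonempty ∧ ∀ f : Fin n → ℕ → Bool,
      ∑ S ∈ F, ∏ v ∈ S, bitPoly (ZMod 2) N (f v) ≠ 0 →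
        Test N k (q - 2) (genNumber G q s t N f) := by
  classical
  obtain ⟨S₀, h1, h2, h3⟩ := h
  let A : Finset (Finset (Fin n)) := Finset.univ.filter fun S =>
    (Separates s t S ∧ 0 < cutSize G S) ∧ IsSolution G q S
  have hS₀ : S₀ ∈ A := Finset.mem_filter.2 ⟨Finset.mem_univ _, ⟨h1, by omega⟩, h2⟩
  obtain ⟨S₁, hS₁, hmax⟩ := A.exists_max_image (cutSize G) ⟨S₀, hS₀⟩
  set j := cutSize G S₁ with hj
  have hkj : k ≤ j := h3.trans (hmax S₀ hS₀)
  refine ⟨A.filter fun S => cutSize G S = j, ⟨S₁, Finset.mem_filter.2 ⟨hS₁, rfl⟩⟩, fun f hf => ?_⟩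
  rw [test_iff G s t f hq hn hk]
  set Φ := ∑ S ∈ A.filter fun S => cutSize G S = j, ∏ v ∈ S, bitPoly (ZMod 2) N (f v) with hΦ
  have hdeg : Φ.natDegree ≤ n * (N - 1) := by
    refine Polynomial.natDegree_sum_le_of_forall_le _ _ fun S _ => ?_
    simpa using natDegree_monomial_le (R := ZMod 2) N f 0 S
  have hb := degree_bound hn
  have hb' := degree_bound' hn
  have hjn : j ≤ n ^ 2 := cutSize_le G S₁
  -- Solutions with smaller cuts have degree below `N ^ 2 * j`, so at this place only the leading
  -- coefficient of `Φ` remains.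
  refine ⟨N ^ 2 * j + Φ.natDegree, ?_, ?_, ?_⟩
  · have := Nat.mul_le_mul_left (N ^ 2) hjn
    omega
  · rw [mul_comm]
    exact (Nat.mul_le_mul_left _ hkj).trans (Nat.le_add_right _ _)
  · have hsplit : solPoly G q s t N f = Polynomial.X ^ (N ^ 2 * j) * Φ +
        ∑ S ∈ A.filter fun S => ¬ cutSize G S = j,
          ((Polynomial.X ^ N ^ 2) ^ cutSize G S * ∏ v ∈ S, bitPoly (ZMod 2) N (f v)) := by
      rw [solPoly, ← Finset.sum_filter_add_sum_filter_not A (fun S => cutSize G S = j)]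
      congr 1
      rw [hΦ, Finset.mul_sum]
      refine Finset.sum_congr rfl fun S hS => ?_
      rw [(Finset.mem_filter.1 hS).2, pow_mul]
    rw [hsplit, Polynomial.coeff_add, add_comm (N ^ 2 * j), Polynomial.coeff_X_pow_mul,
      Polynomial.coeff_natDegree, Polynomial.finsetSum_coeff, Finset.sum_eq_zero, add_zero]
    · exact Polynomial.leadingCoeff_ne_zero.2 hf
    · intro S hS
      obtain ⟨hSA, hSj⟩ := Finset.mem_filter.1 hS
      have hlt : cutSize G S + 1 ≤ j := lt_of_le_of_ne (hmax S hSA) hSj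
      refine Polynomial.coeff_eq_zero_of_natDegree_lt
        ((natDegree_monomial_le N f _ S).trans_lt ?_)
      have := Nat.mul_le_mul_left (N ^ 2) hlt
      rw [mul_add, mul_one] at this
      omega

end Test

/-! ### The probability of failure -/

section Probability

/-- The multilinear generating polynomial of a family of sets. -/
noncomputable def familyPoly (R : Type*) [CommRing R] {n : ℕ} (F : Finset (Finset (Fin n))) :
    MvPolynomial (Fin n) R :=
  ∑ S ∈ F, ∏ v ∈ S, MvPolynomial.X v

/-- Distinct sets give distinct squarefree monomials, so nothing cancels, in any characteristic. -/
theorem familyPoly_ne_zero (R : Type*) [CommRing R] [Nontrivial R] {n : ℕ}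
    {F : Finset (Finset (Fin n))} (hF : F.Nonempty) : familyPoly R F ≠ 0 := by
  classical
  obtain ⟨S₀, hS₀⟩ := hF
  have hinj : ∀ S T : Finset (Fin n),
      (∑ v ∈ S, Finsupp.single v 1 : Fin n →₀ ℕ) = ∑ v ∈ T, Finsupp.single v 1 → S = T := by
    intro S T h
    ext w
    have := DFunLike.congr_fun h w
    simp only [Finsupp.finsetSum_apply, Finsupp.single_apply, Finset.sum_ite_eq'] at this
    by_cases h1 : w ∈ S <;> by_cases h2 : w ∈ T <;> simp [h1, h2] at this ⊢
  have : (familyPoly R F).coeff (∑ v ∈ S₀, Finsupp.single v 1) = 1 := by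
    rw [familyPoly, MvPolynomial.coeff_sum, Finset.sum_eq_single S₀]
    · rw [show ∏ v ∈ S₀, (MvPolynomial.X v : MvPolynomial (Fin n) R) =
        MvPolynomial.monomial (∑ v ∈ S₀, Finsupp.single v 1) 1 from
        (MvPolynomial.monomial_sum_one S₀ fun v => Finsupp.single v 1).symm]
      simp
    · intro S _ hS
      rw [show ∏ v ∈ S, (MvPolynomial.X v : MvPolynomial (Fin n) R) =
        MvPolynomial.monomial (∑ v ∈ S, Finsupp.single v 1) 1 from
        (MvPolynomial.monomial_sum_one S fun v => Finsupp.single v 1).symm]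
      rw [MvPolynomial.coeff_monomial, if_neg fun h => hS (hinj _ _ h)]
    · exact fun h => absurd hS₀ h
  intro h
  rw [h, MvPolynomial.coeff_zero] at this
  exact zero_ne_one this

theorem totalDegree_familyPoly_le (R : Type*) [CommRing R] [Nontrivial R] {n : ℕ}
    (F : Finset (Finset (Fin n))) : (familyPoly R F).totalDegree ≤ n := by
  refine MvPolynomial.totalDegree_finsetSum_le fun S _ => ?_
  refine (MvPolynomial.totalDegree_finsetProd _ _).trans ?_
  simp only [MvPolynomial.totalDegree_X, Finset.sum_const, smul_eq_mul, mul_one]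
  exact (Finset.card_le_univ S).trans (by simp)

theorem coeff_bitPoly (R : Type*) [CommSemiring R] (N : ℕ) (f : ℕ → Bool) {b : ℕ} (hb : b < N) :
    (bitPoly R N f).coeff b = if f b then 1 else 0 := by
  rw [bitPoly, Polynomial.finsetSum_coeff, Finset.sum_eq_single b]
  · split_ifs <;> simp
  · intro c _ hc
    split_ifs
    · simp [Polynomial.coeff_X_pow, hc.symm]
    · simp
  · intro h
    exact absurd (Finset.mem_range.2 hb) h

/-- The polynomial with coefficients given by a vector of bits. -/
noncomputable def vecPoly {N : ℕ} (g : Fin N → Bool) : Polynomial (ZMod 2) :=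
  bitPoly (ZMod 2) N fun b => if h : b < N then g ⟨b, h⟩ else false

theorem vecPoly_injective {N : ℕ} : Function.Injective (vecPoly (N := N)) := by
  intro g g' h
  funext b
  have h1 := coeff_bitPoly (ZMod 2) N (fun b => if h : b < N then g ⟨b, h⟩ else false) b.2
  have h2 := coeff_bitPoly (ZMod 2) N (fun b => if h : b < N then g' ⟨b, h⟩ else false) b.2
  have h3 : (vecPoly g).coeff b = (vecPoly g').coeff b := by rw [h]
  rw [vecPoly, vecPoly, h1, h2] at h3
  simp only [b.2, dif_pos, Fin.eta] at h3
  cases hg : g b <;> cases hg' : g' b <;> simp [hg, hg'] at h3 ⊢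

-- Schwartz–Zippel with the `2 ^ N` polynomials of degree below `N` as sample set bounds the bad
-- proportion by `n / 2 ^ N`, and `2 * n ≤ 2 ^ N`. Working in the domain `(ZMod 2)[X]` avoids the
-- construction of a large field of characteristic two.
open Classical in
theorem card_bad_le {n N : ℕ} (hn : n < N) {F : Finset (Finset (Fin n))} (hF : F.Nonempty) :
    2 * (Finset.univ.filter fun g : Fin n → Fin N → Bool =>
      ∑ S ∈ F, ∏ v ∈ S, vecPoly (g v) = 0).card ≤ 2 ^ (n * N) := by
  set Bad := Finset.univ.filter fun g : Fin n → Fin N → Bool =>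
      ∑ S ∈ F, ∏ v ∈ S, vecPoly (g v) = 0 with hBad
  let A : Finset (Polynomial (ZMod 2)) := Finset.univ.image (vecPoly (N := N))
  have hA : A.card = 2 ^ N := by
    rw [Finset.card_image_of_injective _ vecPoly_injective]
    simp
  have hle : Bad.card ≤ ((Fintype.piFinset fun _ : Fin n => A).filter fun x =>
      MvPolynomial.eval x (familyPoly (Polynomial (ZMod 2)) F) = 0).card := by
    refine Finset.card_le_card_of_injOn (fun g v => vecPoly (g v)) ?_ ?_
    · intro g hg
      simp only [Finset.coe_filter, Fintype.mem_piFinset]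
      refine ⟨fun v => Finset.mem_image_of_mem _ (Finset.mem_univ _), ?_⟩
      rw [familyPoly, map_sum]
      simp only [map_prod, MvPolynomial.eval_X]
      exact (Finset.mem_filter.1 hg).2
    · intro g _ g' _ h
      funext v
      exact vecPoly_injective (congrFun h v)
  have hsz := MvPolynomial.schwartz_zippel_totalDegree
    (familyPoly_ne_zero (Polynomial (ZMod 2)) hF) A
  have hdeg := totalDegree_familyPoly_le (Polynomial (ZMod 2)) F
  have hN : 2 * n ≤ 2 ^ N := by
    have h1 : n + 1 ≤ N := hn
    have h2 : n < 2 ^ n := Nat.lt_two_pow_self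
    calc 2 * n ≤ 2 ^ n * 2 := by omega
      _ = 2 ^ (n + 1) := by rw [pow_succ]
      _ ≤ _ := Nat.pow_le_pow_right (by simp) h1
  set B := ((Fintype.piFinset fun _ : Fin n => A).filter fun x =>
      MvPolynomial.eval x (familyPoly (Polynomial (ZMod 2)) F) = 0).card with hB
  rw [hA] at hsz
  have hB2 : B * 2 ^ N ≤ n * (2 ^ N) ^ n := by
    push_cast at hsz
    rw [div_le_div_iff₀ (by positivity) (by positivity)] at hsz
    have h4 : (B : ℚ≥0) * 2 ^ N ≤ n * (2 ^ N) ^ n :=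
      hsz.trans (mul_le_mul_left (Nat.cast_le.2 hdeg) _)
    exact_mod_cast h4
  have h5 : 2 * B * 2 ^ N ≤ 2 ^ (n * N) * 2 ^ N := by
    calc 2 * B * 2 ^ N = 2 * (B * 2 ^ N) := by ring
      _ ≤ 2 * (n * (2 ^ N) ^ n) := Nat.mul_le_mul_left _ hB2
      _ = 2 * n * 2 ^ (n * N) := by rw [← pow_mul, mul_comm N n]; ring
      _ ≤ 2 ^ N * 2 ^ (n * N) := Nat.mul_le_mul_right _ hN
      _ = _ := by ring
  have h6 := Nat.le_of_mul_le_mul_right h5 (by positivity)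
  omega

/-- The event prescribes each of the first `n * N` coins: coin `i` is bit `i % N` of vertex `i / N`.
-/
theorem coinMeasure_fiber_le {n N : ℕ} (g : Fin n → Fin N → Bool) :
    coinMeasure {ω | (fun (v : Fin n) (b : Fin N) => ω (v * N + b)) = g} ≤
      ((2 : ENNReal) ^ (n * N))⁻¹ := by
  let r : ℕ → Set Bool := fun i =>
    if h : i / N < n ∧ 0 < N then {g ⟨i / N, h.1⟩ ⟨i % N, Nat.mod_lt _ h.2⟩} else Set.univ
  have hsub : {ω | (fun (v : Fin n) (b : Fin N) => ω (v * N + b)) = g} ⊆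
      Set.pi (Finset.range (n * N) : Set ℕ) r := by
    rintro ω hω i -
    change (fun (v : Fin n) (b : Fin N) => ω (v * N + b)) = g at hω
    simp only [r]
    split_ifs with h
    · rw [Set.mem_singleton_iff, ← hω]
      simp only
      rw [Nat.div_add_mod']
    · trivial
  refine (measure_mono hsub).trans ?_
  rw [coinMeasure, Measure.infinitePi_pi _ fun i _ => MeasurableSet.of_discrete]
  refine (Finset.prod_le_prod' (g := fun _ => (2 : ENNReal)⁻¹) fun i hi => ?_).trans ?_
  · have hi' := Finset.mem_range.1 hi
    have hN : 0 < N := Nat.pos_of_ne_zero fun h => by simp [h] at hi'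
    have hin : i / N < n := (Nat.div_lt_iff_lt_mul hN).2 hi'
    simp only [r, dif_pos (And.intro hin hN)]
    rw [PMF.toMeasure_apply_singleton _ _ (by measurability)]
    simp
  · simp [ENNReal.inv_pow]

theorem coinMeasure_family_le {n N : ℕ} (hn : n < N) {F : Finset (Finset (Fin n))}
    (hF : F.Nonempty) :
    coinMeasure {ω | ∑ S ∈ F, ∏ v ∈ S,
      bitPoly (ZMod 2) N (fun b => ω ((v : Fin n) * N + b)) = 0} ≤ 1 / 2 := by
  classical
  set Bad := Finset.univ.filter fun g : Fin n → Fin N → Bool =>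
      ∑ S ∈ F, ∏ v ∈ S, vecPoly (g v) = 0 with hBad
  have hsub : {ω : ℕ → Bool | ∑ S ∈ F, ∏ v ∈ S,
      bitPoly (ZMod 2) N (fun b => ω ((v : Fin n) * N + b)) = 0} ⊆
      ⋃ g ∈ Bad, {ω | (fun (v : Fin n) (b : Fin N) => ω (v * N + b)) = g} := by
    intro ω hω
    refine Set.mem_biUnion (x := fun (v : Fin n) (b : Fin N) => ω (v * N + b)) ?_ rfl
    refine Finset.mem_filter.2 ⟨Finset.mem_univ _, ?_⟩
    have e : ∀ v : Fin n, vecPoly (fun b : Fin N => ω (v * N + b)) =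
        bitPoly (ZMod 2) N fun b => ω (v * N + b) := by
      intro v
      simp only [vecPoly, bitPoly]
      refine Finset.sum_congr rfl fun b hb => ?_
      simp [Finset.mem_range.1 hb]
    simp only [e]
    exact hω
  refine (measure_mono hsub).trans ((measure_biUnion_finset_le _ _).trans ?_)
  refine (Finset.sum_le_sum fun g _ => coinMeasure_fiber_le g).trans ?_
  rw [Finset.sum_const, nsmul_eq_mul]
  have h := card_bad_le hn hF
  have h' : (2 : ENNReal) * Bad.card ≤ 2 ^ (n * N) := by exact_mod_cast h
  rw [← div_eq_mul_inv, ENNReal.div_le_iff (by positivity) (by simp)]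
  rw [one_div, ← ENNReal.div_eq_inv_mul, ENNReal.le_div_iff_mul_le (by simp) (by simp), mul_comm]
  exact h'

end Probability

/-! ### The program and its correctness -/

/-! ### Algorithms with one main command -/

/-- `reg r :=` the value of `e`; the registers from `D` on are used for the computation. -/
def assign (D r : ℕ) (e : RamExpr) : Prog :=
  .seq (e.compile D) (.seq (.const (D + 1) 0) (.arith .add r D (D + 1)))

theorem exists_assign_spec {D : ℕ} (hD : 1 < D) (e : RamExpr) (he : e.wf D = true) :
    ∃ P : Polynomial ℕ, ∀ (r : ℕ) (ω : ℕ → Bool) (σ : State) (L : ℕ), r < D →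
      RamExpr.Bdd D L σ.reg σ.mem → ∃ σ', Runs ω (assign D r e) σ σ' (P.eval L) ∧
        (∀ x < D, σ'.reg x = Function.update σ.reg r (e.den σ.reg σ.mem) x) ∧
        σ'.mem = σ.mem ∧ σ'.tosses = σ.tosses ∧ e.den σ.reg σ.mem < 2 ^ P.eval L := by
  obtain ⟨P, hP⟩ := e.exists_compile_spec hD he
  obtain ⟨R, hR⟩ := e.exists_den_lt he
  refine ⟨P + 2 * R + 2, fun r ω σ L hr h => ?_⟩
  obtain ⟨σ₁, e1, v1, g1⟩ := hP D ω σ L le_rfl h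
  have hv := hR L _ _ h
  have hs := size_le_of_lt hv
  have e2 := Runs.const ω σ₁ (D + 1) 0
  have e3 := Runs.arith ω (σ₁.setReg (D + 1) 0) .add r D (D + 1)
  have w : (σ₁.setReg (D + 1) 0).reg D = e.den σ.reg σ.mem := by simp [v1]
  have w' : (σ₁.setReg (D + 1) 0).reg (D + 1) = 0 := by simp
  rw [w, w'] at e3
  refine ⟨_, (e1.seq (e2.seq e3)).mono ?_, ?_, ?_, ?_, ?_⟩
  · simp only [Op.eval, Nat.add_zero, Nat.size_zero, Polynomial.eval_add, Polynomial.eval_mul,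
      Polynomial.eval_ofNat]
    omega
  · intro x hx
    simp only [State.setReg_reg, Op.eval, Nat.add_zero]
    by_cases hxr : x = r
    · subst hxr; simp
    · rw [Function.update_of_ne hxr, Function.update_of_ne hxr, Function.update_of_ne (by omega),
        g1.reg x hx]
  · simpa using g1.mem
  · simpa using g1.tosses
  · refine hv.trans_le (Nat.pow_le_pow_right Nat.two_pos ?_)
    simp only [Polynomial.eval_add, Polynomial.eval_mul, Polynomial.eval_ofNat]
    omega

/-- Compute the bounds for the loops and the modulus, run the command `c`, and output the value
of `a`. -/
def algorithm (D : ℕ) (eN eK eQ : RamExpr) (c : Cmd) (a : RamExpr) : Prog :=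
  .seq (assign D 1 eN) <| .seq (assign D 0 eK) <| .seq (assign D 2 eQ) <|
    .seq (c.compile D) (assign D 0 a)

theorem size_getD_le (l : List ℕ) (a : ℕ) : Nat.size (l.getD a 0) ≤ inputSize l := by
  by_cases ha : a < l.length
  · rw [List.getD_eq_getElem _ _ ha]
    have : Nat.size l[a] + 1 ≤ inputSize l :=
      List.single_le_sum (fun _ _ => Nat.zero_le _) _
        (List.mem_map.2 ⟨l[a], List.getElem_mem ha, rfl⟩)
    omega
  · rw [List.getD_eq_default _ _ (by omega)]
    simp

theorem length_le_inputSize (l : List ℕ) : l.length ≤ inputSize l := by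
  induction l with
  | nil => simp [inputSize]
  | cons a l ih =>
    simp only [inputSize, List.map_cons, List.sum_cons, List.length_cons] at ih ⊢
    omega

/-- The registers when the command is started. -/
def startEnv (N K Q : ℕ) : ℕ → ℕ :=
  Function.update (Function.update (Function.update (fun _ => 0) 1 N) 0 K) 2 Q

theorem startEnv_zero (N : ℕ) : Function.update (fun _ => 0) 1 N = startEnv N 0 0 := by
  funext r
  simp only [startEnv, Function.update_apply]
  split_ifs <;> omega

theorem startEnv_update_zero (N K : ℕ) :
    Function.update (startEnv N 0 0) 0 K = startEnv N K 0 := by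
  funext r
  simp only [startEnv, Function.update_apply]
  split_ifs <;> omega

theorem startEnv_update_two (N K Q : ℕ) :
    Function.update (startEnv N K 0) 2 Q = startEnv N K Q := by
  simp [startEnv]

theorem startEnv_lt {N K Q b : ℕ} (hN : N < b) (hK : K < b) (hQ : Q < b) (r : ℕ) :
    startEnv N K Q r < b := by
  simp only [startEnv, Function.update_apply]
  split_ifs <;> omega

@[simp] theorem startEnv_apply_zero (N K Q : ℕ) : startEnv N K Q 0 = K := by simp [startEnv]
@[simp] theorem startEnv_apply_one (N K Q : ℕ) : startEnv N K Q 1 = N := by simp [startEnv]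
@[simp] theorem startEnv_apply_two (N K Q : ℕ) : startEnv N K Q 2 = Q := by simp [startEnv]

theorem update_congr {D : ℕ} {u v : ℕ → ℕ} (h : ∀ y < D, u y = v y) (r w : ℕ) :
    ∀ y < D, Function.update u r w y = Function.update v r w y := by
  intro y hy
  simp only [Function.update_apply, h y hy]

/-- The assignments depend on each other: the modulus and the number of rounds are themselves
expressions with loops up to `N`, so register `1` is set first. As `depth = 1`, the cost is `Q + 1`
times a polynomial. -/
theorem exists_algorithm_spec {D : ℕ} (hD : 2 < D) {eN eK eQ a : RamExpr} {c : Cmd}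
    (hN : eN.wf D = true) (hK : eK.wf D = true) (hQ : eQ.wf D = true) (hc : c.wf D = true)
    (ha : a.wf D = true) (hdepth : c.depth = 1) :
    ∃ f : Polynomial ℕ, ∀ (l : List ℕ) (ω : ℕ → Bool) (N K Q : ℕ),
      eN.den (fun _ => 0) (fun a => l.getD a 0) = N →
      eK.den (startEnv N 0 0) (fun a => l.getD a 0) = K →
      eQ.den (startEnv N K 0) (fun a => l.getD a 0) = Q →
      N ≤ inputSize l + 5 → 0 < K →
      ∃ σ', Runs ω (algorithm D eN eK eQ c a) (State.init l) σ'
        ((Q + 1) * f.eval (inputSize l)) ∧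
        σ'.reg 0 = a.den (startEnv N K Q)
          (c.den ω (startEnv N K Q) (fun a => l.getD a 0, 0)).1 := by
  obtain ⟨PN, hPN⟩ := exists_assign_spec (by omega : 1 < D) eN hN
  obtain ⟨PK, hPK⟩ := exists_assign_spec (by omega : 1 < D) eK hK
  obtain ⟨PQ, hPQ⟩ := exists_assign_spec (by omega : 1 < D) eQ hQ
  obtain ⟨Pa, hPa⟩ := exists_assign_spec (by omega : 1 < D) a ha
  obtain ⟨Pc, hPc⟩ := c.exists_compile_spec hD hc
  -- Bit bounds for the successive phases: `L₁` covers the input and `N`, `L₂` also the modulus `K`,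
  -- and `L₃` also `Q`.
  let L₁ : Polynomial ℕ := .X + 5
  let L₂ : Polynomial ℕ := L₁ + PK.comp L₁
  let L₃ : Polynomial ℕ := L₂ + PQ.comp L₂
  refine ⟨PN.comp L₁ + (PK.comp L₁ + (PQ.comp L₂ + (Pc.comp L₃ + Pa.comp L₃))),
    fun l ω N K Q eqN eqK eqQ hNl hK0 => ?_⟩
  set x := inputSize l with hx
  have l1 : L₁.eval x = x + 5 := by simp [L₁]
  have l2 : L₂.eval x = L₁.eval x + PK.eval (L₁.eval x) := by simp [L₂, Polynomial.eval_comp]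
  have l3 : L₃.eval x = L₂.eval x + PQ.eval (L₂.eval x) := by simp [L₃, Polynomial.eval_comp]
  have l12 : 2 ^ L₁.eval x ≤ 2 ^ L₂.eval x := Nat.pow_le_pow_right Nat.two_pos (by omega)
  have l23 : 2 ^ L₂.eval x ≤ 2 ^ L₃.eval x := Nat.pow_le_pow_right Nat.two_pos (by omega)
  have hm : ∀ b, l.getD b 0 < 2 ^ L₁.eval x := fun b =>
    Nat.size_le.1 ((size_getD_le l b).trans (by omega))
  have hNL : N < 2 ^ L₁.eval x :=
    (show N ≤ L₁.eval x by omega).trans_lt Nat.lt_two_pow_self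
  obtain ⟨σ₁, r1, e1, m1, t1, -⟩ := hPN 1 ω (State.init l) (L₁.eval x) (by omega)
    ⟨fun r _ => by simp [State.init], hm, by simp [State.init]⟩
  have e1' : ∀ y < D, σ₁.reg y = startEnv N 0 0 y := by
    intro y hy
    rw [e1 y hy]
    have : eN.den (State.init l).reg (State.init l).mem = N := eqN
    rw [this, ← startEnv_zero]
    rfl
  have b1 : RamExpr.Bdd D (L₁.eval x) σ₁.reg σ₁.mem := by
    refine ⟨fun r hr => ?_, ?_, ?_⟩
    · rw [e1' r hr]
      exact startEnv_lt hNL (by positivity) (by positivity) r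
    · rw [m1]; exact hm
    · rw [e1' 1 (by omega)]
      rw [startEnv_apply_one]
      omega
  obtain ⟨σ₂, r2, e2, m2, t2, z2⟩ := hPK 0 ω σ₁ (L₁.eval x) (by omega) b1
  have hKd : eK.den σ₁.reg σ₁.mem = K := by
    rw [eK.den_congr (by omega) hK _ e1', m1]; exact eqK
  rw [hKd] at e2 z2
  have e2' : ∀ y < D, σ₂.reg y = startEnv N K 0 y := by
    intro y hy
    rw [e2 y hy, update_congr e1' 0 K y hy, startEnv_update_zero]
  have hKL : K < 2 ^ L₂.eval x :=
    z2.trans_le (Nat.pow_le_pow_right Nat.two_pos (by omega))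
  have b2 : RamExpr.Bdd D (L₂.eval x) σ₂.reg σ₂.mem := by
    refine ⟨fun r hr => ?_, ?_, ?_⟩
    · rw [e2' r hr]
      exact startEnv_lt (hNL.trans_le l12) hKL (by positivity) r
    · rw [m2, m1]; exact fun b => (hm b).trans_le l12
    · rw [e2' 1 (by omega)]
      rw [startEnv_apply_one]
      omega
  obtain ⟨σ₃, r3, e3, m3, t3, z3⟩ := hPQ 2 ω σ₂ (L₂.eval x) (by omega) b2
  have hQd : eQ.den σ₂.reg σ₂.mem = Q := by
    rw [eQ.den_congr (by omega) hQ _ e2', m2, m1]; exact eqQ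
  rw [hQd] at e3 z3
  have e3' : ∀ y < D, σ₃.reg y = startEnv N K Q y := by
    intro y hy
    rw [e3 y hy, update_congr e2' 2 Q y hy, startEnv_update_two]
  have hreg : ∀ r < D, startEnv N K Q r < 2 ^ L₃.eval x := by
    intro r _
    exact startEnv_lt ((hNL.trans_le l12).trans_le l23) (hKL.trans_le l23)
      (z3.trans_le (Nat.pow_le_pow_right Nat.two_pos (by omega))) r
  have s0 : σ₃.reg 0 = K := by rw [e3' 0 (by omega)]; simp
  have s1 : σ₃.reg 1 = N := by rw [e3' 1 (by omega)]; simp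
  have s2 : σ₃.reg 2 = Q := by rw [e3' 2 (by omega)]; simp
  have hmem : ∀ b, σ₃.mem b < 2 ^ L₃.eval x := by
    rw [m3, m2, m1]; exact fun b => ((hm b).trans_le l12).trans_le l23
  obtain ⟨σ₄, r4, v4, e4⟩ := hPc D ω σ₃ (L₃.eval x) le_rfl (by omega) (by rw [s0]; exact hK0)
    (fun r hr => by rw [e3' r hr]; exact hreg r hr) hmem (by rw [s1]; omega)
  have hmt : (σ₃.mem, σ₃.tosses) = ((fun a => l.getD a 0 : ℕ → ℕ), 0) := by
    rw [m3, m2, m1, t3, t2, t1]; rfl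
  have hden : (σ₄.mem, σ₄.tosses) = c.den ω (startEnv N K Q) (fun a => l.getD a 0, 0) := by
    rw [v4, hmt]
    exact c.den_congr hD ω hc _ e3'
  have hm4 : σ₄.mem = (c.den ω (startEnv N K Q) (fun a => l.getD a 0, 0)).1 := by rw [← hden]
  have henv₄ : ∀ y < D, σ₄.reg y = startEnv N K Q y := fun y hy => by rw [e4 y hy, e3' y hy]
  have b4 : RamExpr.Bdd D (L₃.eval x) σ₄.reg σ₄.mem := by
    refine ⟨fun r hr => by rw [henv₄ r hr]; exact hreg r hr, ?_, ?_⟩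
    · rw [hm4]
      refine c.den_bdd ω (by simpa using hK0) (hreg 0 (by omega)) (by omega) hc ?_
      exact fun b => ((hm b).trans_le l12).trans_le l23
    · rw [henv₄ 1 (by omega)]
      rw [startEnv_apply_one]
      omega
  obtain ⟨σ₅, r5, e5, m5, t5, z5⟩ := hPa 0 ω σ₄ (L₃.eval x) (by omega) b4
  refine ⟨σ₅, (r1.seq (r2.seq (r3.seq (r4.seq r5)))).mono ?_, ?_⟩
  · rw [hdepth, s2, pow_one]
    simp only [Polynomial.eval_add, Polynomial.eval_comp]
    generalize PN.eval (L₁.eval x) = A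
    generalize PK.eval (L₁.eval x) = B
    generalize PQ.eval (L₂.eval x) = C
    generalize Pc.eval (L₃.eval x) = E
    generalize Pa.eval (L₃.eval x) = F
    nlinarith [Nat.zero_le (Q * A), Nat.zero_le (Q * B), Nat.zero_le (Q * C), Nat.zero_le (Q * F)]
  · rw [e5 0 (by omega)]
    simp only [Function.update_self]
    rw [a.den_congr (by omega) ha _ henv₄, hm4]

/-! ### Indicators -/

open Classical in
/-- One if `p` holds, and zero otherwise. -/
noncomputable def ind (p : Prop) : ℕ := if p then 1 else 0

theorem ind_pos {p : Prop} (h : p) : ind p = 1 := if_pos h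
theorem ind_neg {p : Prop} (h : ¬ p) : ind p = 0 := if_neg h

theorem ind_mul (p r : Prop) : ind p * ind r = ind (p ∧ r) := by
  by_cases hp : p <;> by_cases hr : r <;> simp [ind, hp, hr]

theorem one_sub_ind (p : Prop) : 1 - ind p = ind (¬ p) := by
  by_cases hp : p <;> simp [ind, hp]

theorem prod_ind (s : Finset ℕ) (p : ℕ → Prop) : ∏ i ∈ s, ind (p i) = ind (∀ i ∈ s, p i) := by
  by_cases h : ∀ i ∈ s, p i
  · rw [ind_pos h]
    exact Finset.prod_eq_one fun i hi => ind_pos (h i hi)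
  · rw [ind_neg h]
    push Not at h
    obtain ⟨i, hi, hp⟩ := h
    exact Finset.prod_eq_zero hi (ind_neg hp)

theorem ind_congr {p r : Prop} (h : p ↔ r) : ind p = ind r := by rw [propext h]

theorem ind_le_one (p : Prop) : ind p ≤ 1 := by
  by_cases hp : p <;> simp [ind, hp]

namespace RamExpr

/-! ### Derived expressions -/

instance : Add RamExpr := ⟨op .add⟩
instance : Sub RamExpr := ⟨op .sub⟩
instance : Mul RamExpr := ⟨op .mul⟩
instance : Div RamExpr := ⟨op .div⟩
instance (c : ℕ) : OfNat RamExpr c := ⟨const c⟩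

section Den

variable (env mem : ℕ → ℕ) (a b c : RamExpr)

theorem den_add : (a + b).den env mem = a.den env mem + b.den env mem := rfl
theorem den_sub : (a - b).den env mem = a.den env mem - b.den env mem := rfl
theorem den_mul : (a * b).den env mem = a.den env mem * b.den env mem := rfl
theorem den_div : (a / b).den env mem = a.den env mem / b.den env mem := rfl
theorem den_zero : (0 : RamExpr).den env mem = 0 := rfl
theorem den_one : (1 : RamExpr).den env mem = 1 := rfl
theorem den_two : (2 : RamExpr).den env mem = 2 := rfl
theorem den_three : (3 : RamExpr).den env mem = 3 := rfl
theorem den_five : (5 : RamExpr).den env mem = 5 := rfl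
theorem den_const (n : ℕ) : (const n).den env mem = n := rfl
theorem den_var (x : ℕ) : (var x).den env mem = env x := rfl
theorem den_load : (load a).den env mem = mem (a.den env mem) := rfl
theorem den_sum (x : ℕ) : (sum x a).den env mem =
    ∑ i ∈ Finset.range (env 1), a.den (Function.update env x i) mem := rfl
theorem den_prod (x : ℕ) : (prod x a).den env mem =
    ∏ i ∈ Finset.range (env 1), a.den (Function.update env x i) mem := rfl

def ltE : RamExpr := 1 - (1 - (b - a))
def eqE : RamExpr := 1 - ((a - b) + (b - a))
def modE : RamExpr := a - a / b * b
def iteE : RamExpr := c * a + (1 - c) * b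
/-- `b ^ a`, where `x` is an auxiliary variable -/
def powE (x : ℕ) : RamExpr := prod x (1 + ltE (var x) a * (b - 1))

theorem den_ltE : (ltE a b).den env mem = ind (a.den env mem < b.den env mem) := by
  simp only [ltE, den_sub, den_one]
  by_cases h : a.den env mem < b.den env mem
  · rw [ind_pos h]; omega
  · rw [ind_neg h]; omega

theorem den_eqE : (eqE a b).den env mem = ind (a.den env mem = b.den env mem) := by
  simp only [eqE, den_sub, den_add, den_one]
  by_cases h : a.den env mem = b.den env mem
  · rw [ind_pos h]; omega
  · rw [ind_neg h]; omega

theorem den_modE : (modE a b).den env mem = a.den env mem % b.den env mem := by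
  simp only [modE, den_sub, den_mul, den_div, ← Nat.mod_eq_sub_div_mul]

open Classical in
theorem den_iteE {p : Prop} (h : c.den env mem = ind p) :
    (iteE a b c).den env mem = if p then a.den env mem else b.den env mem := by
  simp only [iteE, den_add, den_mul, den_sub, den_one, h]
  by_cases hp : p <;> simp [ind, hp]

end Den

/-- The variable `x` does not occur. -/
def fresh (x : ℕ) : RamExpr → Bool
  | var y => y != x
  | const _ => true
  | op _ a b => a.fresh x && b.fresh x
  | load a => a.fresh x
  | sum y e => y != x && e.fresh x
  | prod y e => y != x && e.fresh x

theorem den_update {x : ℕ} (hx : x ≠ 1) (e : RamExpr) (he : e.fresh x = true) (mem : ℕ → ℕ) (i : ℕ) :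
    ∀ env : ℕ → ℕ, e.den (Function.update env x i) mem = e.den env mem := by
  induction e with
  | var y =>
    intro env
    simp only [fresh, bne_iff_ne, ne_eq] at he
    simp [den, Function.update_of_ne he]
  | const c => intro env; rfl
  | op o a b iha ihb =>
    intro env
    simp only [fresh, Bool.and_eq_true] at he
    simp only [den, iha he.1, ihb he.2]
  | load a iha => intro env; simp only [den, iha he]
  | sum y e ih | prod y e ih =>
    intro env
    simp only [fresh, Bool.and_eq_true, bne_iff_ne, ne_eq] at he
    simp only [den, Function.update_of_ne hx.symm]
    congr 1
    funext j
    rw [Function.update_comm (Ne.symm he.1), ih he.2]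

theorem den_powE {x : ℕ} (hx : x ≠ 1) {a b : RamExpr} (ha : a.fresh x = true) (hb : b.fresh x = true)
    (env mem : ℕ → ℕ) (hb0 : 0 < b.den env mem) (haN : a.den env mem ≤ env 1) :
    (powE a b x).den env mem = b.den env mem ^ a.den env mem := by
  simp only [powE, den_prod, den_add, den_mul, den_sub, den_one, den_ltE, den_var,
    Function.update_self, den_update hx a ha, den_update hx b hb]
  generalize a.den env mem = u at *
  generalize b.den env mem = v at *
  -- The product always has `env 1` factors; the first `u` are `v`, the remaining ones are `1`. This
  -- needs the exponent to be at most the loop bound, and `v > 0` because of the truncated `v - 1`.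
  obtain ⟨w, hw⟩ : ∃ w, env 1 = u + w := ⟨env 1 - u, by omega⟩
  rw [hw, Finset.prod_range_add]
  have h1 : ∀ i ∈ Finset.range u, 1 + ind (i < u) * (v - 1) = v := by
    intro i hi
    rw [ind_pos (Finset.mem_range.1 hi)]
    omega
  have h2 : ∀ i ∈ Finset.range w, 1 + ind (u + i < u) * (v - 1) = 1 := by
    intro i _
    rw [ind_neg (by omega), zero_mul, Nat.add_zero]
  rw [Finset.prod_congr rfl h1, Finset.prod_eq_one h2]
  simp

/-- `2 ^ N ^ r`, where the variables from `x` on are auxiliary -/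
def towerE : ℕ → ℕ → RamExpr
  | _, 0 => 2
  | x, r + 1 => prod x (towerE (x + 1) r)

theorem den_towerE (mem : ℕ → ℕ) (r : ℕ) : ∀ {x : ℕ}, 1 < x → ∀ env : ℕ → ℕ,
    (towerE x r).den env mem = 2 ^ env 1 ^ r := by
  induction r with
  | zero => intro x _ env; simp [towerE, den_two]
  | succ r ih =>
    intro x hx env
    simp only [towerE, den_prod, ih (show 1 < x + 1 by omega),
      Function.update_of_ne (show 1 ≠ x by omega), Finset.prod_const, Finset.card_range]
    rw [← pow_mul, pow_succ]

end RamExpr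

/-! ### The contents of the memory -/

/-- The number that bounds most loops. -/
def CutInstance.bound (x : CutInstance) : ℕ := x.n + x.m + 5

def CutInstance.Adj (x : CutInstance) (u v : ℕ) : Prop :=
  ∃ (hu : u < x.n) (hv : v < x.n), x.G.Adj ⟨u, hu⟩ ⟨v, hv⟩

def CutInstance.TreeAdj (x : CutInstance) (i j : ℕ) : Prop :=
  ∃ (hi : i < x.m) (hj : j < x.m), x.D.tree.Adj ⟨i, hi⟩ ⟨j, hj⟩

def CutInstance.InBag (x : CutInstance) (i v : ℕ) : Prop :=
  ∃ (hi : i < x.m) (hv : v < x.n), (⟨v, hv⟩ : Fin x.n) ∈ x.D.bag ⟨i, hi⟩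

/-- The memory starts with the code of the instance, whose matrices begin at the address `h`. The
numbers `s` and `t` stand at the addresses `sa` and `ta`. -/
structure Holds (x : CutInstance) (h sa ta s t : ℕ) (mem : ℕ → ℕ) : Prop where
  n : mem 0 = x.n
  m : mem 1 = x.m
  k : mem 2 = x.k
  s : mem sa = s
  t : mem ta = t
  adj : ∀ u < x.n, ∀ v < x.n, mem (h + (u * x.n + v)) = ind (x.Adj u v)
  tree : ∀ i < x.m, ∀ j < x.m, mem (h + x.n * x.n + (i * x.m + j)) = ind (x.TreeAdj i j)
  bag : ∀ i < x.m, ∀ v < x.n,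
    mem (h + x.n * x.n + x.m * x.m + (i * x.n + v)) = ind (x.InBag i v)
  h_le : h ≤ 5
  sa_le : sa < 5
  ta_le : ta < 5

theorem lt_mul_of_lt {i j a b : ℕ} (hi : i < a) (hj : j < b) : i * b + j < a * b := by
  calc i * b + j < i * b + b := by omega
    _ = (i + 1) * b := by ring
    _ ≤ a * b := Nat.mul_le_mul_right _ hi

/-- The input fits below the address `N ^ 2`, with `N = bound`. The coins start at `N ^ 2`, the
search order at `2 * N ^ 2` and the table at `3 * N ^ 2`. -/
theorem CutInstance.bound_sq (x : CutInstance) :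
    x.n * x.n + x.m * x.m + x.m * x.n + 5 < x.bound ^ 2 := by
  unfold CutInstance.bound
  nlinarith [Nat.zero_le (x.n * x.m)]

theorem Holds.congr {x : CutInstance} {h sa ta s t : ℕ} {mem mem' : ℕ → ℕ}
    (H : Holds x h sa ta s t mem) (hm : ∀ a < x.bound ^ 2, mem' a = mem a) :
    Holds x h sa ta s t mem' := by
  have hb := x.bound_sq
  have := H.h_le
  have := H.sa_le
  have := H.ta_le
  refine ⟨?_, ?_, ?_, ?_, ?_, fun u hu v hv => ?_, fun i hi j hj => ?_, fun i hi v hv => ?_,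
    H.h_le, H.sa_le, H.ta_le⟩
  · rw [hm _ (by omega), H.n]
  · rw [hm _ (by omega), H.m]
  · rw [hm _ (by omega), H.k]
  · rw [hm _ (by omega), H.s]
  · rw [hm _ (by omega), H.t]
  · have := lt_mul_of_lt hu hv
    rw [hm _ (by omega), H.adj u hu v hv]
  · have := lt_mul_of_lt hi hj
    rw [hm _ (by omega), H.tree i hi j hj]
  · have := lt_mul_of_lt hi hv
    rw [hm _ (by omega), H.bag i hi v hv]

namespace RamExpr

def nE : RamExpr := load 0
def mE : RamExpr := load 1
def kE : RamExpr := load 2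
/-- The value of `CutInstance.bound`. -/
def NE : RamExpr := var 1

/-- The comparisons give zero for indices out of range, where the load would read an unrelated cell.
-/
def adjE (h : ℕ) (u v : RamExpr) : RamExpr := ltE u nE * (ltE v nE * load (const h + (u * nE + v)))
def treeE (h : ℕ) (i j : RamExpr) : RamExpr :=
  ltE i mE * (ltE j mE * load (const h + nE * nE + (i * mE + j)))
def bagE (h : ℕ) (i v : RamExpr) : RamExpr :=
  ltE i mE * (ltE v nE * load (const h + nE * nE + mE * mE + (i * nE + v)))

section

variable {x : CutInstance} {h sa ta s t : ℕ} {mem : ℕ → ℕ}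

theorem den_adjE (H : Holds x h sa ta s t mem) (env : ℕ → ℕ) (u v : RamExpr) :
    (adjE h u v).den env mem = ind (x.Adj (u.den env mem) (v.den env mem)) := by
  simp only [adjE, nE, den_mul, den_ltE, den_load, den_zero, den_add, den_const, H.n]
  by_cases h1 : u.den env mem < x.n
  · by_cases h2 : v.den env mem < x.n
    · rw [ind_pos h1, ind_pos h2, one_mul, one_mul, H.adj _ h1 _ h2]
    · rw [ind_neg h2, zero_mul, mul_zero, ind_neg fun h => h2 h.2.1]
  · rw [ind_neg h1, zero_mul, ind_neg fun h => h1 h.1]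

theorem den_treeE (H : Holds x h sa ta s t mem) (env : ℕ → ℕ) (u v : RamExpr) :
    (treeE h u v).den env mem = ind (x.TreeAdj (u.den env mem) (v.den env mem)) := by
  simp only [treeE, nE, mE, den_mul, den_ltE, den_load, den_zero, den_one, den_add, den_const,
    H.n, H.m]
  by_cases h1 : u.den env mem < x.m
  · by_cases h2 : v.den env mem < x.m
    · rw [ind_pos h1, ind_pos h2, one_mul, one_mul, H.tree _ h1 _ h2]
    · rw [ind_neg h2, zero_mul, mul_zero, ind_neg fun h => h2 h.2.1]
  · rw [ind_neg h1, zero_mul, ind_neg fun h => h1 h.1]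

theorem den_bagE (H : Holds x h sa ta s t mem) (env : ℕ → ℕ) (u v : RamExpr) :
    (bagE h u v).den env mem = ind (x.InBag (u.den env mem) (v.den env mem)) := by
  simp only [bagE, nE, mE, den_mul, den_ltE, den_load, den_zero, den_one, den_add, den_const,
    H.n, H.m]
  by_cases h1 : u.den env mem < x.m
  · by_cases h2 : v.den env mem < x.n
    · rw [ind_pos h1, ind_pos h2, one_mul, one_mul, H.bag _ h1 _ h2]
    · rw [ind_neg h2, zero_mul, mul_zero, ind_neg fun h => h2 h.2.1]
  · rw [ind_neg h1, zero_mul, ind_neg fun h => h1 h.1]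

end

/-- The node at position `a` of the search order. -/
def ordE (a : RamExpr) : RamExpr := load (2 * (NE * NE) + a)

/-- The node at position `b` of the search order is the parent of the one at position `a`. -/
def isParE (h : ℕ) (a b : RamExpr) : RamExpr := ltE a mE * (ltE b a * treeE h (ordE b) (ordE a))

/-- The node `j` can be appended to the first `var 10 + 1` nodes of the search order. -/
def extE (h : ℕ) (j : RamExpr) : RamExpr :=
  ltE j mE * (prod 20 (1 - ltE (var 20) (var 10 + 1) * eqE (ordE (var 20)) j) *
    (1 - prod 20 (1 - ltE (var 20) (var 10 + 1) * treeE h (ordE (var 20)) j)))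

/-- The node to be appended to the first `var 10 + 1` nodes of the search order. -/
def nextE (h : ℕ) : RamExpr :=
  sum 21 (prod 22 (1 - ltE (var 22) (var 21 + 1) * extE h (var 22)))

/-- The position in the search order that is processed by the dynamic program. -/
def posE : RamExpr := NE - 1 - var 10

/-- The vertex `v` is in the current bag. -/
def curE (h : ℕ) (v : RamExpr) : RamExpr := bagE h (ordE posE) v

/-- The number of vertices before `v` in the current bag. -/
def rankE (h : ℕ) (v : RamExpr) : RamExpr := sum 20 (ltE (var 20) v * curE h (var 20))

/-- The size of the current bag. -/
def cardE (h : ℕ) : RamExpr := sum 20 (curE h (var 20))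

/-- The colour of `v` in the colouring number `var 11` of the current bag. -/
def colE (q h : ℕ) (v : RamExpr) : RamExpr :=
  curE h v * modE (var 11 / powE (rankE h v) (const q) 21) (const q)

/-- The vertex `v` is in the bag of the parent. -/
def parBagE (h : ℕ) (v : RamExpr) : RamExpr :=
  sum 23 (isParE h posE (var 23) * bagE h (ordE (var 23)) v)

/-- The code of the current colouring on the bag of the parent. -/
def keyE (q h : ℕ) : RamExpr :=
  sum 24 (parBagE h (var 24) * (colE q h (var 24) * powE (var 24) (const q) 25))

/-- The code of the current colouring on the bag at position `j`. -/
def childKeyE (q h : ℕ) (j : RamExpr) : RamExpr :=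
  sum 24 (bagE h (ordE j) (var 24) * (colE q h (var 24) * powE (var 24) (const q) 25))

/-- The address of the entry `key` of the table at position `j`. -/
def tableE (q : ℕ) (j key : RamExpr) : RamExpr :=
  3 * (NE * NE) + (j * prod 25 (const q) + key)

/-- The product of the table entries of the children. -/
def childrenE (q h : ℕ) : RamExpr :=
  prod 26 (iteE (load (tableE q (var 26) (childKeyE q h (var 26)))) 1 (isParE h (var 26) posE))

/-- The current node is the first one whose bag contains both `u` and `v`. -/
def ownE (h : ℕ) (u v : RamExpr) : RamExpr :=
  curE h u * (curE h v *
    prod 27 (1 - ltE (var 27) (ordE posE) * (bagE h (var 27) u * bagE h (var 27) v)))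

def sideE (q : ℕ) (a : RamExpr) : RamExpr := (a + const (4 - q)) / 2

/-- The random weight of the vertex `v`. -/
def weightE (v : RamExpr) : RamExpr :=
  sum 28 (load (NE * NE + (v * NE + var 28)) * powE (var 28) (towerE 30 2) 29)

def vertexE (q sa ta : ℕ) (v a : RamExpr) : RamExpr :=
  iteE (iteE 0 (weightE v) (eqE v (load (const ta)))) (iteE 0 1 (eqE v (load (const sa))))
    (eqE (sideE q a) 1)

def edgeE (q : ℕ) (a b : RamExpr) : RamExpr :=
  iteE (iteE 1 0 (eqE a b)) (towerE 30 4) (eqE (sideE q a) (sideE q b))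

def pairE (q h sa ta : ℕ) (u v : RamExpr) : RamExpr :=
  iteE (vertexE q sa ta u (colE q h u))
    (iteE (edgeE q (colE q h u) (colE q h v)) 1 (ltE u v * adjE h u v)) (eqE u v)

/-- The local factor of the current node. -/
def localE (q h sa ta : ℕ) : RamExpr :=
  prod 34 (prod 35 (iteE (pairE q h sa ta (var 34) (var 35)) 1 (ownE h (var 34) (var 35))))

def valueE (q h sa ta : ℕ) : RamExpr :=
  ltE (var 11) (powE (cardE h) (const q) 21) * (localE q h sa ta * childrenE q h)

/-- The number of rounds for each node. -/
def roundsE (q h : ℕ) : RamExpr :=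
  sum 36 (powE (sum 20 (bagE h (var 36) (var 20))) (const q) 21)

/-- Number the digits of the result by four variables. -/
def placeE : RamExpr := ((var 37 * NE + var 38) * NE + var 39) * NE + var 40

def answerE (q : ℕ) : RamExpr :=
  sum 37 (sum 38 (sum 39 (sum 40 (ltE (kE * (NE * NE)) (placeE + 1) *
    modE (load (3 * (NE * NE)) / (powE (var 37) (towerE 42 5) 41 *
      (powE (var 38) (towerE 42 4) 41 * (powE (var 39) (towerE 42 3) 41 *
        powE (var 40) (towerE 42 2) 41))) / const (2 ^ (q - 2))) 2))))

end RamExpr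

open ConnectedCuts.RamExpr in
def coinCmd : Cmd :=
  .loop 1 10 (.loop 1 11 (.flip (NE * NE + (var 10 * NE + var 11))))

-- Position `0` is not written: its cell is zero at the start, so node `0` is the root. When all
-- nodes are listed, `nextE` evaluates to `N`, which is harmless.
open ConnectedCuts.RamExpr in
def orderCmd (h : ℕ) : Cmd :=
  .loop 1 10 (.store (2 * (NE * NE) + (var 10 + 1)) (nextE h))

-- Positions are processed downwards, so children come before parents. The number `var 11` of a
-- colouring has its digits at the ranks of the vertices within the bag, so that exactly `q ^ |B|`
-- numbers are needed; table keys have them at the vertices themselves, so that different bags use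
-- the same code. Each round adds one contribution to the entry of its key. Addresses are spread
-- widely, but cost only their logarithm.
open ConnectedCuts.RamExpr in
def tableCmd (q h sa ta : ℕ) : Cmd :=
  .loop 1 10 (.loop 2 11 (.store (tableE q posE (keyE q h))
    (load (tableE q posE (keyE q h)) + valueE q h sa ta)))

def mainCmd (q h sa ta : ℕ) : Cmd := .seq coinCmd (.seq (orderCmd h) (tableCmd q h sa ta))

open ConnectedCuts.RamExpr in
/-- The algorithm for cut problems. -/
def cutAlgorithm (q h sa ta : ℕ) : Prog :=
  algorithm 50 (nE + mE + 5) (towerE 30 6) (roundsE q h) (mainCmd q h sa ta) (answerE q)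

theorem mainCmd_wf (q h sa ta : ℕ) : (mainCmd q h sa ta).wf 50 = true := by rfl
theorem mainCmd_depth (q h sa ta : ℕ) : (mainCmd q h sa ta).depth = 1 := by rfl
theorem roundsE_wf (q h : ℕ) : (RamExpr.roundsE q h).wf 50 = true := by rfl
theorem answerE_wf (q : ℕ) : (RamExpr.answerE q).wf 50 = true := by rfl
theorem towerE_wf : (RamExpr.towerE 30 6).wf 50 = true := by rfl

/-! ### The values of the expressions -/

/-- The search order stored in the memory. -/
def ordAt (x : CutInstance) (mem : ℕ → ℕ) (a : ℕ) : ℕ := mem (2 * x.bound ^ 2 + a)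

/-- The parent relation between positions of the search order `o`. -/
def CutInstance.IsPar (x : CutInstance) (o : ℕ → ℕ) (a b : ℕ) : Prop :=
  a < x.m ∧ b < a ∧ x.TreeAdj (o b) (o a)

/-- The number of vertices before `v` in the bag of `i`. -/
noncomputable def CutInstance.rank (x : CutInstance) (i v : ℕ) : ℕ :=
  ∑ u ∈ Finset.range x.bound, ind (u < v ∧ x.InBag i u)

/-- The size of the bag of `i`. -/
noncomputable def CutInstance.bagCard (x : CutInstance) (i : ℕ) : ℕ :=
  ∑ u ∈ Finset.range x.bound, ind (x.InBag i u)

/-- The colour of `v` in the colouring number `c` of the bag of `i`. -/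
noncomputable def CutInstance.color (x : CutInstance) (q i c v : ℕ) : ℕ :=
  ind (x.InBag i v) * (c / q ^ x.rank i v % q)

theorem CutInstance.rank_le (x : CutInstance) (i v : ℕ) : x.rank i v ≤ x.bound := by
  refine (Finset.sum_le_sum fun u _ => ind_le_one _).trans ?_
  simp

theorem CutInstance.bagCard_le (x : CutInstance) (i : ℕ) : x.bagCard i ≤ x.bound := by
  refine (Finset.sum_le_sum fun u _ => ind_le_one _).trans ?_
  simp

/-- The number of parents of the position `a` whose bag contains `v`. -/
noncomputable def CutInstance.parBag (x : CutInstance) (o : ℕ → ℕ) (a v : ℕ) : ℕ :=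
  ∑ b ∈ Finset.range x.bound, ind (x.IsPar o a b ∧ x.InBag (o b) v)

/-- The code of the colouring number `c` at the position `a`, restricted to the bag of the
parent. -/
noncomputable def CutInstance.key (x : CutInstance) (q : ℕ) (o : ℕ → ℕ) (a c : ℕ) : ℕ :=
  ∑ v ∈ Finset.range x.bound, x.parBag o a v * (x.color q (o a) c v * q ^ v)

/-- The code of the colouring number `c` at the position `a`, restricted to the bag at the
position `j`. -/
noncomputable def CutInstance.childKey (x : CutInstance) (q : ℕ) (o : ℕ → ℕ) (a j c : ℕ) : ℕ :=
  ∑ v ∈ Finset.range x.bound, ind (x.InBag (o j) v) * (x.color q (o a) c v * q ^ v)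

/-- The address of a table entry. -/
def CutInstance.entry (x : CutInstance) (q j k : ℕ) : ℕ :=
  3 * x.bound ^ 2 + (j * q ^ x.bound + k)

/-- The node `i` is the first one whose bag contains `u` and `v`. -/
def CutInstance.Own (x : CutInstance) (i u v : ℕ) : Prop :=
  x.InBag i u ∧ x.InBag i v ∧ ∀ j < i, ¬ (x.InBag j u ∧ x.InBag j v)

/-- The random weight of the vertex `v`. -/
def CutInstance.weight (x : CutInstance) (mem : ℕ → ℕ) (v : ℕ) : ℕ :=
  ∑ b ∈ Finset.range x.bound, mem (x.bound ^ 2 + (v * x.bound + b)) * (2 ^ x.bound ^ 2) ^ b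

open Classical in
/-- The factor of the pair of vertices `u` and `v` of colours `a` and `b`. -/
noncomputable def CutInstance.pairValue (x : CutInstance) (q s t : ℕ) (mem : ℕ → ℕ)
    (u v a b : ℕ) : ℕ :=
  if u = v then vertexFactor q s t u (x.weight mem u) a
  else if u < v ∧ x.Adj u v then edgeFactor q (2 ^ x.bound ^ 4) a b else 1

open Classical in
/-- The product of the factors of the pairs owned by the node `i`. -/
noncomputable def CutInstance.localValue (x : CutInstance) (q s t : ℕ) (mem : ℕ → ℕ) (i : ℕ)
    (c : ℕ → ℕ) : ℕ :=
  ∏ u ∈ Finset.range x.bound, ∏ v ∈ Finset.range x.bound,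
    if x.Own i u v then x.pairValue q s t mem u v (c u) (c v) else 1

open Classical in
/-- The contribution of the colouring number `c` to the table at the position `a`. -/
noncomputable def CutInstance.value (x : CutInstance) (q s t : ℕ) (mem : ℕ → ℕ) (a c : ℕ) : ℕ :=
  ind (c < q ^ x.bagCard (ordAt x mem a)) *
    (x.localValue q s t mem (ordAt x mem a) (x.color q (ordAt x mem a) c) *
      ∏ j ∈ Finset.range x.bound, if x.IsPar (ordAt x mem) j a then
        mem (x.entry q j (x.childKey q (ordAt x mem) a j c)) else 1)

/-- The number of rounds for each node. -/
noncomputable def CutInstance.rounds (x : CutInstance) (q : ℕ) : ℕ :=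
  ∑ i ∈ Finset.range x.bound, q ^ x.bagCard i

namespace RamExpr

variable {x : CutInstance} {q h sa ta s t : ℕ} {mem env : ℕ → ℕ}

theorem fresh_sub (a b : RamExpr) (y : ℕ) : (a - b).fresh y = (a.fresh y && b.fresh y) := rfl

theorem den_NE (hN : env 1 = x.bound) : NE.den env mem = x.bound := hN

theorem update_one {y : ℕ} (hy : 1 ≠ y) (hN : env 1 = x.bound) (i : ℕ) :
    Function.update env y i 1 = x.bound := by
  rw [Function.update_of_ne hy, hN]

theorem den_ordE (hN : env 1 = x.bound) (a : RamExpr) :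
    (ordE a).den env mem = ordAt x mem (a.den env mem) := by
  simp only [ordE, den_load, den_add, den_mul, den_two, den_NE hN, ordAt, sq]

theorem den_isParE (H : Holds x h sa ta s t mem) (hN : env 1 = x.bound) (a b : RamExpr) :
    (isParE h a b).den env mem =
      ind (x.IsPar (ordAt x mem) (a.den env mem) (b.den env mem)) := by
  simp only [isParE, den_mul, den_ltE, den_treeE H, den_ordE hN, mE, den_load, den_one, H.m,
    ind_mul, CutInstance.IsPar]

theorem den_extE (H : Holds x h sa ta s t mem) (hN : env 1 = x.bound) (h10 : env 10 < x.bound)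
    {j : RamExpr} (hj : j.fresh 20 = true) :
    (extE h j).den env mem =
      ind (Extends x.TreeAdj x.m (ordAt x mem) (env 10) (j.den env mem)) := by
  have h1 : ∀ i, (1 - ltE (var 20) (var 10 + 1) * eqE (ordE (var 20)) j).den
      (Function.update env 20 i) mem =
      ind (¬ (i < env 10 + 1 ∧ ordAt x mem i = j.den env mem)) := by
    intro i
    simp only [den_sub, den_mul, den_ltE, den_eqE,
      den_ordE (update_one (show 1 ≠ 20 by decide) hN i), den_var, den_add, den_one,
      Function.update_self, den_update (show 20 ≠ 1 by decide) j hj, ind_mul,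
      one_sub_ind, Function.update_of_ne (show 10 ≠ 20 by decide)]
  have h2 : ∀ i, (1 - ltE (var 20) (var 10 + 1) * treeE h (ordE (var 20)) j).den
      (Function.update env 20 i) mem =
      ind (¬ (i < env 10 + 1 ∧ x.TreeAdj (ordAt x mem i) (j.den env mem))) := by
    intro i
    simp only [den_sub, den_mul, den_ltE, den_treeE H,
      den_ordE (update_one (show 1 ≠ 20 by decide) hN i), den_var, den_add, den_one,
      Function.update_self, den_update (show 20 ≠ 1 by decide) j hj,
      ind_mul, one_sub_ind, Function.update_of_ne (show 10 ≠ 20 by decide)]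
  simp only [extE, den_mul, den_sub, den_one, den_prod, h1, h2, hN, prod_ind, one_sub_ind, ind_mul,
    den_ltE, mE, den_load, H.m]
  refine ind_congr (and_congr_right fun _ => and_congr ?_ ?_)
  · constructor
    · intro h s hs he
      exact h s (Finset.mem_range.2 (by omega)) ⟨by omega, he⟩
    · rintro h s - ⟨hs, he⟩
      exact h s (by omega) he
  · constructor
    · intro h
      push Not at h
      obtain ⟨s, -, hs, h⟩ := h
      exact ⟨s, by omega, h⟩
    · rintro ⟨s, hs, h⟩ h'
      exact h' s (Finset.mem_range.2 (by omega)) ⟨by omega, h⟩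

open Classical in
theorem den_nextE (H : Holds x h sa ta s t mem) (hN : env 1 = x.bound) (h10 : env 10 < x.bound) :
    (nextE h).den env mem =
      first x.bound (Extends x.TreeAdj x.m (ordAt x mem) (env 10)) := by
  have h1 : ∀ i j, (1 - ltE (var 22) (var 21 + 1) * extE h (var 22)).den
      (Function.update (Function.update env 21 i) 22 j) mem =
      ind (¬ (j < i + 1 ∧ Extends x.TreeAdj x.m (ordAt x mem) (env 10) j)) := by
    intro i j
    rw [den_sub, den_mul, den_extE H
      (update_one (by decide) (update_one (by decide) hN i) j) (by simpa using h10) rfl]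
    simp only [den_ltE, den_add, den_var, den_one, Function.update_self, ind_mul, one_sub_ind,
      Function.update_of_ne (show 21 ≠ 22 by decide),
      Function.update_of_ne (show 10 ≠ 22 by decide),
      Function.update_of_ne (show 10 ≠ 21 by decide)]
  simp only [nextE, den_sum, den_prod, h1, hN, update_one (show 1 ≠ 21 by decide) hN, prod_ind,
    first]
  refine Finset.sum_congr rfl fun i hi => ?_
  have hi' := Finset.mem_range.1 hi
  by_cases hp : ∀ j ≤ i, ¬ Extends x.TreeAdj x.m (ordAt x mem) (env 10) j
  · rw [if_pos hp, ind_pos]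
    rintro j - ⟨hj, hE⟩
    exact hp j (by omega) hE
  · rw [if_neg hp, ind_neg]
    exact fun h => hp fun j hj hE => h j (Finset.mem_range.2 (by omega)) ⟨by omega, hE⟩

/-- The position in the search order. -/
def pos (x : CutInstance) (env : ℕ → ℕ) : ℕ := x.bound - 1 - env 10

theorem den_posE (hN : env 1 = x.bound) : posE.den env mem = pos x env := by
  simp only [posE, den_sub, den_NE hN, den_one, den_var, pos]

theorem pos_update {y : ℕ} (hy : 10 ≠ y) (i : ℕ) : pos x (Function.update env y i) = pos x env := by
  rw [pos, Function.update_of_ne hy, pos]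

theorem den_curE (H : Holds x h sa ta s t mem) (hN : env 1 = x.bound) (v : RamExpr) :
    (curE h v).den env mem = ind (x.InBag (ordAt x mem (pos x env)) (v.den env mem)) := by
  rw [curE, den_bagE H, den_ordE hN, den_posE hN]

theorem den_rankE (H : Holds x h sa ta s t mem) (hN : env 1 = x.bound) {v : RamExpr}
    (hv : v.fresh 20 = true) :
    (rankE h v).den env mem = x.rank (ordAt x mem (pos x env)) (v.den env mem) := by
  simp only [rankE, den_sum, den_mul, den_ltE, den_var, Function.update_self,
    den_update (show 20 ≠ 1 by decide) v hv, hN, CutInstance.rank]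
  refine Finset.sum_congr rfl fun i _ => ?_
  rw [den_curE H (update_one (by decide) hN i), pos_update (by decide), den_var,
    Function.update_self, ind_mul]

theorem den_cardE (H : Holds x h sa ta s t mem) (hN : env 1 = x.bound) :
    (cardE h).den env mem = x.bagCard (ordAt x mem (pos x env)) := by
  simp only [cardE, den_sum, hN, CutInstance.bagCard]
  refine Finset.sum_congr rfl fun i _ => ?_
  rw [den_curE H (update_one (by decide) hN i), pos_update (by decide), den_var,
    Function.update_self]

theorem den_colE (hq : 0 < q) (H : Holds x h sa ta s t mem) (hN : env 1 = x.bound) {v : RamExpr}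
    (hv : v.fresh 20 = true) (hv' : v.fresh 21 = true) :
    (colE q h v).den env mem =
      x.color q (ordAt x mem (pos x env)) (env 11) (v.den env mem) := by
  have hr : (rankE h v).fresh 21 = true := by
    simp [rankE, curE, bagE, ltE, ordE, posE, NE, nE, mE, fresh_sub, fresh, hv']
  rw [colE, den_mul, den_curE H hN, den_modE, den_div, den_const,
    den_powE (b := const q) (by decide) hr rfl env mem hq
      (by rw [den_rankE H hN hv, hN]; exact x.rank_le _ _), den_rankE H hN hv, den_const]
  rfl

theorem den_parBagE (H : Holds x h sa ta s t mem) (hN : env 1 = x.bound) {v : RamExpr}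
    (hv : v.fresh 23 = true) : (parBagE h v).den env mem =
      x.parBag (ordAt x mem) (pos x env) (v.den env mem) := by
  simp only [parBagE, den_sum, den_mul, hN, CutInstance.parBag]
  refine Finset.sum_congr rfl fun i _ => ?_
  have hN' := update_one (show 1 ≠ 23 by decide) hN i
  rw [den_isParE H hN', den_bagE H, den_ordE hN', den_posE hN', den_var, Function.update_self,
    pos_update (by decide), den_update (by decide) v hv, ind_mul]

theorem den_keyE (hq : 0 < q) (H : Holds x h sa ta s t mem) (hN : env 1 = x.bound) :
    (keyE q h).den env mem = x.key q (ordAt x mem) (pos x env) (env 11) := by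
  simp only [keyE, den_sum, den_mul, hN, CutInstance.key]
  refine Finset.sum_congr rfl fun i hi => ?_
  have hN' := update_one (show 1 ≠ 24 by decide) hN i
  rw [den_parBagE H hN' rfl, den_colE hq H hN' rfl rfl,
    den_powE (a := var 24) (b := const q) (by decide) rfl rfl _ _ hq
      (by rw [den_var, Function.update_self, hN']; exact (Finset.mem_range.1 hi).le),
    den_var, Function.update_self, pos_update (by decide), den_const,
    Function.update_of_ne (show 11 ≠ 24 by decide)]

theorem den_childKeyE (hq : 0 < q) (H : Holds x h sa ta s t mem) (hN : env 1 = x.bound) {j : RamExpr}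
    (hj : j.fresh 24 = true) : (childKeyE q h j).den env mem =
      x.childKey q (ordAt x mem) (pos x env) (j.den env mem) (env 11) := by
  simp only [childKeyE, den_sum, den_mul, hN, CutInstance.childKey]
  refine Finset.sum_congr rfl fun i hi => ?_
  have hN' := update_one (show 1 ≠ 24 by decide) hN i
  rw [den_bagE H, den_ordE hN', den_colE hq H hN' rfl rfl,
    den_powE (a := var 24) (b := const q) (by decide) rfl rfl _ _ hq
      (by rw [den_var, Function.update_self, hN']; exact (Finset.mem_range.1 hi).le),
    den_var, Function.update_self, pos_update (by decide), den_const,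
    Function.update_of_ne (show 11 ≠ 24 by decide), den_update (by decide) j hj]

theorem den_tableE (hN : env 1 = x.bound) (j k : RamExpr) : (tableE q j k).den env mem =
    x.entry q (j.den env mem) (k.den env mem) := by
  simp only [tableE, den_add, den_mul, den_three, den_NE hN, den_prod, den_const, hN,
    Finset.prod_const, Finset.card_range, CutInstance.entry, sq]

open Classical in
theorem den_childrenE (hq : 0 < q) (H : Holds x h sa ta s t mem) (hN : env 1 = x.bound) :
    (childrenE q h).den env mem = ∏ j ∈ Finset.range x.bound,
      if x.IsPar (ordAt x mem) j (pos x env) then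
        mem (x.entry q j (x.childKey q (ordAt x mem) (pos x env) j (env 11))) else 1 := by
  simp only [childrenE, den_prod, hN]
  refine Finset.prod_congr rfl fun i _ => ?_
  have hN' := update_one (show 1 ≠ 26 by decide) hN i
  rw [den_iteE _ _ _ _ _ (den_isParE H hN' _ _), den_posE hN', den_var, Function.update_self,
    pos_update (by decide), den_load, den_tableE hN', den_childKeyE hq H hN' rfl, den_var,
    Function.update_self, pos_update (by decide), Function.update_of_ne (show 11 ≠ 26 by decide),
    den_one]

theorem den_ownE (H : Holds x h sa ta s t mem) (hN : env 1 = x.bound) {u v : RamExpr}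
    (hu : u.fresh 27 = true) (hv : v.fresh 27 = true) : (ownE h u v).den env mem =
      ind (x.Own (ordAt x mem (pos x env)) (u.den env mem) (v.den env mem)) := by
  have h1 : ∀ i, (1 - ltE (var 27) (ordE posE) * (bagE h (var 27) u * bagE h (var 27) v)).den
      (Function.update env 27 i) mem = ind (¬ (i < ordAt x mem (pos x env) ∧
        x.InBag i (u.den env mem) ∧ x.InBag i (v.den env mem))) := by
    intro i
    have hN' := update_one (show 1 ≠ 27 by decide) hN i
    rw [den_sub, den_mul, den_mul, den_bagE H, den_bagE H, den_ltE, den_ordE hN', den_posE hN',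
      den_var, Function.update_self, pos_update (by decide), den_update (by decide) u hu,
      den_update (by decide) v hv, ind_mul, ind_mul, den_one, one_sub_ind]
  simp only [ownE, den_mul, den_curE H hN, den_prod, hN, h1, prod_ind, ind_mul]
  refine ind_congr (and_congr_right fun h1 => and_congr_right fun _ => ?_)
  -- The product over `var 27` stops at `N`; this covers all smaller nodes because a node with a
  -- vertex in its bag is below `m`.
  have hlt : ordAt x mem (pos x env) < x.bound := by
    have := h1.1
    unfold CutInstance.bound
    omega
  constructor
  · intro h i hi hb
    exact h i (Finset.mem_range.2 (hi.trans hlt)) ⟨hi, hb⟩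
  · rintro h i - ⟨hi, hb⟩
    exact h i hi hb

theorem den_sideE (a : RamExpr) : (sideE q a).den env mem = side q (a.den env mem) := rfl

theorem den_weightE (hN : env 1 = x.bound) {v : RamExpr} (hv : v.fresh 28 = true) :
    (weightE v).den env mem = x.weight mem (v.den env mem) := by
  simp only [weightE, den_sum, den_mul, hN, CutInstance.weight]
  refine Finset.sum_congr rfl fun i hi => ?_
  have hN' := update_one (show 1 ≠ 28 by decide) hN i
  rw [den_powE (a := var 28) (b := towerE 30 2) (by decide) rfl rfl _ _
      (by rw [den_towerE _ _ (by decide)]; positivity)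
      (by rw [den_var, Function.update_self, hN']; exact (Finset.mem_range.1 hi).le),
    den_towerE _ _ (by decide), hN', den_load, den_add, den_mul, den_add, den_mul, den_NE hN',
    den_var, Function.update_self, den_update (by decide) v hv, sq]

open Classical in
theorem den_vertexE (H : Holds x h sa ta s t mem) (hN : env 1 = x.bound) {v : RamExpr} (a : RamExpr)
    (hv : v.fresh 28 = true) : (vertexE q sa ta v a).den env mem =
      vertexFactor q s t (v.den env mem) (x.weight mem (v.den env mem)) (a.den env mem) := by
  rw [vertexE, den_iteE _ _ _ _ _ (den_eqE _ _ _ _), den_iteE _ _ _ _ _ (den_eqE _ _ _ _),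
    den_iteE _ _ _ _ _ (den_eqE _ _ _ _), den_weightE hN hv, den_sideE, den_load, den_load,
    den_const, den_const, H.s, H.t, den_zero, den_one, vertexFactor]
  congr

open Classical in
theorem den_edgeE (hN : env 1 = x.bound) (a b : RamExpr) : (edgeE q a b).den env mem =
      edgeFactor q (2 ^ x.bound ^ 4) (a.den env mem) (b.den env mem) := by
  rw [edgeE, den_iteE _ _ _ _ _ (den_eqE _ _ _ _), den_iteE _ _ _ _ _ (den_eqE _ _ _ _),
    den_towerE _ _ (by decide), hN, den_sideE, den_sideE, den_zero, den_one, edgeFactor]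
  congr

theorem den_pairE (hq : 0 < q) (H : Holds x h sa ta s t mem) (hN : env 1 = x.bound) :
    (pairE q h sa ta (var 34) (var 35)).den env mem =
      x.pairValue q s t mem (env 34) (env 35)
        (x.color q (ordAt x mem (pos x env)) (env 11) (env 34))
        (x.color q (ordAt x mem (pos x env)) (env 11) (env 35)) := by
  rw [pairE, den_iteE _ _ _ _ _ (den_eqE _ _ _ _), den_iteE _ _ _ _ _
      (show _ = ind (env 34 < env 35 ∧ x.Adj (env 34) (env 35)) by
        rw [den_mul, den_ltE, den_adjE H, ind_mul, den_var, den_var]),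
    den_vertexE H hN _ rfl, den_edgeE hN, den_colE hq H hN rfl rfl, den_colE hq H hN rfl rfl,
    den_one, den_var, den_var, CutInstance.pairValue]
  congr

theorem den_localE (hq : 0 < q) (H : Holds x h sa ta s t mem) (hN : env 1 = x.bound) :
    (localE q h sa ta).den env mem =
      x.localValue q s t mem (ordAt x mem (pos x env))
        (x.color q (ordAt x mem (pos x env)) (env 11)) := by
  simp only [localE, den_prod, hN, update_one (show 1 ≠ 34 by decide) hN, CutInstance.localValue]
  refine Finset.prod_congr rfl fun u _ => Finset.prod_congr rfl fun v _ => ?_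
  have hN' := update_one (show 1 ≠ 35 by decide) (update_one (show 1 ≠ 34 by decide) hN u) v
  rw [den_iteE _ _ _ _ _ (den_ownE H hN' rfl rfl), den_pairE hq H hN', den_var, den_var, den_one,
    Function.update_self, Function.update_of_ne (show 34 ≠ 35 by decide), Function.update_self,
    Function.update_of_ne (show 11 ≠ 35 by decide), Function.update_of_ne (show 11 ≠ 34 by decide),
    pos_update (by decide), pos_update (by decide)]

/-- The value added to the table in a round. -/
theorem den_valueE (hq : 0 < q) (H : Holds x h sa ta s t mem) (hN : env 1 = x.bound) :
    (valueE q h sa ta).den env mem = x.value q s t mem (pos x env) (env 11) := by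
  rw [valueE, den_mul, den_mul, den_ltE, den_localE hq H hN, den_childrenE hq H hN, den_var,
    den_powE (a := cardE h) (b := const q) (by decide) rfl rfl _ _ hq
      (by rw [den_cardE H hN, hN]; exact x.bagCard_le _), den_cardE H hN, den_const,
    CutInstance.value]

theorem den_roundsE (hq : 0 < q) (H : Holds x h sa ta s t mem) (hN : env 1 = x.bound) :
    (roundsE q h).den env mem = x.rounds q := by
  have h1 : ∀ i, (sum 20 (bagE h (var 36) (var 20))).den (Function.update env 36 i) mem =
      x.bagCard i := by
    intro i
    simp only [den_sum, update_one (show 1 ≠ 36 by decide) hN, CutInstance.bagCard]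
    refine Finset.sum_congr rfl fun u _ => ?_
    rw [den_bagE H, den_var, den_var, Function.update_self,
      Function.update_of_ne (show 36 ≠ 20 by decide), Function.update_self]
  simp only [roundsE, den_sum, hN, CutInstance.rounds]
  refine Finset.sum_congr rfl fun i _ => ?_
  rw [den_powE (a := sum 20 (bagE h (var 36) (var 20))) (b := const q) (by decide) rfl rfl _ _ hq
      (by rw [h1, update_one (by decide) hN]; exact x.bagCard_le _), h1, den_const]

end RamExpr

/-! ### The memory after each phase of the algorithm -/

theorem Cmd.loop_induction {ω : ℕ → Bool} {b x : ℕ} {c : Cmd} {env : ℕ → ℕ}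
    {s : (ℕ → ℕ) × ℕ} (P : ℕ → (ℕ → ℕ) × ℕ → Prop) (h0 : P 0 s)
    (hs : ∀ i < env b, ∀ s', P i s' → P (i + 1) (c.den ω (Function.update env x i) s')) :
    P (env b) ((Cmd.loop b x c).den ω env s) := by
  rw [Cmd.den]
  have : ∀ k ≤ env b, P k (Nat.rec s (fun i s' => c.den ω (Function.update env x i) s') k) := by
    intro k
    induction k with
    | zero => exact fun _ => h0
    | succ k ih => exact fun hk => hs k hk _ (ih (by omega))
  exact this _ le_rfl

/-- The first `j` coins stand in the memory from the address `A` on. -/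
def HoldsCoins (ω : ℕ → Bool) (A j : ℕ) (mem : ℕ → ℕ) (s : (ℕ → ℕ) × ℕ) : Prop :=
  s.2 = j ∧ ∀ a, s.1 a = if A ≤ a ∧ a < A + j then (if ω (a - A) then 1 else 0) else mem a

theorem coinCmd_spec (ω : ℕ → Bool) (env mem : ℕ → ℕ) :
    HoldsCoins ω (env 1 * env 1) (env 1 * env 1) mem (coinCmd.den ω env (mem, 0)) := by
  refine Cmd.loop_induction (fun v s => HoldsCoins ω (env 1 * env 1) (v * env 1) mem s)
    ⟨by simp, fun a => ?_⟩ fun v hv s hs => ?_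
  · rw [if_neg (by omega)]
  have h1 : Function.update env 10 v 1 = env 1 := Function.update_of_ne (by decide) _ _
  have := Cmd.loop_induction (ω := ω) (b := 1) (x := 11)
    (c := .flip (RamExpr.NE * RamExpr.NE + (RamExpr.var 10 * RamExpr.NE + RamExpr.var 11)))
    (env := Function.update env 10 v) (s := s)
    (fun b s => HoldsCoins ω (env 1 * env 1) (v * env 1 + b) mem s) (by simpa using hs) ?_
  · rw [h1] at this
    rw [add_mul, one_mul]
    exact this
  rintro b hb s' ⟨e1, e2⟩
  refine ⟨by simp [Cmd.den, e1, add_assoc], fun a => ?_⟩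
  have hA : (RamExpr.NE * RamExpr.NE + (RamExpr.var 10 * RamExpr.NE + RamExpr.var 11)).den
      (Function.update (Function.update env 10 v) 11 b) s'.1 =
      env 1 * env 1 + (v * env 1 + b) := by
    simp [RamExpr.den_add, RamExpr.den_mul, RamExpr.NE, RamExpr.den_var]
  simp only [Cmd.den, hA, e1]
  by_cases ha : a = env 1 * env 1 + (v * env 1 + b)
  · subst ha
    rw [Function.update_self, if_pos (show _ ∧ _ from ⟨Nat.le_add_right _ _, by omega⟩),
      Nat.add_sub_cancel_left]
  · rw [Function.update_of_ne ha, e2]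
    by_cases h : env 1 * env 1 ≤ a ∧ a < env 1 * env 1 + (v * env 1 + b)
    · rw [if_pos h, if_pos (show env 1 * env 1 ≤ a ∧ _ from ⟨h.1, by omega⟩)]
    · rw [if_neg h, if_neg (by omega)]

theorem Extends.congr {T : ℕ → ℕ → Prop} {m t i : ℕ} {o o' : ℕ → ℕ} (h : ∀ s ≤ t, o' s = o s) :
    Extends T m o' t i ↔ Extends T m o t i := by
  unfold Extends
  refine and_congr_right fun _ => and_congr ?_ ?_
  · exact forall₂_congr fun s hs => by rw [h s hs]
  · exact exists_congr fun s => and_congr_right fun hs => by rw [h s hs]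

variable {x : CutInstance} {q h sa ta s t : ℕ}

/-- Appending a node does not change the earlier part of the order, on which the choices already
made depend. Since `N` is below the modulus, the stored nodes are not altered by the reduction. -/
theorem orderCmd_spec {mem env : ℕ → ℕ} (ω : ℕ → Bool) (τ : ℕ) (H : Holds x h sa ta s t mem)
    (hN : env 1 = x.bound) (hK : x.bound < env 0) :
    (∀ a, (a ≤ 2 * x.bound ^ 2 ∨ 2 * x.bound ^ 2 + x.bound < a) →
      ((orderCmd h).den ω env (mem, τ)).1 a = mem a) ∧
    ∀ r < x.bound, (∃ i < x.m, Extends x.TreeAdj x.m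
        (ordAt x ((orderCmd h).den ω env (mem, τ)).1) r i) →
      Extends x.TreeAdj x.m (ordAt x ((orderCmd h).den ω env (mem, τ)).1) r
        (ordAt x ((orderCmd h).den ω env (mem, τ)).1 (r + 1)) := by
  classical
  have hmN : x.m ≤ x.bound := by unfold CutInstance.bound; omega
  have key := Cmd.loop_induction (ω := ω) (b := 1) (x := 10)
    (c := .store (2 * (RamExpr.NE * RamExpr.NE) + (RamExpr.var 10 + 1)) (RamExpr.nextE h))
    (env := env) (s := (mem, τ))
    (fun j s' => (∀ a, (a ≤ 2 * x.bound ^ 2 ∨ 2 * x.bound ^ 2 + j < a) → s'.1 a = mem a) ∧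
      ∀ r < j, ordAt x s'.1 (r + 1) =
        first x.bound (Extends x.TreeAdj x.m (ordAt x s'.1) r))
    ⟨fun _ _ => rfl, fun r hr => absurd hr (by omega)⟩ ?_
  · rw [hN] at key
    refine ⟨key.1, fun r hr hex => ?_⟩
    obtain ⟨i, hi, hE⟩ := hex
    have := key.2 r hr
    unfold orderCmd
    rw [this]
    exact first_spec ⟨i, by omega, hE⟩
  rintro j hj s' ⟨e1, e2⟩
  rw [hN] at hj
  have H' : Holds x h sa ta s t s'.1 := H.congr fun a ha => e1 a (by omega)
  have hA : (2 * (RamExpr.NE * RamExpr.NE) + (RamExpr.var 10 + 1)).den (Function.update env 10 j) s'.1 =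
      2 * x.bound ^ 2 + (j + 1) := by
    simp [RamExpr.den_add, RamExpr.den_mul, RamExpr.NE, RamExpr.den_var, RamExpr.den_one, RamExpr.den_two, hN, sq]
  have hV := RamExpr.den_nextE (env := Function.update env 10 j) H'
    (RamExpr.update_one (by decide) hN j) (by simpa using hj)
  simp only [Function.update_self] at hV
  have h0 : Function.update env 10 j 0 = env 0 := Function.update_of_ne (by decide) _ _
  simp only [Cmd.den, hA, hV, h0]
  rw [Nat.mod_eq_of_lt ((first_le _ _).trans_lt hK)]
  set u := first x.bound (Extends x.TreeAdj x.m (ordAt x s'.1) j) with hu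
  have hord : ∀ r, ordAt x (Function.update s'.1 (2 * x.bound ^ 2 + (j + 1)) u) r =
      if r = j + 1 then u else ordAt x s'.1 r := by
    intro r
    unfold ordAt
    by_cases hr : r = j + 1
    · subst hr; simp
    · rw [Function.update_of_ne (by omega), if_neg hr]
  refine ⟨fun a ha => ?_, fun r hr => ?_⟩
  · rw [Function.update_of_ne (by omega), e1 a (by omega)]
  · have hE : Extends x.TreeAdj x.m
        (ordAt x (Function.update s'.1 (2 * x.bound ^ 2 + (j + 1)) u)) r =
        Extends x.TreeAdj x.m (ordAt x s'.1) r := by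
      funext i
      exact propext (Extends.congr fun r' hr' => by rw [hord, if_neg (by omega)])
    rw [hord]
    simp only [hE]
    by_cases hrj : r = j
    · subst hrj; rw [if_pos rfl, hu]
    · rw [if_neg (by omega), e2 r (by omega)]

/-! ### The table -/

theorem CutInstance.color_lt (hq : 0 < q) (i c v : ℕ) : x.color q i c v < q := by
  unfold CutInstance.color
  have := Nat.mod_lt (c / q ^ x.rank i v) hq
  by_cases hv : x.InBag i v
  · rwa [ind_pos hv, one_mul]
  · rwa [ind_neg hv, zero_mul]

theorem sum_le_one_mul_lt {N : ℕ} (a c : ℕ → ℕ) (ha : ∀ v, a v ≤ 1)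
    (hc : ∀ v, c v < q) : ∑ v ∈ Finset.range N, a v * (c v * q ^ v) < q ^ N := by
  simp only [← mul_assoc]
  refine sum_mul_pow_lt (fun v => a v * c v) (fun v => ?_) N
  calc a v * c v ≤ 1 * c v := Nat.mul_le_mul_right _ (ha v)
    _ < q := by simpa using hc v

theorem CutInstance.key_lt (hq : 0 < q) {o : ℕ → ℕ} (ho : ∀ a v, x.parBag o a v ≤ 1) (a c : ℕ) :
    x.key q o a c < q ^ x.bound :=
  sum_le_one_mul_lt _ _ (ho a) fun _ => color_lt hq _ _ _

theorem CutInstance.childKey_lt (hq : 0 < q) (o : ℕ → ℕ) (a j c : ℕ) :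
    x.childKey q o a j c < q ^ x.bound :=
  sum_le_one_mul_lt _ _ (fun _ => ind_le_one _) fun _ => color_lt hq _ _ _

/-- Rows of length `q ^ N` do not overlap, as all keys are below `q ^ N`. -/
theorem CutInstance.entry_inj {j j' k k' : ℕ} (hk : k < q ^ x.bound) (hk' : k' < q ^ x.bound)
    (he : x.entry q j k = x.entry q j' k') : j = j' ∧ k = k' := by
  have he' : j * q ^ x.bound + k = j' * q ^ x.bound + k' := by
    unfold CutInstance.entry at he; omega
  have hj : j = j' := by
    rcases lt_trichotomy j j' with hl | hl | hl
    · have := Nat.mul_le_mul_right (q ^ x.bound) (show j + 1 ≤ j' from hl)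
      rw [add_mul] at this; omega
    · exact hl
    · have := Nat.mul_le_mul_right (q ^ x.bound) (show j' + 1 ≤ j from hl)
      rw [add_mul] at this; omega
  subst hj
  exact ⟨rfl, by omega⟩

theorem ordAt_congr {mem mem' : ℕ → ℕ} (h1 : ∀ a < 3 * x.bound ^ 2, mem' a = mem a) {r : ℕ}
    (hr : r < x.bound) : ordAt x mem' r = ordAt x mem r := by
  have : x.bound ≤ x.bound ^ 2 := Nat.le_self_pow (by decide) _
  exact h1 _ (by omega)

theorem CutInstance.isPar_congr {mem mem' : ℕ → ℕ} (h1 : ∀ a < 3 * x.bound ^ 2, mem' a = mem a)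
    (a b : ℕ) : x.IsPar (ordAt x mem') a b ↔ x.IsPar (ordAt x mem) a b := by
  have hmN : x.m ≤ x.bound := by unfold CutInstance.bound; omega
  refine and_congr_right fun ha => and_congr_right fun hb => ?_
  rw [ordAt_congr h1 (by omega), ordAt_congr h1 (by omega)]

theorem CutInstance.key_congr {mem mem' : ℕ → ℕ} (h1 : ∀ a < 3 * x.bound ^ 2, mem' a = mem a)
    {p : ℕ} (hp : p < x.bound) (c : ℕ) :
    x.key q (ordAt x mem') p c = x.key q (ordAt x mem) p c := by
  unfold CutInstance.key CutInstance.parBag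
  rw [ordAt_congr h1 hp]
  refine Finset.sum_congr rfl fun v _ => ?_
  congr 1
  refine Finset.sum_congr rfl fun b hb => ?_
  rw [ordAt_congr h1 (Finset.mem_range.1 hb)]
  exact ind_congr (and_congr_left fun _ => isPar_congr h1 _ _)

theorem CutInstance.weight_congr {mem mem' : ℕ → ℕ}
    (h1 : ∀ a < 3 * x.bound ^ 2, mem' a = mem a) {v : ℕ} (hv : v < x.bound) :
    x.weight mem' v = x.weight mem v := by
  refine Finset.sum_congr rfl fun b hb => ?_
  have := lt_mul_of_lt hv (Finset.mem_range.1 hb)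
  rw [h1 _ (by rw [sq]; omega)]

/-- The value at position `p` reads only the part below the table and the rows of later positions.
So it does not change while row `p` is being filled or when earlier positions are processed. -/
theorem CutInstance.value_congr (hq : 0 < q) {mem mem' : ℕ → ℕ}
    (h1 : ∀ a < 3 * x.bound ^ 2, mem' a = mem a) {p : ℕ} (hp : p < x.bound)
    (h2 : ∀ j, p < j → j < x.bound → ∀ κ < q ^ x.bound,
      mem' (x.entry q j κ) = mem (x.entry q j κ)) (c : ℕ) :
    x.value q s t mem' p c = x.value q s t mem p c := by
  have hmN : x.m ≤ x.bound := by unfold CutInstance.bound; omega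
  unfold CutInstance.value
  rw [ordAt_congr h1 hp]
  congr 2
  · unfold CutInstance.localValue
    refine Finset.prod_congr rfl fun u hu => Finset.prod_congr rfl fun v _ => ?_
    unfold CutInstance.pairValue
    rw [weight_congr h1 (Finset.mem_range.1 hu)]
  · refine Finset.prod_congr rfl fun j hj => ?_
    have hck : x.childKey q (ordAt x mem') p j c = x.childKey q (ordAt x mem) p j c := by
      unfold CutInstance.childKey
      rw [ordAt_congr h1 hp, ordAt_congr h1 (Finset.mem_range.1 hj)]
    by_cases hpar : x.IsPar (ordAt x mem) j p
    · rw [if_pos hpar, if_pos ((isPar_congr h1 j p).2 hpar), hck]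
      exact h2 j hpar.2.1 (Finset.mem_range.1 hj) _ (childKey_lt hq _ _ _ _)
    · rw [if_neg hpar, if_neg fun hpar_new => hpar ((isPar_congr h1 j p).1 hpar_new)]

/-- The rows of the table satisfy the recurrence of the dynamic program. -/
theorem tableCmd_spec (hq : 0 < q) {mem env : ℕ → ℕ} (ω : ℕ → Bool) (τ : ℕ)
    (H : Holds x h sa ta s t mem) (hN : env 1 = x.bound)
    (ho : ∀ a v, x.parBag (ordAt x mem) a v ≤ 1)
    (h0 : ∀ a, 3 * x.bound ^ 2 ≤ a → mem a = 0) :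
    (∀ a < 3 * x.bound ^ 2, ((tableCmd q h sa ta).den ω env (mem, τ)).1 a = mem a) ∧
    ∀ p < x.bound, ∀ κ < q ^ x.bound,
      (((tableCmd q h sa ta).den ω env (mem, τ)).1 (x.entry q p κ) : ZMod (env 0)) =
      ∑ c ∈ Finset.range (env 2) with
          x.key q (ordAt x ((tableCmd q h sa ta).den ω env (mem, τ)).1) p c = κ,
        (x.value q s t ((tableCmd q h sa ta).den ω env (mem, τ)).1 p c : ZMod (env 0)) := by
  have h3 : ∀ j κ, 3 * x.bound ^ 2 ≤ x.entry q j κ := fun j κ => Nat.le_add_right _ _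
  have outer := Cmd.loop_induction (ω := ω) (b := 1) (x := 10)
    (c := .loop 2 11 (.store (RamExpr.tableE q RamExpr.posE (RamExpr.keyE q h))
      (.load (RamExpr.tableE q RamExpr.posE (RamExpr.keyE q h)) + RamExpr.valueE q h sa ta)))
    (env := env) (s := (mem, τ))
    -- After `j` rounds the last `j` rows are complete and the others are still zero.
    (fun j s' => (∀ a < 3 * x.bound ^ 2, s'.1 a = mem a) ∧
      (∀ p < x.bound - j, ∀ κ < q ^ x.bound, s'.1 (x.entry q p κ) = 0) ∧
      ∀ p < x.bound, x.bound - j ≤ p → ∀ κ < q ^ x.bound,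
        (s'.1 (x.entry q p κ) : ZMod (env 0)) =
        ∑ c ∈ Finset.range (env 2) with x.key q (ordAt x s'.1) p c = κ,
          (x.value q s t s'.1 p c : ZMod (env 0)))
    ⟨fun _ _ => rfl, fun _ _ _ _ => h0 _ (h3 _ _), fun p hp hp' => absurd hp (by omega)⟩ ?_
  · rw [hN] at outer
    exact ⟨outer.1, fun p hp => outer.2.2 p hp (by omega)⟩
  rintro j hj ⟨M, τ'⟩ ⟨e1, e2, e3⟩
  rw [hN] at hj
  simp only at e1 e2 e3
  set p := x.bound - 1 - j with hp
  have hpN : p < x.bound := by omega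
  have hN1 : Function.update env 10 j 1 = x.bound := RamExpr.update_one (by decide) hN j
  have inner := Cmd.loop_induction (ω := ω) (b := 2) (x := 11)
    (c := .store (RamExpr.tableE q RamExpr.posE (RamExpr.keyE q h))
      (.load (RamExpr.tableE q RamExpr.posE (RamExpr.keyE q h)) + RamExpr.valueE q h sa ta))
    (env := Function.update env 10 j) (s := (M, τ'))
    -- The invariant refers to the memory `M` at the start of the row, not to the changing one;
    -- `value_congr` justifies this.
    (fun i s' => (∀ a < 3 * x.bound ^ 2, s'.1 a = M a) ∧
      (∀ r ≠ p, ∀ κ < q ^ x.bound, s'.1 (x.entry q r κ) = M (x.entry q r κ)) ∧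
      ∀ κ < q ^ x.bound, (s'.1 (x.entry q p κ) : ZMod (env 0)) =
        ∑ c ∈ Finset.range i with x.key q (ordAt x M) p c = κ,
          (x.value q s t M p c : ZMod (env 0)))
    ⟨fun _ _ => rfl, fun _ _ _ _ => rfl, fun κ hκ => by simp [e2 p (by omega) κ hκ]⟩ ?_
  · rw [Function.update_of_ne (show 2 ≠ 10 by decide)] at inner
    generalize Cmd.den ω _ (Function.update env 10 j) (M, τ') = s' at inner
    obtain ⟨i1, i2, i3⟩ := inner
    refine ⟨fun a ha => (i1 a ha).trans (e1 a ha), fun r hr κ hκ => ?_, fun r hr hr' κ hκ => ?_⟩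
    · rw [i2 r (by omega) κ hκ, e2 r (by omega) κ hκ]
    · have hval : ∀ c, x.value q s t s'.1 r c = x.value q s t M r c := fun c =>
        CutInstance.value_congr hq i1 hr (fun l hl _ κ hκ => i2 l (by omega) κ hκ) c
      simp only [CutInstance.key_congr i1 hr, hval]
      by_cases hrp : r = p
      · subst hrp
        exact i3 κ hκ
      · rw [i2 r hrp κ hκ]
        exact e3 r hr (by omega) κ hκ
  rintro i - ⟨M', τ''⟩ ⟨i1, i2, i3⟩
  simp only at i1 i2 i3
  have hN2 : Function.update (Function.update env 10 j) 11 i 1 = x.bound :=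
    RamExpr.update_one (by decide) hN1 i
  have H' : Holds x h sa ta s t M' := H.congr fun a ha => by
    rw [i1 a (by omega), e1 a (by omega)]
  have hpos : RamExpr.pos x (Function.update (Function.update env 10 j) 11 i) = p := by
    simp [RamExpr.pos, hp]
  have hkey : x.key q (ordAt x M') p i = x.key q (ordAt x M) p i := CutInstance.key_congr i1 hpN i
  have hA : (RamExpr.tableE q RamExpr.posE (RamExpr.keyE q h)).den
      (Function.update (Function.update env 10 j) 11 i) M' =
      x.entry q p (x.key q (ordAt x M) p i) := by
    rw [RamExpr.den_tableE hN2, RamExpr.den_posE hN2, RamExpr.den_keyE hq H' hN2, hpos,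
      Function.update_self, hkey]
  have hV : (RamExpr.valueE q h sa ta).den (Function.update (Function.update env 10 j) 11 i) M' =
      x.value q s t M p i := by
    rw [RamExpr.den_valueE hq H' hN2, hpos, Function.update_self]
    exact CutInstance.value_congr hq i1 hpN (fun l hl _ κ hκ => i2 l (by omega) κ hκ) i
  have h00 : Function.update (Function.update env 10 j) 11 i 0 = env 0 := by
    rw [Function.update_of_ne (by decide), Function.update_of_ne (by decide)]
  have hklt : x.key q (ordAt x M) p i < q ^ x.bound := by
    rw [CutInstance.key_congr e1 hpN]
    exact CutInstance.key_lt hq ho p i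
  simp only [Cmd.den, RamExpr.den_add, RamExpr.den_load, hA, hV, h00]
  set k := x.key q (ordAt x M) p i with hk
  refine ⟨fun a ha => ?_, fun r hr κ hκ => ?_, fun κ hκ => ?_⟩
  · rw [Function.update_of_ne (by have := h3 p k; omega), i1 a ha]
  · rw [Function.update_of_ne, i2 r hr κ hκ]
    exact fun he => hr (CutInstance.entry_inj hκ hklt he).1
  · rw [Finset.range_add_one, Finset.filter_insert]
    by_cases hκk : κ = k
    · subst hκk
      rw [Function.update_self, if_pos rfl, Finset.sum_insert (by simp), ZMod.natCast_mod,
        Nat.cast_add, i3 k hklt, add_comm]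
    · rw [Function.update_of_ne fun he => hκk (CutInstance.entry_inj hκ hklt he).2,
        if_neg (Ne.symm hκk), i3 κ hκ]

/-! ### The colourings of a bag -/

theorem sum_ind_eq_card (A : Finset ℕ) (p : ℕ → Prop) [DecidablePred p] :
    ∑ i ∈ A, ind (p i) = (A.filter p).card := by
  rw [Finset.card_filter]
  refine Finset.sum_congr rfl fun i _ => ?_
  by_cases hp : p i
  · rw [ind_pos hp, if_pos hp]
  · rw [ind_neg hp, if_neg hp]

theorem card_filter_lt_strictMono {A : Finset ℕ} {u v : ℕ} (hu : u ∈ A) (huv : u < v) :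
    (A.filter (· < u)).card < (A.filter (· < v)).card := by
  refine Finset.card_lt_card ?_
  rw [Finset.ssubset_iff_of_subset fun w hw => ?_]
  · exact ⟨u, by simp [hu, huv], by simp⟩
  · rw [Finset.mem_filter] at hw ⊢
    exact ⟨hw.1, hw.2.trans huv⟩

/-- The rank is injective on `A` with values below `|A|`, hence takes all of them. -/
theorem exists_card_filter_lt_eq {A : Finset ℕ} {r : ℕ} (hr : r < A.card) :
    ∃ v ∈ A, (A.filter (· < v)).card = r := by
  have hmaps : Set.MapsTo (fun v => (A.filter (· < v)).card) A (Finset.range A.card) := by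
    intro v hv
    rw [Finset.mem_coe, Finset.mem_range]
    refine Finset.card_lt_card ?_
    rw [Finset.ssubset_iff_of_subset (Finset.filter_subset _ _)]
    exact ⟨v, hv, by simp⟩
  have hinj : Set.InjOn (fun v => (A.filter (· < v)).card) A := by
    intro u hu v hv huv
    rcases lt_trichotomy u v with hl | hl | hl
    · exact absurd huv (card_filter_lt_strictMono hu hl).ne
    · exact hl
    · exact absurd huv (card_filter_lt_strictMono hv hl).ne'
  obtain ⟨v, hv, h⟩ := Finset.surjOn_of_injOn_of_card_le _ hmaps hinj (by simp)
    (Finset.mem_coe.2 (Finset.mem_range.2 hr))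
  exact ⟨v, hv, h⟩

theorem eq_of_digits_eq {q b : ℕ} : ∀ {c d : ℕ}, c < q ^ b → d < q ^ b →
    (∀ r < b, c / q ^ r % q = d / q ^ r % q) → c = d := by
  induction b with
  | zero => intro c d hc hd _; simp at hc hd; omega
  | succ b ih =>
    intro c d hc hd h
    have h0 : c % q = d % q := by simpa using h 0 (by omega)
    have h1 : c / q = d / q := by
      refine ih (Nat.div_lt_of_lt_mul (by rwa [← pow_succ']))
        (Nat.div_lt_of_lt_mul (by rwa [← pow_succ'])) fun r hr => ?_
      have := h (r + 1) (by omega)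
      rwa [pow_succ', ← Nat.div_div_eq_div_mul, ← Nat.div_div_eq_div_mul] at this
    rw [← Nat.div_add_mod c q, ← Nat.div_add_mod d q, h0, h1]

variable {x : CutInstance} {q s t : ℕ}

open Classical in
theorem CutInstance.bagCard_eq (i : Fin x.m) : x.bagCard i = (x.D.bag i).card := by
  rw [CutInstance.bagCard, sum_ind_eq_card,
    ← Finset.card_map (f := Fin.valEmbedding) (s := x.D.bag i)]
  congr 1
  ext v
  simp only [Finset.mem_filter, Finset.mem_range, Finset.mem_map, Fin.valEmbedding_apply]
  constructor
  · rintro ⟨-, hi, hv, hb⟩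
    exact ⟨⟨v, hv⟩, hb, rfl⟩
  · rintro ⟨w, hw, rfl⟩
    exact ⟨by have := w.2; unfold CutInstance.bound; omega, i.2, w.2, hw⟩

/-- Each digit of the number of a colouring is the colour of a vertex. -/
theorem CutInstance.exists_rank_eq {i : ℕ} {r : ℕ} (hr : r < x.bagCard i) :
    ∃ v, x.InBag i v ∧ x.rank i v = r := by
  classical
  rw [CutInstance.bagCard, sum_ind_eq_card] at hr
  obtain ⟨v, hv, h⟩ := exists_card_filter_lt_eq hr
  refine ⟨v, (Finset.mem_filter.1 hv).2, ?_⟩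
  rw [CutInstance.rank, sum_ind_eq_card, ← h, Finset.filter_filter]
  congr 2
  funext u
  rw [and_comm]

theorem CutInstance.color_inj {i c d : ℕ} (hc : c < q ^ x.bagCard i) (hd : d < q ^ x.bagCard i)
    (h : ∀ v, x.color q i c v = x.color q i d v) : c = d := by
  refine eq_of_digits_eq hc hd fun r hr => ?_
  obtain ⟨v, hv, rfl⟩ := x.exists_rank_eq hr
  have := h v
  rwa [CutInstance.color, CutInstance.color, ind_pos hv, one_mul, one_mul] at this

/-- A colouring, extended by zero to all natural numbers. -/
def extZero {n : ℕ} (k : Fin n → Fin q) (v : ℕ) : ℕ := if h : v < n then k ⟨v, h⟩ else 0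

theorem extZero_coe {n : ℕ} (k : Fin n → Fin q) (v : Fin n) : extZero k v = k v := by
  simp [extZero]

section Colorings

variable [NeZero q]

/-- The colouring number `c` of the bag of `i`. -/
noncomputable def CutInstance.dec (x : CutInstance) (q : ℕ) [NeZero q] (i c : ℕ) :
    Fin x.n → Fin q :=
  fun v => ⟨x.color q i c v, x.color_lt (NeZero.pos q) _ _ _⟩

theorem extZero_lt {n : ℕ} (k : Fin n → Fin q) (v : ℕ) : extZero k v < q := by
  unfold extZero
  split_ifs
  · exact Fin.is_lt _
  · exact NeZero.pos q

theorem CutInstance.extZero_dec (i c v : ℕ) : extZero (x.dec q i c) v = x.color q i c v := by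
  unfold extZero
  split_ifs with hv
  · rfl
  · rw [CutInstance.color, ind_neg fun h => hv h.2.1, zero_mul]

/-- The number that represents a colouring in the table. -/
def CutInstance.colorCode (x : CutInstance) (k : Fin x.n → Fin q) : ℕ :=
  ∑ v ∈ Finset.range x.bound, extZero k v * q ^ v

theorem CutInstance.colorCode_lt (k : Fin x.n → Fin q) : x.colorCode k < q ^ x.bound :=
  sum_mul_pow_lt _ (extZero_lt k) _

theorem CutInstance.colorCode_inj {k k' : Fin x.n → Fin q}
    (h : x.colorCode k = x.colorCode k') : k = k' := by
  funext v
  have hv : (v : ℕ) < x.bound := by have := v.2; unfold CutInstance.bound; omega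
  have h1 := sum_mul_pow_div_mod _ (extZero_lt k) hv
  have h2 := sum_mul_pow_div_mod _ (extZero_lt k') hv
  unfold CutInstance.colorCode at h
  rw [h, h2, extZero_coe, extZero_coe] at h1
  exact (Fin.ext h1).symm

theorem CutInstance.colorCode_zero : x.colorCode (0 : Fin x.n → Fin q) = 0 := by
  refine Finset.sum_eq_zero fun v _ => ?_
  simp [extZero]

open Classical in
/-- The numbers of the colourings of a bag. -/
theorem CutInstance.sum_dec {R : Type*} [AddCommMonoid R] (i : Fin x.m)
    (f : (Fin x.n → Fin q) → R) :
    ∑ c ∈ Finset.range (q ^ x.bagCard i), f (x.dec q i c) =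
      ∑ b ∈ colorings (Fin q) (x.D.bag i), f b := by
  have hmaps : Set.MapsTo (x.dec q i) (Finset.range (q ^ x.bagCard i))
      (colorings (Fin q) (x.D.bag i)) := by
    intro c _
    rw [Finset.mem_coe, mem_colorings]
    intro v hv
    refine Fin.ext ?_
    simp only [CutInstance.dec, CutInstance.color]
    rw [ind_neg fun h => hv h.2.2, zero_mul]
    rfl
  have hinj : Set.InjOn (x.dec q i) (Finset.range (q ^ x.bagCard i)) := by
    intro c hc d hd hcd
    refine x.color_inj (Finset.mem_range.1 hc) (Finset.mem_range.1 hd) fun v => ?_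
    rw [← extZero_dec, ← extZero_dec, hcd]
  refine Finset.sum_nbij _ hmaps hinj ?_ fun _ _ => rfl
  -- Surjectivity follows by counting: a bag `B` has `q ^ |B|` colourings.
  refine Finset.surjOn_of_injOn_of_card_le _ hmaps hinj ?_
  rw [Finset.card_range, colorings, Fintype.card_piFinset, x.bagCard_eq]
  refine le_of_eq ?_
  have : ∀ v, (if v ∈ x.D.bag i then Finset.univ else ({0} : Finset (Fin q))).card =
      if v ∈ x.D.bag i then q else 1 := by
    intro v
    split_ifs <;> simp
  rw [Finset.prod_congr rfl fun v _ => this v, Finset.prod_ite]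
  simp

open Classical in
/-- A sum over the indicators of the members of a bag gives the code of a restriction. -/
theorem CutInstance.sum_restr (A : Finset (Fin x.n)) (a : ℕ → ℕ) (i c : ℕ)
    (ha : ∀ v : Fin x.n, a v = if v ∈ A then 1 else 0) :
    ∑ v ∈ Finset.range x.bound, a v * (x.color q i c v * q ^ v) =
      x.colorCode (restr A (x.dec q i c)) := by
  refine Finset.sum_congr rfl fun v _ => ?_
  by_cases hv : v < x.n
  · rw [ha ⟨v, hv⟩, ← extZero_dec]
    simp only [extZero, hv, dif_pos, restr_apply]
    by_cases hA : (⟨v, hv⟩ : Fin x.n) ∈ A <;> simp [hA]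
  · rw [← extZero_dec]
    simp [extZero, hv]

end Colorings

/-! ### The local factors -/

-- Each pair that is equal or adjacent lies in some bag and is charged only to the smallest such
-- node, so its factor occurs exactly once. All other pairs have factor `1`, wherever they are
-- charged.
open Classical in
theorem CutInstance.prod_localValue (mem : ℕ → ℕ) {o : ℕ → Fin x.m}
    (ho : IsSearchOrder x.D.tree o) (c : Fin x.n → Fin q) :
    ∏ r ∈ Finset.range x.m, x.localValue q s t mem (o r) (extZero c) =
      ∏ u, ∏ v, pairFactor x.G q s t (fun v => x.weight mem v) (2 ^ x.bound ^ 4) u v (c u) (c v) := by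
  have hnN : x.n ≤ x.bound := by unfold CutInstance.bound; omega
  have restrict : ∀ f : ℕ → ℕ, (∀ u, x.n ≤ u → f u = 1) →
      ∏ u ∈ Finset.range x.bound, f u = ∏ u : Fin x.n, f u := by
    intro f hf
    rw [← Finset.prod_range]
    refine (Finset.prod_subset (Finset.range_mono hnN) fun u _ hu => hf u ?_).symm
    simpa using hu
  unfold CutInstance.localValue
  rw [Finset.prod_comm, restrict]
  swap
  · intro u hu
    refine Finset.prod_eq_one fun r _ => Finset.prod_eq_one fun v _ => ?_
    rw [if_neg fun h => absurd h.1.2.1 (by omega)]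
  refine Finset.prod_congr rfl fun u _ => ?_
  rw [Finset.prod_comm, restrict]
  swap
  · intro v hv
    refine Finset.prod_eq_one fun r _ => ?_
    rw [if_neg fun h => absurd h.2.1.2.1 (by omega)]
  refine Finset.prod_congr rfl fun v _ => ?_
  have hpair : x.pairValue q s t mem u v (extZero c u) (extZero c v) =
      pairFactor x.G q s t (fun v => x.weight mem v) (2 ^ x.bound ^ 4) u v (c u) (c v) := by
    have hadj : x.Adj u v ↔ x.G.Adj u v := ⟨fun h => h.2.2, fun h => ⟨u.2, v.2, h⟩⟩
    simp only [CutInstance.pairValue, pairFactor, extZero_coe, hadj, Fin.ext_iff, Fin.lt_def]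
  rw [hpair]
  by_cases huv : u = v ∨ x.G.Adj u v
  · have hex : ∃ i, x.InBag i u ∧ x.InBag i v := by
      rcases huv with rfl | hadj
      · obtain ⟨i, hi⟩ := x.D.vertex_mem u
        exact ⟨i, ⟨i.2, u.2, hi⟩, ⟨i.2, u.2, hi⟩⟩
      · obtain ⟨i, hi, hi'⟩ := x.D.edge_mem u v hadj
        exact ⟨i, ⟨i.2, u.2, hi⟩, ⟨i.2, v.2, hi'⟩⟩
    have hown : x.Own (Nat.find hex) u v :=
      ⟨(Nat.find_spec hex).1, (Nat.find_spec hex).2, fun j hj => Nat.find_min hex hj⟩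
    obtain ⟨r, hr, hor⟩ := ho.exists_index ⟨Nat.find hex, hown.1.1⟩
    rw [Finset.prod_eq_single r]
    · rw [hor, if_pos hown]
    · intro r' hr' hne
      refine if_neg fun hown' => hne (ho.inj _ (Finset.mem_range.1 hr') _ hr ?_)
      rw [hor]
      refine Fin.ext (le_antisymm ?_ ?_)
      · by_contra hlt
        exact hown'.2.2 _ (not_le.1 hlt) ⟨hown.1, hown.2.1⟩
      · exact Nat.find_min' hex ⟨hown'.1, hown'.2.1⟩
    · intro h
      exact absurd (Finset.mem_range.2 hr) h
  · push Not at huv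
    have : pairFactor x.G q s t (fun v => x.weight mem v) (2 ^ x.bound ^ 4) u v (c u) (c v) = 1 := by
      rw [pairFactor, if_neg huv.1, if_neg fun h => huv.2 h.2]
    rw [this]
    exact Finset.prod_eq_one fun r _ => by simp

/-! ### The result of the dynamic program -/

-- A position has at most one parent, so the sum over parents is an indicator. Hence `key` is a
-- valid code in base `q`.
open Classical in
theorem CutInstance.parBag_eq {o : ℕ → ℕ} {a : ℕ}
    (hu : ∀ b b', x.IsPar o a b → x.IsPar o a b' → b = b') (v : ℕ) :
    x.parBag o a v = if ∃ b, x.IsPar o a b ∧ x.InBag (o b) v then 1 else 0 := by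
  have hmN : x.m ≤ x.bound := by unfold CutInstance.bound; omega
  rw [CutInstance.parBag]
  split_ifs with hex
  · obtain ⟨b, hb, hv⟩ := hex
    rw [Finset.sum_eq_single b]
    · exact ind_pos ⟨hb, hv⟩
    · exact fun b' _ hne => ind_neg fun h => hne (hu _ _ h.1 hb)
    · intro hb'
      have h1 := hb.1
      have h2 := hb.2.1
      exact absurd (Finset.mem_range.2 (by omega)) hb'
  · exact Finset.sum_eq_zero fun b _ => ind_neg fun h => hex ⟨b, h⟩

theorem CutInstance.isPar_iff {o : ℕ → ℕ} {o' : ℕ → Fin x.m} (h : ∀ r < x.m, (o' r : ℕ) = o r)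
    (a b : ℕ) : x.IsPar o a b ↔ a < x.m ∧ b < a ∧ x.D.tree.Adj (o' b) (o' a) := by
  refine and_congr_right fun ha => and_congr_right fun hb => ?_
  rw [← h a ha, ← h b (by omega)]
  exact ⟨fun h => h.2.2, fun h => ⟨Fin.is_lt _, Fin.is_lt _, h⟩⟩

theorem CutInstance.isPar_unique {o : ℕ → ℕ} {o' : ℕ → Fin x.m} (ho : IsSearchOrder x.D.tree o')
    (h : ∀ r < x.m, (o' r : ℕ) = o r) (a b b' : ℕ) (h1 : x.IsPar o a b) (h2 : x.IsPar o a b') :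
    b = b' := by
  rw [isPar_iff h] at h1 h2
  exact ho.adj_unique x.D.isTree.isAcyclic h1.1 h1.2.1 h2.2.1 h1.2.2 h2.2.2

/-- If the rows of the table satisfy the recurrence, then the entry of the root is the generating
number. -/
theorem CutInstance.table_root_eq [NeZero q] {K Q : ℕ} {mem : ℕ → ℕ} {ω : ℕ → Bool}
    {o : ℕ → Fin x.m} (ho : IsSearchOrder x.D.tree o)
    (hmem : ∀ r < x.m, (o r : ℕ) = ordAt x mem r)
    (hQ : ∀ i : Fin x.m, q ^ x.bagCard i ≤ Q)
    (hcoin : ∀ a < x.bound ^ 2, mem (x.bound ^ 2 + a) = if ω a then 1 else 0)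
    (htable : ∀ p < x.m, ∀ κ < q ^ x.bound, (mem (x.entry q p κ) : ZMod K) =
      ∑ c ∈ Finset.range Q with x.key q (ordAt x mem) p c = κ,
        (x.value q s t mem p c : ZMod K)) :
    (mem (x.entry q 0 0) : ZMod K) =
      genNumber x.G q s t x.bound (fun v b => ω (v * x.bound + b)) := by
  classical
  have hmN : x.m ≤ x.bound := by unfold CutInstance.bound; omega
  have hm : 0 < x.m := by
    have := x.D.isTree.connected.nonempty
    exact Fin.pos_iff_nonempty.2 this
  have huniq := CutInstance.isPar_unique ho hmem
  let B : ℕ → Finset (Fin x.n) := fun r => x.D.bag (o r)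
  let Bp : ℕ → Finset (Fin x.n) := fun r =>
    Finset.univ.filter fun v => ∃ b, x.IsPar (ordAt x mem) r b ∧ v ∈ B b
  have hB : ∀ r < x.m, ∀ v : Fin x.n, x.InBag (ordAt x mem r) v ↔ v ∈ B r := by
    intro r hr v
    rw [← hmem r hr]
    exact ⟨fun h => h.2.2, fun h => ⟨Fin.is_lt _, v.2, h⟩⟩
  have hkey : ∀ r < x.m, ∀ c, x.key q (ordAt x mem) r c =
      x.colorCode (restr (Bp r) (x.dec q (o r) c)) := by
    intro r hr c
    rw [CutInstance.key, ← hmem r hr]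
    refine x.sum_restr _ _ _ _ fun v => ?_
    rw [x.parBag_eq (huniq r)]
    refine if_congr ?_ rfl rfl
    simp only [Bp, Finset.mem_filter, Finset.mem_univ, true_and]
    refine exists_congr fun b => and_congr_right fun hb => hB b ?_ v
    exact hb.2.1.trans hb.1
  have hchild : ∀ r < x.m, ∀ j < x.m, ∀ c, x.childKey q (ordAt x mem) r j c =
      x.colorCode (restr (B j) (x.dec q (o r) c)) := by
    intro r hr j hj c
    rw [CutInstance.childKey, ← hmem r hr]
    refine x.sum_restr _ _ _ _ fun v => ?_
    by_cases hv : v ∈ B j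
    · rw [if_pos hv, ind_pos ((hB j hj v).2 hv)]
    · rw [if_neg hv, ind_neg fun h => hv ((hB j hj v).1 h)]
  -- The messages are the table entries, indexed by the codes of colourings, and the calculation
  -- takes place modulo `K`.
  have hroot := message_root_eq (C := Fin q) (R := ZMod K) hm B Bp (x.IsPar (ordAt x mem))
    (fun _ _ h => h.2.1) huniq
    (fun r hr hr0 => by
      obtain ⟨b, hb, hadj⟩ := ho.exists_adj r hr hr0
      exact ⟨b, (CutInstance.isPar_iff hmem r b).2 ⟨hr, hb, hadj⟩⟩)
    (fun r b b' hr hb hpar v hv => by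
      rw [CutInstance.isPar_iff hmem] at hpar
      rw [Finset.mem_inter] at hv
      exact ho.running_intersection x.D.isTree.isAcyclic (x.D.connected v) hr hb hpar.2.1
        hpar.2.2 hv.1 hv.2)
    (fun r b hpar => by
      ext v
      simp only [Bp, Finset.mem_filter, Finset.mem_univ, true_and]
      constructor
      · rintro ⟨b', hb', hv⟩
        rwa [huniq r b b' hpar hb']
      · exact fun hv => ⟨b, hpar, hv⟩)
    (by
      ext v
      simp only [Bp, Finset.mem_filter, Finset.mem_univ, true_and, Finset.notMem_empty, iff_false]
      rintro ⟨b, hb, -⟩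
      exact absurd hb.2.1 (by omega))
    (fun r c => (x.localValue q s t mem (o r) (extZero c) : ZMod K))
    (fun r c c' h => by
      congr 1
      refine Finset.prod_congr rfl fun u _ => Finset.prod_congr rfl fun v _ => ?_
      by_cases hown : x.Own (o r) u v
      · have hu : extZero c u = extZero c' u := by
          have hu := hown.1.2.1
          rw [extZero, extZero, dif_pos hu, dif_pos hu, h ⟨u, hu⟩ hown.1.2.2]
        have hv : extZero c v = extZero c' v := by
          have hv := hown.2.1.2.1
          rw [extZero, extZero, dif_pos hv, dif_pos hv, h ⟨v, hv⟩ hown.2.1.2.2]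
        rw [hu, hv]
      · rw [if_neg hown, if_neg hown])
    (fun r k => (mem (x.entry q r (x.colorCode k)) : ZMod K))
    -- The surplus rounds, from `q ^ |B|` up to `Q`, contribute zero because of the indicator in
    -- `value`.
    (fun r hr k => by
      rw [htable r hr _ (x.colorCode_lt k), Finset.sum_filter]
      have hsub : Finset.range (q ^ x.bagCard (o r)) ⊆ Finset.range Q :=
        Finset.range_mono (hQ _)
      rw [← Finset.sum_subset hsub fun c _ hc => ?_]
      · rw [Finset.sum_filter, ← x.sum_dec (o r)]
        refine Finset.sum_congr rfl fun c hc => ?_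
        refine if_congr ?_ ?_ rfl
        · rw [hkey r hr]
          exact ⟨fun h => x.colorCode_inj h, fun h => by rw [h]⟩
        · rw [CutInstance.value, ← hmem r hr, ind_pos (Finset.mem_range.1 hc), one_mul,
            Nat.cast_mul, Nat.cast_prod]
          congr 1
          · congr 2
            funext v
            rw [CutInstance.extZero_dec]
          · rw [Finset.prod_filter]
            refine (Finset.prod_subset (Finset.range_mono hmN) fun j _ hj => ?_).symm.trans
              (Finset.prod_congr rfl fun j hj => ?_)
            · rw [if_neg fun h => hj (Finset.mem_range.2 h.1), Nat.cast_one]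
            · rw [hchild r hr j (Finset.mem_range.1 hj)]
              split_ifs <;> simp
      · rw [CutInstance.value, ← hmem r hr, ind_neg fun h => hc (Finset.mem_range.2 h)]
        simp)
  rw [CutInstance.colorCode_zero] at hroot
  rw [hroot]
  have hU : (Finset.range x.m).biUnion B = Finset.univ := by
    ext v
    simp only [Finset.mem_biUnion, Finset.mem_range, Finset.mem_univ, iff_true, B]
    obtain ⟨i, hi⟩ := x.D.vertex_mem v
    obtain ⟨r, hr, rfl⟩ := ho.exists_index i
    exact ⟨r, hr, hi⟩
  have hall : colorings (Fin q) (Finset.univ : Finset (Fin x.n)) = Finset.univ := by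
    ext c
    simp [mem_colorings]
  rw [hU, hall, genNumber, partitionFn, Nat.cast_sum]
  refine Finset.sum_congr rfl fun c _ => ?_
  rw [← Nat.cast_prod, x.prod_localValue mem ho c]
  have hy : 2 ^ x.bound ^ 4 = (2 ^ x.bound ^ 2) ^ x.bound ^ 2 := by
    rw [← pow_mul, ← pow_add]
  have hw : (fun v : Fin x.n => x.weight mem v) = fun v : Fin x.n =>
      ∑ b ∈ Finset.range x.bound, if ω (v * x.bound + b) then (2 ^ x.bound ^ 2) ^ b else 0 := by
    funext v
    refine Finset.sum_congr rfl fun b hb => ?_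
    have hv : (v : ℕ) < x.bound := by have := v.2; unfold CutInstance.bound; omega
    have := lt_mul_of_lt hv (Finset.mem_range.1 hb)
    rw [hcoin _ (by rwa [sq])]
    split_ifs <;> simp
  rw [hw, hy]

variable {x : CutInstance} {q h sa ta s t : ℕ}

/-! ### The answer -/

theorem sum_ne_zero_iff_nat {A : Finset ℕ} {f : ℕ → ℕ} :
    ∑ i ∈ A, f i ≠ 0 ↔ ∃ i ∈ A, f i ≠ 0 := by
  rw [Ne, Finset.sum_eq_zero_iff]
  push Not
  rfl

/-- Loop variables only range below `N`, so a place below `N ^ 4` is written with four digits in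
base `N`. -/
theorem lt_pow_four_iff {N I : ℕ} : I < N ^ 4 ↔
    ∃ a < N, ∃ b < N, ∃ c < N, ∃ d < N, I = ((a * N + b) * N + c) * N + d := by
  constructor
  · intro hI
    have hN : 0 < N := by
      rcases Nat.eq_zero_or_pos N with rfl | hN
      · simp at hI
      · exact hN
    refine ⟨I / N / N / N, ?_, I / N / N % N, Nat.mod_lt _ hN, I / N % N, Nat.mod_lt _ hN,
      I % N, Nat.mod_lt _ hN, ?_⟩
    · rw [Nat.div_div_eq_div_mul, Nat.div_div_eq_div_mul]
      exact Nat.div_lt_of_lt_mul (by convert hI using 1; ring)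
    · rw [Nat.div_add_mod', Nat.div_add_mod', Nat.div_add_mod']
  · rintro ⟨a, ha, b, hb, c, hc, d, hd, rfl⟩
    have := lt_mul_of_lt (lt_mul_of_lt (lt_mul_of_lt ha hb) hc) hd
    calc _ < N * N * N * N := this
      _ = N ^ 4 := by ring

theorem RamExpr.den_answerE {mem env : ℕ → ℕ} (hN : env 1 = x.bound) (hk : mem 2 = x.k) :
    (answerE q).den env mem ≠ 0 ↔ Test x.bound x.k (q - 2) (mem (3 * x.bound ^ 2)) := by
  simp only [answerE, den_sum, hN, update_one (show 1 ≠ 37 by decide) hN,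
    update_one (show 1 ≠ 38 by decide) (update_one (show 1 ≠ 37 by decide) hN _),
    update_one (show 1 ≠ 39 by decide) (update_one (show 1 ≠ 38 by decide)
      (update_one (show 1 ≠ 37 by decide) hN _) _), sum_ne_zero_iff_nat]
  have key : ∀ a < x.bound, ∀ b < x.bound, ∀ c < x.bound, ∀ d < x.bound,
      (ltE (kE * (NE * NE)) (placeE + 1) *
        modE (load (3 * (NE * NE)) / (powE (var 37) (towerE 42 5) 41 *
        (powE (var 38) (towerE 42 4) 41 * (powE (var 39) (towerE 42 3) 41 *
          powE (var 40) (towerE 42 2) 41))) / const (2 ^ (q - 2))) 2).den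
        (Function.update (Function.update (Function.update (Function.update env 37 a) 38 b) 39 c)
          40 d) mem ≠ 0 ↔ x.k * x.bound ^ 2 ≤ ((a * x.bound + b) * x.bound + c) * x.bound + d ∧
        mem (3 * x.bound ^ 2) / (2 ^ x.bound ^ 2) ^
          (((a * x.bound + b) * x.bound + c) * x.bound + d) / 2 ^ (q - 2) % 2 = 1 := by
    intro a ha b hb c hc d hd
    set env' := Function.update (Function.update (Function.update (Function.update env 37 a) 38 b)
      39 c) 40 d with henv
    have e1 : env' 1 = x.bound := by simp [henv, hN]
    have ea : env' 37 = a := by simp [henv]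
    have eb : env' 38 = b := by simp [henv]
    have ec : env' 39 = c := by simp [henv]
    have ed : env' 40 = d := by simp [henv]
    have htow : ∀ (y r : ℕ), y ≠ 41 → (towerE 42 r).fresh 41 = true → env' y < x.bound →
        (powE (var y) (towerE 42 r) 41).den env' mem = (2 ^ x.bound ^ r) ^ env' y := by
      intro y r hy hf hlt
      rw [den_powE (by decide) (by simpa [fresh] using hy) hf _ _
        (by rw [den_towerE _ _ (by decide)]; positivity) (by rw [den_var, e1]; exact hlt.le),
        den_towerE _ _ (by decide), den_var, e1]
    -- `powE` allows only exponents up to `N`, so the power is assembled from the digits of the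
    -- place.
    have e2 : (2 ^ x.bound ^ 5) ^ a * ((2 ^ x.bound ^ 4) ^ b * ((2 ^ x.bound ^ 3) ^ c *
        (2 ^ x.bound ^ 2) ^ d)) =
        (2 ^ x.bound ^ 2) ^ (((a * x.bound + b) * x.bound + c) * x.bound + d) := by
      simp only [← pow_mul, ← pow_add]
      congr 1
      ring
    have e3 : (3 * (NE * NE)).den env' mem = 3 * x.bound ^ 2 := by
      simp only [den_mul, den_three, den_NE e1, sq]
    have e4 : (kE * (NE * NE)).den env' mem = x.k * x.bound ^ 2 := by
      simp only [kE, den_mul, den_load, den_two, den_NE e1, hk, sq]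
    have e5 : (placeE + 1).den env' mem =
        ((a * x.bound + b) * x.bound + c) * x.bound + d + 1 := by
      simp only [placeE, den_add, den_mul, den_one, den_NE e1, den_var, ea, eb, ec, ed]
    rw [den_mul, den_ltE, e4, e5, den_modE, den_div, den_div, den_load, e3, den_mul, den_mul,
      den_mul, htow 37 5 (by decide) rfl (by rwa [ea]), htow 38 4 (by decide) rfl (by rwa [eb]),
      htow 39 3 (by decide) rfl (by rwa [ec]), htow 40 2 (by decide) rfl (by rwa [ed]),
      den_const, den_two, ea, eb, ec, ed, e2, mul_ne_zero_iff]
    refine and_congr ?_ ?_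
    · by_cases hlt : x.k * x.bound ^ 2 ≤ ((a * x.bound + b) * x.bound + c) * x.bound + d
      · rw [ind_pos (by omega)]; simp [hlt]
      · rw [ind_neg (by omega)]; simp [hlt]
    · omega
  constructor
  · rintro ⟨a, ha, b, hb, c, hc, d, hd, hne⟩
    rw [Finset.mem_range] at ha hb hc hd
    exact ⟨_, lt_pow_four_iff.2 ⟨a, ha, b, hb, c, hc, d, hd, rfl⟩, (key a ha b hb c hc d hd).1 hne⟩
  · rintro ⟨I, hI, hT⟩
    obtain ⟨a, ha, b, hb, c, hc, d, hd, rfl⟩ := lt_pow_four_iff.1 hI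
    exact ⟨a, Finset.mem_range.2 ha, b, Finset.mem_range.2 hb, c, Finset.mem_range.2 hc, d,
      Finset.mem_range.2 hd, (key a ha b hb c hc d hd).2 hT⟩

/-! ### The memory at the end -/

theorem tableCmd_lt {ω : ℕ → Bool} {env mem : ℕ → ℕ} {τ : ℕ} (h0 : 0 < env 0) {a : ℕ}
    (ha : mem a < env 0) : ((tableCmd q h sa ta).den ω env (mem, τ)).1 a < env 0 := by
  refine Cmd.loop_induction (fun _ s => s.1 a < env 0) ha fun i _ s hs => ?_
  refine Cmd.loop_induction (fun _ s => s.1 a < env 0) hs fun j _ s hs => ?_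
  simp only [Cmd.den]
  rw [Function.update_apply]
  split_ifs
  · rw [Function.update_of_ne (by decide), Function.update_of_ne (by decide)]
    exact Nat.mod_lt _ h0
  · exact hs

theorem CutInstance.le_rounds (i : Fin x.m) : q ^ x.bagCard i ≤ x.rounds q :=
  Finset.single_le_sum (f := fun i => q ^ x.bagCard i) (fun _ _ => Nat.zero_le _)
    (Finset.mem_range.2 (by have := i.2; unfold CutInstance.bound; omega))

/-- The table yields the generating number only modulo `2 ^ N ^ 6`. Both numbers are below this
modulus, so they are equal. -/
theorem mainCmd_spec (hq : q = 3 ∨ q = 4) {mem : ℕ → ℕ} (ω : ℕ → Bool)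
    (H : Holds x h sa ta s t mem) (h0 : ∀ a, x.bound ^ 2 ≤ a → mem a = 0) :
    ((mainCmd q h sa ta).den ω (startEnv x.bound (2 ^ x.bound ^ 6) (x.rounds q)) (mem, 0)).1 2 =
      x.k ∧
    ((mainCmd q h sa ta).den ω (startEnv x.bound (2 ^ x.bound ^ 6) (x.rounds q)) (mem, 0)).1
      (3 * x.bound ^ 2) = genNumber x.G q s t x.bound (fun v b => ω (v * x.bound + b)) := by
  have : NeZero q := ⟨by omega⟩
  have hb : 5 ≤ x.bound := by unfold CutInstance.bound; omega
  have hmN : x.m ≤ x.bound := by unfold CutInstance.bound; omega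
  have hbb : 5 * x.bound ≤ x.bound ^ 2 := by rw [sq]; exact Nat.mul_le_mul_right _ hb
  have hKb : x.bound < 2 ^ x.bound ^ 6 :=
    Nat.lt_two_pow_self.trans_le
      (Nat.pow_le_pow_right Nat.two_pos (Nat.le_self_pow (by decide) _))
  set env := startEnv x.bound (2 ^ x.bound ^ 6) (x.rounds q) with henv
  have hN : env 1 = x.bound := by simp [henv]
  have hK : env 0 = 2 ^ x.bound ^ 6 := by simp [henv]
  have hQ : env 2 = x.rounds q := by simp [henv]
  simp only [mainCmd, Cmd.den]
  have c1 := (coinCmd_spec ω env mem).2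
  generalize coinCmd.den ω env (mem, 0) = S1 at c1
  obtain ⟨F1, τ1⟩ := S1
  simp only [hN, ← sq] at c1
  have H1 : Holds x h sa ta s t F1 := H.congr fun a ha => by rw [c1, if_neg (by omega)]
  have c2 := orderCmd_spec ω τ1 H1 hN (by rw [hK]; exact hKb)
  generalize (orderCmd h).den ω env (F1, τ1) = S2 at c2
  obtain ⟨F2, τ2⟩ := S2
  obtain ⟨c2, c3⟩ := c2
  simp only at c2 c3
  have H2 : Holds x h sa ta s t F2 := H1.congr fun a ha => c2 a (by omega)
  obtain ⟨o, ho, hoF⟩ := isSearchOrder_of_greedy x.D.isTree.connected (ordAt x F2)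
    (by rw [ordAt, c2 _ (by omega), c1, if_neg (by omega), h0 _ (by omega)])
    fun r hex hr => c3 r (by omega) hex
  have hpar : ∀ a v, x.parBag (ordAt x F2) a v ≤ 1 := fun a v => by
    classical
    rw [x.parBag_eq (CutInstance.isPar_unique ho hoF a)]
    split_ifs <;> omega
  have hz : ∀ a, 3 * x.bound ^ 2 ≤ a → F2 a = 0 := fun a ha => by
    rw [c2 a (by omega), c1, if_neg (by omega), h0 a (by omega)]
  have c4 := tableCmd_spec (q := q) (NeZero.pos q) ω τ2 H2 hN hpar hz
  have c5 : ((tableCmd q h sa ta).den ω env (F2, τ2)).1 (3 * x.bound ^ 2) < env 0 :=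
    tableCmd_lt (by rw [hK]; positivity) (by rw [hz _ le_rfl, hK]; positivity)
  generalize (tableCmd q h sa ta).den ω env (F2, τ2) = S3 at c4 c5
  obtain ⟨F3, τ3⟩ := S3
  obtain ⟨c4, c6⟩ := c4
  simp only at c4 c5 c6 ⊢
  refine ⟨(H2.congr fun a ha => c4 a (by omega)).k, ?_⟩
  have hroot := x.table_root_eq (mem := F3) (ω := ω) ho
    (fun r hr => by rw [hoF r hr, ordAt_congr c4 (by omega)])
    (fun i => (x.le_rounds i).trans_eq hQ.symm)
    (fun a ha => by
      rw [c4 _ (by omega), c2 _ (by omega), c1,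
        if_pos (show x.bound ^ 2 ≤ x.bound ^ 2 + a ∧ _ from ⟨by omega, by omega⟩),
        Nat.add_sub_cancel_left])
    (fun p hp => c6 p (by omega))
  have hentry : x.entry q 0 0 = 3 * x.bound ^ 2 := by simp [CutInstance.entry]
  rw [hentry, ZMod.natCast_eq_natCast_iff] at hroot
  refine Nat.ModEq.eq_of_lt_of_lt hroot c5 ?_
  rw [hK]
  exact genNumber_lt _ _ _ _ (by omega) (by unfold CutInstance.bound; omega)

/-! ### Running time, encoding and conclusion -/

/-! ### The running time -/

theorem CutInstance.bagCard_le_width (i : ℕ) : x.bagCard i ≤ x.D.width + 1 := by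
  by_cases hi : i < x.m
  · rw [show x.bagCard i = _ from x.bagCard_eq ⟨i, hi⟩, TreeDecomposition.width]
    have := Finset.le_sup (f := fun i => (x.D.bag i).card) (Finset.mem_univ (⟨i, hi⟩ : Fin x.m))
    omega
  · have : x.bagCard i = 0 := Finset.sum_eq_zero fun u _ => ind_neg fun h => hi h.1
    omega

/-- A sum of the numbers of colourings serves as a common number of rounds in place of their
maximum, at the price of a polynomial factor. -/
theorem CutInstance.rounds_le (hq : 0 < q) : x.rounds q ≤ x.bound * q ^ (x.D.width + 1) := by
  refine (Finset.sum_le_sum fun i _ => Nat.pow_le_pow_right hq (x.bagCard_le_width i)).trans ?_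
  simp

/-! ### The input -/

theorem getD_ofFn {N : ℕ} (f : Fin N → ℕ) {a : ℕ} (ha : a < N) :
    (List.ofFn f).getD a 0 = f ⟨a, ha⟩ := by
  rw [List.getD_eq_getElem _ _ (by simpa using ha), List.getElem_ofFn]

theorem divNat_mk {m n i j : ℕ} (hi : i < m) (hj : j < n) (hij : i * n + j < m * n) :
    (⟨i * n + j, hij⟩ : Fin (m * n)).divNat = ⟨i, hi⟩ := by
  refine Fin.ext ?_
  simp only [Fin.divNat]
  rw [mul_comm, Nat.mul_add_div (by omega), Nat.div_eq_of_lt hj, Nat.add_zero]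

theorem modNat_mk {m n i j : ℕ} (hj : j < n) (hij : i * n + j < m * n) :
    (⟨i * n + j, hij⟩ : Fin (m * n)).modNat = ⟨j, hj⟩ := by
  refine Fin.ext ?_
  simp only [Fin.modNat]
  rw [mul_comm, Nat.mul_add_mod, Nat.mod_eq_of_lt hj]

theorem getD_adjCode {n : ℕ} (G : SimpleGraph (Fin n)) {u v : ℕ} (hu : u < n) (hv : v < n) :
    (adjCode G).getD (u * n + v) 0 =
      ind (∃ (hu : u < n) (hv : v < n), G.Adj ⟨u, hu⟩ ⟨v, hv⟩) := by
  rw [adjCode, getD_ofFn _ (lt_mul_of_lt hu hv), divNat_mk hu hv, modNat_mk hv]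
  by_cases hadj : G.Adj ⟨u, hu⟩ ⟨v, hv⟩
  · rw [if_pos hadj, ind_pos ⟨hu, hv, hadj⟩]
  · rw [if_neg hadj, ind_neg fun h => hadj h.2.2]

theorem getD_bagCode {n m : ℕ} (bag : Fin m → Finset (Fin n)) {i v : ℕ} (hi : i < m) (hv : v < n) :
    (bagCode bag).getD (i * n + v) 0 =
      ind (∃ (hi : i < m) (hv : v < n), (⟨v, hv⟩ : Fin n) ∈ bag ⟨i, hi⟩) := by
  rw [bagCode, getD_ofFn _ (lt_mul_of_lt hi hv), divNat_mk hi hv, modNat_mk hv]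
  by_cases hb : (⟨v, hv⟩ : Fin n) ∈ bag ⟨i, hi⟩
  · rw [if_pos hb, ind_pos ⟨hi, hv, hb⟩]
  · rw [if_neg hb, ind_neg fun h => hb h.2.2]

/-- The matrices of an instance after a header `l`. -/
noncomputable def CutInstance.codeWith (x : CutInstance) (l : List ℕ) : List ℕ :=
  l ++ adjCode x.G ++ adjCode x.D.tree ++ bagCode x.D.bag

theorem CutInstance.length_codeWith (l : List ℕ) :
    (x.codeWith l).length = l.length + x.n * x.n + x.m * x.m + x.m * x.n := by
  simp [CutInstance.codeWith, adjCode, bagCode, add_assoc]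

theorem CutInstance.getD_codeWith {l : List ℕ} {a : ℕ} (ha : a < l.length) :
    (x.codeWith l).getD a 0 = l.getD a 0 := by
  rw [CutInstance.codeWith, List.getD_append _ _ _ _ (by simp; omega),
    List.getD_append _ _ _ _ (by simp; omega), List.getD_append _ _ _ _ ha]

theorem CutInstance.holds_codeWith {l : List ℕ} (hl : l.length ≤ 5) (hn : l.getD 0 0 = x.n)
    (hm : l.getD 1 0 = x.m) (hk : l.getD 2 0 = x.k) (hs : l.getD sa 0 = s) (ht : l.getD ta 0 = t)
    (h3 : 2 < l.length) (hsa : sa < l.length) (hta : ta < l.length) :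
    Holds x l.length sa ta s t (fun a => (x.codeWith l).getD a 0) := by
  have hA : (adjCode x.G).length = x.n * x.n := by simp [adjCode]
  have hT : (adjCode x.D.tree).length = x.m * x.m := by simp [adjCode]
  refine ⟨?_, ?_, ?_, ?_, ?_, fun u hu v hv => ?_, fun i hi j hj => ?_, fun i hi v hv => ?_, hl,
    by omega, by omega⟩
  · rw [getD_codeWith (by omega), hn]
  · rw [getD_codeWith (by omega), hm]
  · rw [getD_codeWith h3, hk]
  · rw [getD_codeWith hsa, hs]
  · rw [getD_codeWith hta, ht]
  · have := lt_mul_of_lt hu hv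
    rw [CutInstance.codeWith, List.getD_append _ _ _ _ (by simp only [List.length_append]; omega),
      List.getD_append _ _ _ _ (by simp only [List.length_append]; omega),
      List.getD_append_right _ _ _ _ (by omega), Nat.add_sub_cancel_left]
    exact getD_adjCode _ hu hv
  · have := lt_mul_of_lt hi hj
    rw [CutInstance.codeWith, List.getD_append _ _ _ _ (by simp only [List.length_append]; omega),
      List.getD_append_right _ _ _ _ (by simp only [List.length_append]; omega),
      List.length_append, hA, Nat.add_sub_cancel_left]
    exact getD_adjCode _ hi hj
  · rw [CutInstance.codeWith,
      List.getD_append_right _ _ _ _ (by simp only [List.length_append]; omega),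
      List.length_append, List.length_append, hA, hT, Nat.add_sub_cancel_left]
    exact getD_bagCode _ hi hv

/-! ### The Monte-Carlo algorithms -/

/-- The cut problems have Monte-Carlo algorithms. -/
theorem monteCarloSolvable_of_iff {I : Type} {code : I → List ℕ} {yes : I → Prop} {q : ℕ}
    (hq : q = 3 ∨ q = 4) (inst : I → CutInstance) (header : I → List ℕ) (s t : I → ℕ)
    (h sa ta : ℕ) (hcode : ∀ i, code i = (inst i).codeWith (header i))
    (hlen : ∀ i, (header i).length = h)
    (H : ∀ i, Holds (inst i) h sa ta (s i) (t i) (fun a => (code i).getD a 0))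
    (hyes : ∀ i, yes i ↔ ∃ S : Finset (Fin (inst i).n), Separates (s i) (t i) S ∧
      IsSolution (inst i).G q S ∧ (inst i).k ≤ cutSize (inst i).G S) :
    MonteCarloSolvable code yes q (fun i => (inst i).D.width) := by
  have hq0 : 0 < q := by omega
  obtain ⟨f, hf⟩ := exists_algorithm_spec (D := 50) (by decide)
    (eN := RamExpr.nE + RamExpr.mE + 5) (eK := RamExpr.towerE 30 6) (eQ := RamExpr.roundsE q h)
    (a := RamExpr.answerE q) (c := mainCmd q h sa ta) rfl towerE_wf (roundsE_wf q h)
    (mainCmd_wf q h sa ta) (answerE_wf q) (mainCmd_depth q h sa ta)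
  refine ⟨cutAlgorithm q h sa ta, Polynomial.C q * (Polynomial.X + 6) * f, fun i => ?_⟩
  set y := inst i with hy
  set l := code i with hl
  have Hi : Holds y h sa ta (s i) (t i) (fun a => l.getD a 0) := H i
  have hlength : l.length = h + y.n * y.n + y.m * y.m + y.m * y.n := by
    rw [hl, hcode, CutInstance.length_codeWith, hlen]
  -- The adjacency matrices alone have `n * n + m * m ≥ n + m` entries.
  have hbound : y.bound ≤ inputSize l + 5 := by
    have h1 := length_le_inputSize l
    have h2 := Nat.le_mul_self y.n
    have h3 := Nat.le_mul_self y.m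
    unfold CutInstance.bound
    omega
  have hzero : ∀ a, y.bound ^ 2 ≤ a → l.getD a 0 = 0 := fun a ha => by
    refine List.getD_eq_default _ _ ?_
    have := y.bound_sq
    have := Hi.h_le
    omega
  have hrun : ∀ ω, ∃ σ', Runs ω (cutAlgorithm q h sa ta) (State.init l) σ'
      ((y.rounds q + 1) * f.eval (inputSize l)) ∧
      (σ'.reg 0 ≠ 0 ↔ Test y.bound y.k (q - 2)
        (genNumber y.G q (s i) (t i) y.bound fun v b => ω (v * y.bound + b))) := by
    intro ω
    obtain ⟨σ', h1, h2⟩ := hf l ω y.bound (2 ^ y.bound ^ 6) (y.rounds q)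
      (by
        have e1 := Hi.n
        have e2 := Hi.m
        simp only [RamExpr.nE, RamExpr.mE, RamExpr.den_add, RamExpr.den_load, RamExpr.den_zero, RamExpr.den_one,
          RamExpr.den_five, e1, e2, CutInstance.bound])
      (by rw [RamExpr.den_towerE _ _ (by decide), startEnv_apply_one])
      (RamExpr.den_roundsE hq0 Hi (startEnv_apply_one _ _ _)) hbound (by positivity)
    refine ⟨σ', h1, ?_⟩
    obtain ⟨g1, g2⟩ := mainCmd_spec hq ω Hi hzero
    rw [h2, RamExpr.den_answerE (startEnv_apply_one _ _ _) g1, g2]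
  have haccept : ∀ ω, (cutAlgorithm q h sa ta).Accepts ω l ↔ Test y.bound y.k (q - 2)
      (genNumber y.G q (s i) (t i) y.bound fun v b => ω (v * y.bound + b)) := by
    intro ω
    obtain ⟨σ', ⟨c, hc, -⟩, h2⟩ := hrun ω
    rw [← h2]
    constructor
    · rintro ⟨σ, d, hd, hne⟩
      rwa [hc.deterministic hd]
    · exact fun hne => ⟨σ', c, hc, hne⟩
  have hn5 : y.n + 5 ≤ y.bound := by unfold CutInstance.bound; omega
  refine ⟨fun ω => ?_, fun hno ω hacc => ?_, fun hy' => ?_⟩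
  · obtain ⟨σ', ⟨c, hc, hcT⟩, -⟩ := hrun ω
    refine ⟨σ', c, hc, hcT.trans ?_⟩
    have h1 := y.rounds_le hq0
    have h2 : 1 ≤ q ^ (y.D.width + 1) := Nat.one_le_pow _ _ hq0
    -- The exponent `tw + 1` costs the constant factor `q`; the factor `bound + 1` is at most
    -- `inputSize l + 6`.
    have h3 : y.rounds q + 1 ≤ q ^ y.D.width * (q * (inputSize l + 6)) := by
      calc y.rounds q + 1 ≤ y.bound * q ^ (y.D.width + 1) + q ^ (y.D.width + 1) :=
            Nat.add_le_add h1 h2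
        _ = q ^ y.D.width * (q * (y.bound + 1)) := by ring
        _ ≤ _ := Nat.mul_le_mul_left _ (Nat.mul_le_mul_left _ (by omega))
    calc _ ≤ q ^ y.D.width * (q * (inputSize l + 6)) * f.eval (inputSize l) :=
          Nat.mul_le_mul_right _ h3
      _ = _ := by
        simp only [Polynomial.eval_mul, Polynomial.eval_add, Polynomial.eval_C, Polynomial.eval_X,
          Polynomial.eval_ofNat]
        ring
  · exact hno ((hyes i).2 (exists_of_test _ _ _ _ hq hn5 y.k_pos ((haccept ω).1 hacc)))
  · obtain ⟨F, hF, hT⟩ := exists_family y.G (s i) (t i) hq hn5 y.k_pos ((hyes i).1 hy')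
    -- Rejection forces the random sum of the family from `exists_family` to vanish.
    refine (measure_mono fun ω hω => ?_).trans
      (coinMeasure_family_le (show y.n < y.bound by omega) hF)
    by_contra hne
    exact hω ((haccept ω).2 (hT (fun v b => ω (v * y.bound + b)) hne))

/-- Sets of vertices versus finsets of vertices. -/
theorem exists_set_iff {n k : ℕ} (hk : 0 < k) (G : SimpleGraph (Fin n))
    (P : Set (Fin n) → Prop) :
    (∃ S : Set (Fin n), S ⊂ Set.univ ∧ P S ∧ k ≤ (cutSet G S).ncard) ↔
      ∃ S : Finset (Fin n), P S ∧ k ≤ cutSize G S := by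
  classical
  constructor
  · rintro ⟨S, -, hP, hc⟩
    refine ⟨S.toFinset, by simpa using hP, ?_⟩
    rw [← ncard_cutSet]
    simpa using hc
  · rintro ⟨S, hP, hc⟩
    refine ⟨S, ?_, hP, by rwa [ncard_cutSet]⟩
    -- A cut with at least `k > 0` edges has vertices on both sides, so `S` is automatically proper.
    obtain ⟨v, hv⟩ := (nonempty_of_cutSize_pos (G := G) (S := S) (by omega)).2
    rw [Set.ssubset_univ_iff]
    intro h
    have : v ∈ (S : Set (Fin n)) := by rw [h]; trivial
    exact Finset.mem_compl.1 hv this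

/-- No vertex has the number `n`, so `s = t = n` imposes no condition. This reduces the problems
without terminals to those with terminals. -/
theorem separates_self {n : ℕ} (S : Finset (Fin n)) : Separates n n S :=
  ⟨fun v _ => v.2.ne, fun v _ => v.2.ne⟩

theorem separates_iff {n : ℕ} {s t : Fin n} {S : Finset (Fin n)} :
    Separates s t S ↔ s ∈ S ∧ t ∉ S := by
  constructor
  · rintro ⟨h1, h2⟩
    exact ⟨by by_contra hs; exact h2 s hs rfl, fun ht => h1 t ht rfl⟩
  · rintro ⟨hs, ht⟩
    exact ⟨fun v hv h => ht (Fin.ext h ▸ hv), fun v hv h => hv (Fin.ext h ▸ hs)⟩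

theorem largestBond_iff (x : CutInstance) : LargestBond x ↔
    ∃ S : Finset (Fin x.n), Separates x.n x.n S ∧ IsSolution x.G 4 S ∧ x.k ≤ cutSize x.G S := by
  have := exists_set_iff x.k_pos x.G fun S => (x.G.induce S).Connected ∧ (x.G.induce Sᶜ).Connected
  simp only [and_assoc] at this
  simp [LargestBond, this, IsSolution, separates_self, and_assoc]

theorem maximumConnectedCut_iff (x : CutInstance) : MaximumConnectedCut x ↔
    ∃ S : Finset (Fin x.n), Separates x.n x.n S ∧ IsSolution x.G 3 S ∧ x.k ≤ cutSize x.G S := by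
  have := exists_set_iff x.k_pos x.G fun S => (x.G.induce S).Connected
  simp [MaximumConnectedCut, this, IsSolution, separates_self]

theorem largestSTBond_iff (x : STCutInstance) : LargestSTBond x ↔
    ∃ S : Finset (Fin x.n), Separates x.s x.t S ∧ IsSolution x.G 4 S ∧ x.k ≤ cutSize x.G S := by
  have := exists_set_iff x.k_pos x.G fun S =>
    x.s ∈ S ∧ x.t ∉ S ∧ (x.G.induce S).Connected ∧ (x.G.induce Sᶜ).Connected
  simp only [and_assoc] at this
  simp [LargestSTBond, this, IsSolution, separates_iff, and_assoc]

theorem maximumConnectedSTCut_iff (x : STCutInstance) : MaximumConnectedSTCut x ↔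
    ∃ S : Finset (Fin x.n), Separates x.s x.t S ∧ IsSolution x.G 3 S ∧ x.k ≤ cutSize x.G S := by
  have := exists_set_iff x.k_pos x.G fun S => x.s ∈ S ∧ x.t ∉ S ∧ (x.G.induce S).Connected
  simp only [and_assoc] at this
  simp [MaximumConnectedSTCut, this, IsSolution, separates_iff, and_assoc]

theorem monteCarloSolvable_cut {yes : CutInstance → Prop} {q : ℕ} (hq : q = 3 ∨ q = 4)
    (hyes : ∀ x, yes x ↔ ∃ S : Finset (Fin x.n), Separates x.n x.n S ∧ IsSolution x.G q S ∧
      x.k ≤ cutSize x.G S) :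
    MonteCarloSolvable CutInstance.code yes q (fun x => x.D.width) :=
  -- The number `n` stands in memory cell `0`, which therefore serves as the address of both `s` and
  -- `t`.
  monteCarloSolvable_of_iff hq id (fun x => [x.n, x.m, x.k]) (fun x => x.n) (fun x => x.n) 3 0 0
    (fun _ => rfl) (fun _ => rfl)
    (fun x => x.holds_codeWith (l := [x.n, x.m, x.k]) (by simp) rfl rfl rfl rfl rfl (by simp)
      (by simp) (by simp)) hyes

theorem monteCarloSolvable_stCut {yes : STCutInstance → Prop} {q : ℕ} (hq : q = 3 ∨ q = 4)
    (hyes : ∀ x, yes x ↔ ∃ S : Finset (Fin x.n), Separates x.s x.t S ∧ IsSolution x.G q S ∧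
      x.k ≤ cutSize x.G S) :
    MonteCarloSolvable STCutInstance.code yes q (fun x => x.D.width) :=
  monteCarloSolvable_of_iff hq STCutInstance.toCutInstance
    (fun x => [x.n, x.m, x.k, (x.s : ℕ), (x.t : ℕ)]) (fun x => x.s) (fun x => x.t) 5 3 4
    (fun _ => rfl) (fun _ => rfl)
    (fun x => x.holds_codeWith (l := [x.n, x.m, x.k, (x.s : ℕ), (x.t : ℕ)]) (by simp) rfl rfl rfl
      rfl rfl (by simp) (by simp) (by simp)) hyes

end ConnectedCuts

open ConnectedCuts in
theorem mainTheorem8 :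
    MonteCarloSolvable CutInstance.code LargestBond 4 (fun x => x.D.width) ∧
    MonteCarloSolvable STCutInstance.code LargestSTBond 4 (fun x => x.D.width) ∧
    MonteCarloSolvable CutInstance.code MaximumConnectedCut 3 (fun x => x.D.width) ∧
    MonteCarloSolvable STCutInstance.code MaximumConnectedSTCut 3 (fun x => x.D.width) := by
  exact ⟨monteCarloSolvable_cut (.inr rfl) largestBond_iff,
    monteCarloSolvable_stCut (.inr rfl) largestSTBond_iff,
    monteCarloSolvable_cut (.inl rfl) maximumConnectedCut_iff,
    monteCarloSolvable_stCut (.inl rfl) maximumConnectedSTCut_iff⟩
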